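/- Let $(M,g)$ be a connected, complete, noncompact smooth Riemannian manifold with Riemannian volume measure $\nu$, let $T>0$ and let $V\in C^1(M)$. Let $u\ge 0$ be a classical subsolution of $u_t-\Delta u+Vu=0$ in $M\times(0,T)$: $u$ is of class $C^{2,1}$ on $M\times(0,T)$ (the derivatives $\partial_t u$ and those of order at most two in $x$ exist and are continuous) and $u_t-\Delta u+Vu\le 0$ pointwise there. Let $\varphi\in H^1_{\mathrm{loc}}(M)\cap C^0(M)$, $\varphi>0$, be a weak supersolution of $\Delta\varphi-V\varphi=0$ in $M$: $$\int_M\langle\nabla\varphi,\nabla\eta\rangle\,d\nu+\int_M V\varphi\eta\,d\nu\ge 0\qquad\text{for all } \eta\in C_c^\infty(M),\ \eta\ge 0.$$ Put $d\mu=\varphi^2\,d\nu$ and $w=u/\varphi$ in $M\times(0,T)$. Then $w$ is a weak subsolution of the weighted heat equation $w_t-\Delta_\mu w=0$ in $M\times(0,T)$, that is: 1. $w\in L^2_{\mathrm{loc}}((0,T);H^1_{\mathrm{loc}}(M,d\mu))$; 2. $\partial_t w\in L^1_{\mathrm{loc}}((0,T);H^{-1}_{\mathrm{loc}}(M,d\mu))$;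 3. for every $\psi\in C_c^\infty(M\times(0,T))$ with $\psi\ge 0$, $$\iint_{M\times(0,T)}\bigl(-w\,\partial_t\psi+\langle\nabla w,\nabla\psi\rangle\bigr)\,d\mu\,dt\le 0.$$ Here $\nabla\varphi$ and $\nabla w(\cdot,t)$ are weak gradients, where $F$ is the weak gradient of $f$ if $\int_M\langle F,X\rangle\,d\nu=-\int_M f\operatorname{div}X\,d\nu$ for all compactly supported $C^1$ vector fields $X$, and $H^1_{\mathrm{loc}}(M,d\mu)$ consists of the $f\in L^2_{\mathrm{loc}}(M,d\mu)$ with weak gradient in $L^2_{\mathrm{loc}}(M,d\mu)$. Functions $f$ act as distributions by $\eta\mapsto\int_M f\eta\,d\mu$, $\eta\in C_c^\infty(M)$. -/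

import Mathlib

open MeasureTheory Set Bundle
open scoped Manifold ContDiff

noncomputable section

namespace RiemHeat

/-- The model space `ℝⁿ` with its Euclidean norm. -/
abbrev E (n : ℕ) : Type := EuclideanSpace ℝ (Fin n)

/-- The space `C_c^∞(M)`. -/
def testFunctions (n : ℕ) (M : Type*) [TopologicalSpace M] [ChartedSpace (E n) M] :
    Submodule ℝ (M → ℝ) where
  carrier := {η | ContMDiff (𝓡 n) 𝓘(ℝ, ℝ) ∞ η ∧ HasCompactSupport η}
  add_mem' h₁ h₂ := ⟨h₁.1.add h₂.1, h₁.2.add h₂.2⟩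
  zero_mem' := ⟨contMDiff_const, HasCompactSupport.zero⟩
  smul_mem' c _ h := ⟨(contMDiff_const (c := c)).mul h.1, h.2.mul_left (f := fun _ ↦ c)⟩

section Geometry

variable (n : ℕ) {M : Type*} [TopologicalSpace M] [ChartedSpace (E n) M]
  [IsManifold (𝓡 n) ∞ M] [RiemannianBundle (fun x : M ↦ TangentSpace (𝓡 n) x)]

/-- The `i`-th coordinate vector field `∂/∂xⁱ` of the preferred chart at `x₀`, at the point of `M`
whose coordinates are `y`. -/
def coordVec (x₀ : M) (y : E n) (i : Fin n) :
    TangentSpace (𝓡 n) ((extChartAt (𝓡 n) x₀).symm y) :=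
  mfderiv 𝓘(ℝ, E n) (𝓡 n) (extChartAt (𝓡 n) x₀).symm y (EuclideanSpace.single i (1 : ℝ) : E n)

/-- The matrix `g_{ij}` of the metric in the preferred chart at `x₀`. -/
def metricMatrix (x₀ : M) (y : E n) : Matrix (Fin n) (Fin n) ℝ :=
  Matrix.of fun i j ↦ inner ℝ (coordVec n x₀ y i) (coordVec n x₀ y j)

/-- `√(det g)` in the preferred chart at `x₀`. -/
def volDensity (x₀ : M) (y : E n) : ℝ := √(metricMatrix n x₀ y).det

/-- The measure `√(det g) dx¹ ⋯ dxⁿ` of the preferred chart at `x₀`, as a measure on `M`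
carried by the domain of the chart. -/
def chartVolume [MeasurableSpace M] (x₀ : M) : Measure M :=
  ((volume.restrict (extChartAt (𝓡 n) x₀).target).withDensity
    fun y ↦ ENNReal.ofReal (volDensity n x₀ y)).map (extChartAt (𝓡 n) x₀).symm

/-- The Riemannian volume measure `ν`. The measures `√(det g) dx¹ ⋯ dxⁿ` of any two charts agree on
the intersection of their domains, so that their supremum (the least measure that dominates all of
them) is the measure on `M` which restricts to each of them on the domain of its chart. -/
def vol [MeasurableSpace M] : Measure M := ⨆ x₀ : M, chartVolume n x₀

/-- The gradient of a function: `⟨∇f, v⟩ = df(v)`. -/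
def grad (f : M → ℝ) (x : M) : TangentSpace (𝓡 n) x :=
  haveI : FiniteDimensional ℝ (TangentSpace (𝓡 n) x) :=
    inferInstanceAs (FiniteDimensional ℝ (E n))
  haveI : CompleteSpace (TangentSpace (𝓡 n) x) := FiniteDimensional.complete ℝ _
  (InnerProductSpace.toDual ℝ (TangentSpace (𝓡 n) x)).symm (mfderiv (𝓡 n) 𝓘(ℝ, ℝ) f x)

/-- The components `Xⁱ` of a vector field in the preferred chart at `x₀`. -/
def coordField (x₀ : M) (X : ∀ x : M, TangentSpace (𝓡 n) x) (y : E n) : E n :=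
  mfderiv (𝓡 n) 𝓘(ℝ, E n) (extChartAt (𝓡 n) x₀) ((extChartAt (𝓡 n) x₀).symm y)
    (X ((extChartAt (𝓡 n) x₀).symm y))

/-- The divergence `(1 / √(det g)) ∂ᵢ (√(det g) Xⁱ)`, at `x` computed in the preferred chart
at `x` (the value does not depend on the chart). -/
def divergence (X : ∀ x : M, TangentSpace (𝓡 n) x) (x : M) : ℝ :=
  (volDensity n x (extChartAt (𝓡 n) x x))⁻¹ *
    ∑ i : Fin n, fderiv ℝ (fun y : E n ↦ volDensity n x y * coordField n x X y i)
      (extChartAt (𝓡 n) x x) (EuclideanSpace.single i (1 : ℝ))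

/-- The Laplace–Beltrami operator `Δ = div ∘ ∇`. -/
def laplacian (f : M → ℝ) (x : M) : ℝ := divergence n (grad n f) x

/-- `X` is a compactly supported vector field of class `C¹`. -/
def IsTestField (X : ∀ x : M, TangentSpace (𝓡 n) x) : Prop :=
  ContMDiff (𝓡 n) (𝓡 n).tangent 1 (fun x ↦ (⟨x, X x⟩ : TangentBundle (𝓡 n) M)) ∧
    IsCompact (closure {x | X x ≠ 0})

end Geometry

section Sobolev

variable (n : ℕ) {M : Type*} [TopologicalSpace M] [ChartedSpace (E n) M]
  [IsManifold (𝓡 n) ∞ M] [RiemannianBundle (fun x : M ↦ TangentSpace (𝓡 n) x)] [MeasurableSpace M]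

/-- `f ∈ L²_loc(M, m)`. -/
def MemL2Loc (m : Measure M) (f : M → ℝ) : Prop :=
  ∀ K : Set M, IsCompact K → MemLp f 2 (m.restrict K)

/-- `f ∈ H¹_loc(M, m)` with weak gradient `F`: the function `f` and the (measurable) vector field
`F` are in `L²_loc(M, m)`, and `∫ ⟨F, X⟩ dν = - ∫ f div X dν` for all compactly supported `C¹`
vector fields `X`. The measure `m` is `ν` itself, or `ν` with a positive continuous density; then
both sides are integrals of integrable functions. -/
structure IsH1Loc (m : Measure M) (f : M → ℝ) (F : ∀ x : M, TangentSpace (𝓡 n) x) : Prop where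
  memL2Loc : MemL2Loc m f
  aestronglyMeasurable : ∀ X : (∀ x : M, TangentSpace (𝓡 n) x), IsTestField n X →
    AEStronglyMeasurable (fun x ↦ inner ℝ (F x) (X x)) m
  memL2Loc_grad : MemL2Loc m (fun x ↦ ‖F x‖)
  integral_eq : ∀ X : (∀ x : M, TangentSpace (𝓡 n) x), IsTestField n X →
    ∫ x, inner ℝ (F x) (X x) ∂(vol n : Measure M) = -∫ x, f x * divergence n X x ∂(vol n)

/-- The norm of `H¹(M, m)` on test functions. -/
def h1Norm (m : Measure M) (η : M → ℝ) : ℝ :=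
  √(∫ x, (η x ^ 2 + ‖grad n η x‖ ^ 2) ∂m)

/-- `φ ∈ H¹_loc(M) ∩ C⁰(M)` is a weak supersolution of `Δφ - Vφ = 0`. -/
def IsWeakSupersolution (V φ : M → ℝ) : Prop :=
  Continuous φ ∧ ∃ Φ : (∀ x : M, TangentSpace (𝓡 n) x), IsH1Loc n (vol n) φ Φ ∧
    ∀ η ∈ testFunctions n M, (∀ x, 0 ≤ η x) →
      0 ≤ ∫ x, inner ℝ (Φ x) (grad n η x) ∂(vol n : Measure M) + ∫ x, V x * φ x * η x ∂(vol n)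

/-- `u` is of class `C^{2,1}` on `M × (0, T)`: the time derivative and the space derivatives up to
order two (in the charts) exist and are continuous on `M × (0, T)`. -/
structure IsC21 (T : ℝ) (u : M → ℝ → ℝ) : Prop where
  contMDiff : ∀ t ∈ Ioo 0 T, ContMDiff (𝓡 n) 𝓘(ℝ, ℝ) 2 (fun x ↦ u x t)
  continuousOn_space : ∀ (x₀ : M) (k : ℕ), k ≤ 2 → ContinuousOn
    (fun p : E n × ℝ ↦
      iteratedFDeriv ℝ k (fun y ↦ u ((extChartAt (𝓡 n) x₀).symm y) p.2) p.1)
    ((extChartAt (𝓡 n) x₀).target ×ˢ Ioo 0 T)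
  differentiableAt : ∀ x, ∀ t ∈ Ioo 0 T, DifferentiableAt ℝ (u x) t
  continuousOn_deriv :
    ContinuousOn (fun p : M × ℝ ↦ deriv (u p.1) p.2) (univ ×ˢ Ioo 0 T)

/-- `u` is a classical subsolution of `u_t - Δu + Vu = 0` in `M × (0, T)`. -/
structure IsClassicalSubsolution (V : M → ℝ) (T : ℝ) (u : M → ℝ → ℝ) : Prop where
  isC21 : IsC21 n T u
  le_zero : ∀ x, ∀ t ∈ Ioo 0 T,
    deriv (u x) t - laplacian n (fun y ↦ u y t) x + V x * u x t ≤ 0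

/-- `f ∈ L²_loc(M × (0, T), m ⊗ dt)`. -/
def MemL2LocTime (m : Measure M) (T : ℝ) (f : M → ℝ → ℝ) : Prop :=
  ∀ K : Set M, IsCompact K → ∀ a b : ℝ, 0 < a → b < T →
    MemLp (fun p : M × ℝ ↦ f p.1 p.2) 2 ((m.restrict K).prod (volume.restrict (Icc a b)))

/-- `w ∈ L²_loc((0, T); H¹_loc(M, m))`, and `W(·, t)` is the weak gradient of `w(·, t)` for almost
all `t`. -/
structure IsL2LocH1Loc (m : Measure M) (T : ℝ) (w : M → ℝ → ℝ)
    (W : ∀ x : M, ℝ → TangentSpace (𝓡 n) x) : Prop where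
  isH1Loc : ∀ᵐ t ∂(volume.restrict (Ioo 0 T)), IsH1Loc n m (fun x ↦ w x t) (fun x ↦ W x t)
  memL2LocTime : MemL2LocTime m T w
  aestronglyMeasurable : ∀ X : (∀ x : M, TangentSpace (𝓡 n) x), IsTestField n X →
    AEStronglyMeasurable (fun p : M × ℝ ↦ inner ℝ (W p.1 p.2) (X p.1))
      (m.prod (volume.restrict (Ioo 0 T)))
  memL2LocTime_grad : MemL2LocTime m T (fun x t ↦ ‖W x t‖)

/-- `∂ₜw ∈ L¹_loc((0, T); H⁻¹_loc(M, m))`: the distributional time derivative of `w` is a family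
`ζ(t)`, `0 < t < T`, of linear functionals on `C_c^∞(M)`, weakly measurable in `t`, such that for
each compact `K ⊆ M` the norm of `ζ(t)`, as a functional on the test functions supported in `K` with
the norm of `H¹(M, m)`, is at most `C(t)` with `C` integrable on each `[a, b] ⊆ (0, T)`. -/
def TimeDerivL1LocHNegOneLoc (m : Measure M) (T : ℝ) (w : M → ℝ → ℝ) : Prop :=
  ∃ ζ : ℝ → (testFunctions n M →ₗ[ℝ] ℝ),
    (∀ η, AEStronglyMeasurable (fun t ↦ ζ t η) (volume.restrict (Ioo 0 T))) ∧
    (∀ K : Set M, IsCompact K → ∀ a b : ℝ, 0 < a → b < T →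
      ∃ C : ℝ → ℝ, IntegrableOn C (Icc a b) ∧
        ∀ᵐ t ∂(volume.restrict (Icc a b)), ∀ η : testFunctions n M,
          tsupport (η : M → ℝ) ⊆ K → |ζ t η| ≤ C t * h1Norm n m η) ∧
    ∀ (η : testFunctions n M) (θ : ℝ → ℝ), ContDiff ℝ ∞ θ → HasCompactSupport θ →
      tsupport θ ⊆ Ioo 0 T →
      ∫ t in Ioo 0 T, θ t * ζ t η =
        -∫ t in Ioo 0 T, deriv θ t * ∫ x, w x t * (η : M → ℝ) x ∂m

/-- The measure `dμ = φ² dν`. -/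
def weightedVol (φ : M → ℝ) : Measure M :=
  (vol n : Measure M).withDensity fun x ↦ ENNReal.ofReal (φ x ^ 2)

/-- `w` is a weak subsolution of the weighted heat equation `w_t - Δ_μ w = 0` in `M × (0, T)`, where
`μ` is the measure `m`. -/
def IsWeakSubsolutionHeat (m : Measure M) (T : ℝ) (w : M → ℝ → ℝ) : Prop :=
  ∃ W : (∀ x : M, ℝ → TangentSpace (𝓡 n) x),
    IsL2LocH1Loc n m T w W ∧
    TimeDerivL1LocHNegOneLoc n m T w ∧
    ∀ ψ : M × ℝ → ℝ, ContMDiff ((𝓡 n).prod 𝓘(ℝ, ℝ)) 𝓘(ℝ, ℝ) ∞ ψ → HasCompactSupport ψ →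
      tsupport ψ ⊆ univ ×ˢ Ioo 0 T → (∀ p, 0 ≤ ψ p) →
      ∫ p : M × ℝ, (-(w p.1 p.2) * deriv (fun s ↦ ψ (p.1, s)) p.2
          + inner ℝ (W p.1 p.2) (grad n (fun y ↦ ψ (y, p.2)) p.1))
        ∂(m.prod (volume.restrict (Ioo 0 T))) ≤ 0

end Sobolev

end RiemHeat

end

noncomputable section

open Filter Topology

set_option linter.unusedSectionVars false

/-! Let `Φ` be the weak gradient of `φ`. Then φ²w = φu, and the quotient rule gives φ²∇w = φ∇u − uΦ.
The weak inequality for w is therefore linear in `Φ` and involves no second derivative of `φ`.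

Fix t and write f = u(·,t), ρ = ψ(·,t). The supersolution inequality tested with fρ ≥ 0 reads 0 ≤ ∫
f⟨Φ,∇ρ⟩ + ∫ ρ⟨Φ,∇f⟩ + ∫ Vφfρ. The definition of `Φ`, tested with the field ρ∇f, turns the middle
term into −∫ φ(ρΔf + ⟨∇f,∇ρ⟩). Hence ∫ (φ⟨∇f,∇ρ⟩ − f⟨Φ,∇ρ⟩) ≤ ∫ φρ(Vf − Δf) ≤ −∫ φρ ∂ₜu, which is
`integral_le_zero_of_subsolution`. Integrating over t and moving the time derivative to ψ
(`integral_deriv_time_mul_add`) yields `integral_quotGrad_le_zero`.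

Two points need approximation. The test function fρ is only of class C², so the supersolution
inequality is extended from smooth test functions by mollification in charts
(`supersolution_of_contMDiff_two`). The quotient rule rests on 1/φ having weak gradient −Φ/φ²
(`IsH1Loc.integral_inv`); since `φ` is positive and continuous, it is bounded below on compact sets,
and mollifying it in a chart gives the chain rule (`weak_deriv_inv`). Local square integrability
then follows from continuity of u, ∇u and 1/φ together with ‖Φ‖ ∈ L²_loc.

The time derivative of w is the continuous function ∂ₜu/φ. It acts by η ↦ ∫ ∂ₜu φη dν, and the
Cauchy–Schwarz inequality bounds this by the H¹ norm of η (`IsC21.timeDerivL1LocHNegOneLoc`).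

Everything else is Riemannian calculus derived from the chart definitions: volume and divergence do
not depend on the chart, and the product rule and integration by parts hold. -/

/-- A connected, locally compact, paracompact Hausdorff space is `σ`-compact. -/
theorem sigmaCompactSpace_of_connected (X : Type*) [TopologicalSpace X] [T2Space X]
    [ConnectedSpace X] [LocallyCompactSpace X] [ParacompactSpace X] : SigmaCompactSpace X := by
  choose C hC hxC using fun x : X ↦ exists_compact_mem_nhds x
  obtain ⟨v, hvo, hvc, hvf, hvC⟩ := precise_refinement (fun x ↦ interior (C x))
    (fun x ↦ isOpen_interior)
    (eq_univ_of_forall fun x ↦ mem_iUnion.2 ⟨x, mem_interior_iff_mem_nhds.2 (hxC x)⟩)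
  have hcpt : ∀ i, IsCompact (closure (v i)) := fun i ↦
    (hC i).closure_of_subset ((hvC i).trans interior_subset)
  obtain ⟨x₀⟩ : Nonempty X := inferInstance
  -- Starting from a point, each step adds the closures of all members of the cover that meet the
  -- current compact set. Local finiteness makes this a finite union. The union of all stages is
  -- clopen, because a member of the cover that meets it lies in it.
  let step : Set X → Set X := fun K ↦ ⋃ i ∈ {i | (v i ∩ K).Nonempty}, closure (v i)
  let K : ℕ → Set X := fun k ↦ step^[k] {x₀}
  have hKs : ∀ k, K (k + 1) = step (K k) := fun k ↦ Function.iterate_succ_apply' _ _ _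
  have hK : ∀ k, IsCompact (K k) := by
    intro k
    induction k with
    | zero => exact isCompact_singleton
    | succ k ih =>
      rw [hKs]
      exact (hvf.finite_nonempty_inter_compact ih).isCompact_biUnion fun i _ ↦ hcpt i
  have hmem : ∀ x k i, x ∈ v i → x ∈ K k → v i ⊆ ⋃ k, K k := by
    intro x k i hxi hxk z hz
    refine mem_iUnion.2 ⟨k + 1, ?_⟩
    rw [hKs]
    exact mem_biUnion (show i ∈ {i | (v i ∩ K k).Nonempty} from ⟨x, hxi, hxk⟩)
      (subset_closure hz)
  have hcov : ∀ x, ∃ i, x ∈ v i := fun x ↦ mem_iUnion.1 (hvc ▸ mem_univ x)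
  have hclopen : IsClopen (⋃ k, K k) := by
    constructor
    · rw [← isOpen_compl_iff, isOpen_iff_forall_mem_open]
      intro x hx
      obtain ⟨i, hi⟩ := hcov x
      refine ⟨v i, fun z hz hzU ↦ hx ?_, hvo i, hi⟩
      obtain ⟨k, hk⟩ := mem_iUnion.1 hzU
      exact hmem z k i hz hk hi
    · rw [isOpen_iff_forall_mem_open]
      intro x hx
      obtain ⟨i, hi⟩ := hcov x
      obtain ⟨k, hk⟩ := mem_iUnion.1 hx
      exact ⟨v i, hmem x k i hi hk, hvo i, hi⟩
  have huniv : (⋃ k, K k) = univ :=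
    hclopen.eq_univ ⟨x₀, mem_iUnion.2 ⟨0, mem_singleton x₀⟩⟩
  exact isSigmaCompact_univ_iff.1 ⟨K, hK, huniv⟩

namespace RiemHeat

/-! ### Derivatives and regularity of functions and fields read in a chart. -/

section ChartDerivatives

variable (n : ℕ) {M : Type*} [TopologicalSpace M] [ChartedSpace (E n) M]
  [IsManifold (𝓡 n) ∞ M]

/-- The derivative at `x` of the preferred chart at `x₀`, as the fibre map of the trivialization
of the tangent bundle. -/
def chartD (x₀ x : M) : TangentSpace (𝓡 n) x →L[ℝ] E n :=
  (trivializationAt (E n) (TangentSpace (𝓡 n)) x₀).continuousLinearMapAt ℝ x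

/-- The inverse of `chartD`. -/
def chartDSymm (x₀ x : M) : E n →L[ℝ] TangentSpace (𝓡 n) x :=
  (trivializationAt (E n) (TangentSpace (𝓡 n)) x₀).symmL ℝ x

variable {n} {x₀ x : M}

theorem mem_baseSet_of_mem_source (hx : x ∈ (extChartAt (𝓡 n) x₀).source) :
    x ∈ (trivializationAt (E n) (TangentSpace (𝓡 n)) x₀).baseSet := by
  rw [extChartAt_source] at hx
  exact hx

theorem chartD_chartDSymm (hx : x ∈ (extChartAt (𝓡 n) x₀).source) (v : E n) :
    chartD n x₀ x (chartDSymm n x₀ x v) = v :=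
  Trivialization.continuousLinearMapAt_symmL _ (mem_baseSet_of_mem_source hx) v

theorem chartDSymm_chartD (hx : x ∈ (extChartAt (𝓡 n) x₀).source) (v : TangentSpace (𝓡 n) x) :
    chartDSymm n x₀ x (chartD n x₀ x v) = v :=
  Trivialization.symmL_continuousLinearMapAt _ (mem_baseSet_of_mem_source hx) v

theorem chartD_eq_mfderiv (hx : x ∈ (extChartAt (𝓡 n) x₀).source) :
    chartD n x₀ x = mfderiv (𝓡 n) 𝓘(ℝ, E n) (extChartAt (𝓡 n) x₀) x :=
  TangentBundle.continuousLinearMapAt_trivializationAt (by rwa [extChartAt_source] at hx)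

theorem coordField_eq (X : ∀ x : M, TangentSpace (𝓡 n) x) {y : E n}
    (hy : y ∈ (extChartAt (𝓡 n) x₀).target) :
    coordField n x₀ X y = chartD n x₀ ((extChartAt (𝓡 n) x₀).symm y)
      (X ((extChartAt (𝓡 n) x₀).symm y)) := by
  rw [chartD_eq_mfderiv ((extChartAt (𝓡 n) x₀).map_target hy)]
  rfl

theorem coordVec_eq {y : E n} (hy : y ∈ (extChartAt (𝓡 n) x₀).target) (i : Fin n) :
    coordVec n x₀ y i = chartDSymm n x₀ ((extChartAt (𝓡 n) x₀).symm y)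
      (EuclideanSpace.single i 1) := by
  have hx := (extChartAt (𝓡 n) x₀).map_target hy
  rw [← chartDSymm_chartD hx (coordVec n x₀ y i), chartD_eq_mfderiv hx]
  congr 1
  have h := mfderiv_extChartAt_comp_mfderivWithin_extChartAt_symm hy
  have h2 := DFunLike.congr_fun h (EuclideanSpace.single i (1 : ℝ) : E n)
  rw [ModelWithCorners.range_eq_univ, mfderivWithin_univ] at h2
  exact h2

/-- Chain rule for f = (f ∘ chart⁻¹) ∘ chart near `x`. -/
theorem mfderiv_eq_fderiv_chartD {F : Type*} [NormedAddCommGroup F] [NormedSpace ℝ F] {f : M → F}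
    (hx : x ∈ (extChartAt (𝓡 n) x₀).source) (hf : MDifferentiableAt (𝓡 n) 𝓘(ℝ, F) f x)
    (v : TangentSpace (𝓡 n) x) :
    mfderiv (𝓡 n) 𝓘(ℝ, F) f x v =
      fderiv ℝ (f ∘ (extChartAt (𝓡 n) x₀).symm) (extChartAt (𝓡 n) x₀ x) (chartD n x₀ x v) := by
  have hy := (extChartAt (𝓡 n) x₀).map_source hx
  have hsymm : MDifferentiableAt 𝓘(ℝ, E n) (𝓡 n) (extChartAt (𝓡 n) x₀).symm
      (extChartAt (𝓡 n) x₀ x) := by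
    have := mdifferentiableWithinAt_extChartAt_symm hy
    rwa [ModelWithCorners.range_eq_univ, mdifferentiableWithinAt_univ] at this
  have hx' : x ∈ (chartAt (E n) x₀).source := by rwa [extChartAt_source] at hx
  have hg : MDifferentiableAt 𝓘(ℝ, E n) 𝓘(ℝ, F) (f ∘ (extChartAt (𝓡 n) x₀).symm)
      (extChartAt (𝓡 n) x₀ x) :=
    MDifferentiableAt.comp (I' := 𝓡 n) _ (by rwa [(extChartAt (𝓡 n) x₀).left_inv hx]) hsymm
  have heq : f =ᶠ[𝓝 x] (f ∘ (extChartAt (𝓡 n) x₀).symm) ∘ (extChartAt (𝓡 n) x₀) := by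
    filter_upwards [extChartAt_source_mem_nhds' hx] with z hz
    simp only [Function.comp_apply, (extChartAt (𝓡 n) x₀).left_inv hz]
  rw [heq.mfderiv_eq, mfderiv_comp x hg (mdifferentiableAt_extChartAt hx'), mfderiv_eq_fderiv,
    chartD_eq_mfderiv hx]
  rfl

/-- Regularity of a vector field in terms of its components in a chart. -/
theorem contMDiffOn_section_iff_chartD {k : ℕ∞ω} (hk : k ≤ ∞) {s : Set M} (hs : IsOpen s)
    (hs' : s ⊆ (extChartAt (𝓡 n) x₀).source) (X : ∀ x : M, TangentSpace (𝓡 n) x) :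
    ContMDiffOn (𝓡 n) (𝓡 n).tangent k (fun x ↦ (⟨x, X x⟩ : TangentBundle (𝓡 n) M)) s ↔
      ContMDiffOn (𝓡 n) 𝓘(ℝ, E n) k (fun x ↦ chartD n x₀ x (X x)) s := by
  have : IsManifold (𝓡 n) (∞ + 1) M := ‹IsManifold (𝓡 n) ∞ M›
  have : ContMDiffVectorBundle ∞ (E n) (TangentSpace (𝓡 n) : M → Type _) (𝓡 n) :=
    TangentBundle.contMDiffVectorBundle
  have : ContMDiffVectorBundle k (E n) (TangentSpace (𝓡 n) : M → Type _) (𝓡 n) :=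
    ContMDiffVectorBundle.of_le hk
  refine ((trivializationAt (E n) (TangentSpace (𝓡 n)) x₀).contMDiffOn_section_iff (s := X)
    (IB := 𝓡 n) hs (fun x hx ↦ mem_baseSet_of_mem_source (hs' hx))).trans ?_
  refine contMDiffOn_congr fun x hx ↦ ?_
  rw [chartD, Trivialization.continuousLinearMapAt_apply,
    Trivialization.coe_linearMapAt_of_mem _ (mem_baseSet_of_mem_source (hs' hx))]

theorem contMDiffOn_iff_comp_symm {F : Type*} [NormedAddCommGroup F] [NormedSpace ℝ F] {k : ℕ∞ω}
    (hk : k ≤ ∞) {f : M → F} :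
    ContMDiffOn (𝓡 n) 𝓘(ℝ, F) k f (extChartAt (𝓡 n) x₀).source ↔
      ContDiffOn ℝ k (f ∘ (extChartAt (𝓡 n) x₀).symm) (extChartAt (𝓡 n) x₀).target := by
  constructor
  · intro h
    rw [← contMDiffOn_iff_contDiffOn]
    exact h.comp ((contMDiffOn_extChartAt_symm x₀).of_le hk)
      fun y hy ↦ (extChartAt (𝓡 n) x₀).map_target hy
  · intro h
    rw [← contMDiffOn_iff_contDiffOn] at h
    have h2 : ContMDiffOn (𝓡 n) 𝓘(ℝ, E n) k (extChartAt (𝓡 n) x₀)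
        (extChartAt (𝓡 n) x₀).source := by
      rw [extChartAt_source]
      exact contMDiffOn_extChartAt.of_le hk
    refine (h.comp h2 fun x hx ↦ (extChartAt (𝓡 n) x₀).map_source hx).congr fun x hx ↦ ?_
    simp only [Function.comp_apply, (extChartAt (𝓡 n) x₀).left_inv hx]

end ChartDerivatives

theorem one_le_smooth : (1 : ℕ∞ω) ≤ ∞ := by
  have : ((1 : ℕ∞) : ℕ∞ω) ≤ ((⊤ : ℕ∞) : ℕ∞ω) := WithTop.coe_le_coe.2 le_top
  exact this

theorem two_le_smooth : (2 : ℕ∞ω) ≤ ∞ := by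
  have : ((2 : ℕ∞) : ℕ∞ω) ≤ ((⊤ : ℕ∞) : ℕ∞ω) := WithTop.coe_le_coe.2 le_top
  exact this

/-! ### Smooth dependence of determinants and inverse matrices on parameters. -/

section Calculus

variable {G : Type*} [NormedAddCommGroup G] [NormedSpace ℝ G] {ι : Type*} [Fintype ι]
  [DecidableEq ι] {k : ℕ∞ω} {s : Set G}

theorem contDiffOn_det {A : G → Matrix ι ι ℝ} (hA : ∀ i j, ContDiffOn ℝ k (fun y ↦ A y i j) s) :
    ContDiffOn ℝ k (fun y ↦ (A y).det) s := by
  simp only [Matrix.det_apply]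
  exact ContDiffOn.sum fun σ _ ↦ (contDiffOn_prod fun i _ ↦ hA _ _).const_smul _

theorem contDiffOn_adjugate {A : G → Matrix ι ι ℝ}
    (hA : ∀ i j, ContDiffOn ℝ k (fun y ↦ A y i j) s) (i j : ι) :
    ContDiffOn ℝ k (fun y ↦ (A y).adjugate i j) s := by
  simp only [Matrix.adjugate_apply]
  refine contDiffOn_det fun a b ↦ ?_
  by_cases h : a = j
  · subst h
    simpa using contDiffOn_const
  · simpa [Matrix.updateRow_ne h] using hA a b

/-- Cramer's rule: the inverse is the adjugate divided by the determinant. -/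
theorem contDiffOn_matrix_inv {A : G → Matrix ι ι ℝ}
    (hA : ∀ i j, ContDiffOn ℝ k (fun y ↦ A y i j) s) (h0 : ∀ y ∈ s, (A y).det ≠ 0) (i j : ι) :
    ContDiffOn ℝ k (fun y ↦ (A y)⁻¹ i j) s := by
  simp only [Matrix.inv_def, Matrix.smul_apply, Ring.inverse_eq_inv', smul_eq_mul]
  exact ((contDiffOn_det hA).inv h0).mul (contDiffOn_adjugate hA i j)

end Calculus

/-! ### The metric in coordinates and its volume density. -/

section Metric

variable {n : ℕ} {M : Type*} [TopologicalSpace M] [ChartedSpace (E n) M]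
  [IsManifold (𝓡 n) ∞ M] [RiemannianBundle (fun x : M ↦ TangentSpace (𝓡 n) x)]
  {x₀ x : M}

variable (n) in
/-- The Gram matrix at `x` of the coordinate vectors of the chart at `x₀`. -/
def gramMatrix (x₀ x : M) : Matrix (Fin n) (Fin n) ℝ :=
  Matrix.gram ℝ fun i ↦ chartDSymm n x₀ x (EuclideanSpace.single i 1)

theorem metricMatrix_eq_gramMatrix {y : E n} (hy : y ∈ (extChartAt (𝓡 n) x₀).target) :
    metricMatrix n x₀ y = gramMatrix n x₀ ((extChartAt (𝓡 n) x₀).symm y) := by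
  ext i j
  simp only [metricMatrix, gramMatrix, Matrix.of_apply, Matrix.gram_apply, coordVec_eq hy]

theorem linearIndependent_coord (hx : x ∈ (extChartAt (𝓡 n) x₀).source) :
    LinearIndependent ℝ fun i : Fin n ↦ chartDSymm n x₀ x (EuclideanSpace.single i 1) := by
  have h : LinearIndependent ℝ fun i : Fin n ↦ (EuclideanSpace.single i (1 : ℝ) : E n) := by
    have h0 : (fun i : Fin n ↦ (EuclideanSpace.single i (1 : ℝ) : E n)) =
        (EuclideanSpace.basisFun (Fin n) ℝ).toBasis := funext fun i ↦ by simp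
    rw [h0]
    exact (EuclideanSpace.basisFun (Fin n) ℝ).toBasis.linearIndependent
  refine h.map' (chartDSymm n x₀ x : E n →ₗ[ℝ] TangentSpace (𝓡 n) x) (LinearMap.ker_eq_bot.2 ?_)
  exact Function.LeftInverse.injective (g := chartD n x₀ x) (chartD_chartDSymm hx)

theorem posDef_gramMatrix (hx : x ∈ (extChartAt (𝓡 n) x₀).source) :
    (gramMatrix n x₀ x).PosDef :=
  Matrix.posDef_gram_iff_linearIndependent.2 (linearIndependent_coord hx)

theorem metricMatrix_det_pos {y : E n} (hy : y ∈ (extChartAt (𝓡 n) x₀).target) :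
    0 < (metricMatrix n x₀ y).det := by
  rw [metricMatrix_eq_gramMatrix hy]
  exact (posDef_gramMatrix ((extChartAt (𝓡 n) x₀).map_target hy)).det_pos

theorem volDensity_pos {y : E n} (hy : y ∈ (extChartAt (𝓡 n) x₀).target) :
    0 < volDensity n x₀ y :=
  Real.sqrt_pos.2 (metricMatrix_det_pos hy)

/-- In its own chart a coordinate field has constant components. -/
theorem contMDiffOn_coord (x₀ : M) (v : E n) :
    ContMDiffOn (𝓡 n) (𝓡 n).tangent ∞
      (fun x ↦ (⟨x, chartDSymm n x₀ x v⟩ : TangentBundle (𝓡 n) M))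
      (extChartAt (𝓡 n) x₀).source := by
  refine (contMDiffOn_section_iff_chartD le_rfl (isOpen_extChartAt_source x₀) subset_rfl
    (fun x ↦ chartDSymm n x₀ x v)).2 ?_
  exact contMDiffOn_const.congr fun x hx ↦ chartD_chartDSymm hx v

variable [IsContMDiffRiemannianBundle (𝓡 n) ∞ (E n) (fun x : M ↦ TangentSpace (𝓡 n) x)]

theorem contDiffOn_metricMatrix (x₀ : M) (i j : Fin n) :
    ContDiffOn ℝ ∞ (fun y ↦ metricMatrix n x₀ y i j) (extChartAt (𝓡 n) x₀).target := by
  have h : ContMDiffOn (𝓡 n) 𝓘(ℝ, ℝ) ∞ (fun x ↦ gramMatrix n x₀ x i j)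
      (extChartAt (𝓡 n) x₀).source :=
    ContMDiffOn.inner_bundle (IB := 𝓡 n) (F := E n) (E := fun x : M ↦ TangentSpace (𝓡 n) x)
      (contMDiffOn_coord x₀ _) (contMDiffOn_coord x₀ _)
  refine ((contMDiffOn_iff_comp_symm le_rfl).1 h).congr fun y hy ↦ ?_
  rw [metricMatrix_eq_gramMatrix hy]
  rfl

theorem contDiffOn_volDensity (x₀ : M) :
    ContDiffOn ℝ ∞ (volDensity n x₀) (extChartAt (𝓡 n) x₀).target :=
  (contDiffOn_det (contDiffOn_metricMatrix x₀)).sqrt fun _ hy ↦ (metricMatrix_det_pos hy).ne'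

end Metric

/-! ### The gradient in coordinates. -/

section Gradient

variable {n : ℕ} {M : Type*} [TopologicalSpace M] [ChartedSpace (E n) M]
  [IsManifold (𝓡 n) ∞ M] [RiemannianBundle (fun x : M ↦ TangentSpace (𝓡 n) x)]
  {x₀ x : M}

theorem inner_grad (f : M → ℝ) (x : M) (v : TangentSpace (𝓡 n) x) :
    inner ℝ (grad n f x) v = mfderiv (𝓡 n) 𝓘(ℝ, ℝ) f x v := by
  have : FiniteDimensional ℝ (TangentSpace (𝓡 n) x) :=
    inferInstanceAs (FiniteDimensional ℝ (E n))
  have : CompleteSpace (TangentSpace (𝓡 n) x) := FiniteDimensional.complete ℝ _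
  exact InnerProductSpace.toDual_symm_apply

theorem eq_sum_coord (hx : x ∈ (extChartAt (𝓡 n) x₀).source) (v : TangentSpace (𝓡 n) x) :
    v = ∑ i, chartD n x₀ x v i • chartDSymm n x₀ x (EuclideanSpace.single i 1) := by
  have h : chartD n x₀ x v = ∑ i, chartD n x₀ x v i • (EuclideanSpace.single i (1 : ℝ) : E n) := by
    simpa using ((EuclideanSpace.basisFun (Fin n) ℝ).sum_repr (chartD n x₀ x v)).symm
  conv_lhs => rw [← chartDSymm_chartD hx v, h]
  simp only [map_sum, map_smul]

/-- The components of the gradient in a chart. -/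
theorem chartD_grad (hx : x ∈ (extChartAt (𝓡 n) x₀).source) {f : M → ℝ}
    (hf : MDifferentiableAt (𝓡 n) 𝓘(ℝ, ℝ) f x) (i : Fin n) :
    chartD n x₀ x (grad n f x) i = ∑ j, (gramMatrix n x₀ x)⁻¹ i j *
      fderiv ℝ (f ∘ (extChartAt (𝓡 n) x₀).symm) (extChartAt (𝓡 n) x₀ x)
        (EuclideanSpace.single j 1) := by
  have hdet : IsUnit (gramMatrix n x₀ x).det := (posDef_gramMatrix hx).det_pos.ne'.isUnit
  -- Pairing ∇f with the j-th coordinate vector gives Σᵢ g_{ji}(∇f)ⁱ = ∂ⱼf. The Gram matrix is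
  -- positive definite, so the system can be inverted.
  have key : (gramMatrix n x₀ x).mulVec (fun i ↦ chartD n x₀ x (grad n f x) i) =
      fun j ↦ fderiv ℝ (f ∘ (extChartAt (𝓡 n) x₀).symm) (extChartAt (𝓡 n) x₀ x)
        (EuclideanSpace.single j 1) := by
    ext j
    have h1 := inner_grad f x (chartDSymm n x₀ x (EuclideanSpace.single j 1))
    rw [mfderiv_eq_fderiv_chartD hx hf, chartD_chartDSymm hx] at h1
    rw [← h1, real_inner_comm]
    conv_rhs => rw [eq_sum_coord hx (grad n f x)]
    rw [inner_sum]
    simp only [Matrix.mulVec, dotProduct, gramMatrix, Matrix.gram_apply, inner_smul_right]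
    exact Finset.sum_congr rfl fun _ _ ↦ mul_comm _ _
  have h2 := congrArg (fun w ↦ (gramMatrix n x₀ x)⁻¹.mulVec w) key
  simp only [Matrix.mulVec_mulVec, Matrix.nonsing_inv_mul _ hdet, Matrix.one_mulVec] at h2
  exact congrFun h2 i

variable [IsContMDiffRiemannianBundle (𝓡 n) ∞ (E n) (fun x : M ↦ TangentSpace (𝓡 n) x)]

theorem contDiffOn_metricMatrix_inv (x₀ : M) (i j : Fin n) :
    ContDiffOn ℝ ∞ (fun y ↦ (metricMatrix n x₀ y)⁻¹ i j) (extChartAt (𝓡 n) x₀).target :=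
  contDiffOn_matrix_inv (contDiffOn_metricMatrix x₀)
    (fun _ hy ↦ (metricMatrix_det_pos hy).ne') i j

theorem ContMDiff.contDiffOn_comp_symm {k : ℕ∞ω} (hk : k ≤ ∞) {f : M → ℝ}
    (hf : ContMDiff (𝓡 n) 𝓘(ℝ, ℝ) k f) (x₀ : M) :
    ContDiffOn ℝ k (f ∘ (extChartAt (𝓡 n) x₀).symm) (extChartAt (𝓡 n) x₀).target :=
  (contMDiffOn_iff_comp_symm hk).1 hf.contMDiffOn

/-- The components Σⱼ gⁱʲ∂ⱼf are products of smooth coefficients with first derivatives of `f`, so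
exactly one order of regularity is lost. This makes ρ∇f an admissible C¹ test field when `f` is C².
-/
theorem contMDiff_grad {f : M → ℝ} (hf : ContMDiff (𝓡 n) 𝓘(ℝ, ℝ) 2 f) :
    ContMDiff (𝓡 n) (𝓡 n).tangent 1
      (fun x ↦ (⟨x, grad n f x⟩ : TangentBundle (𝓡 n) M)) := by
  intro x₀
  have h1 := one_le_smooth
  have h2 := two_le_smooth
  refine ContMDiffOn.contMDiffAt (s := (extChartAt (𝓡 n) x₀).source) ?_
    (extChartAt_source_mem_nhds x₀)
  rw [contMDiffOn_section_iff_chartD h1 (isOpen_extChartAt_source x₀) subset_rfl (grad n f),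
    contMDiffOn_iff_comp_symm h1]
  have hfd := ((ContMDiff.contDiffOn_comp_symm h2 hf x₀).fderiv_of_isOpen
    (isOpen_extChartAt_target x₀) (m := 1) (by norm_num))
  rw [contDiffOn_euclidean]
  intro i
  have h3 : ContDiffOn ℝ 1 (fun y ↦ ∑ j, (metricMatrix n x₀ y)⁻¹ i j *
      fderiv ℝ (f ∘ (extChartAt (𝓡 n) x₀).symm) y (EuclideanSpace.single j 1))
      (extChartAt (𝓡 n) x₀).target :=
    ContDiffOn.sum fun j _ ↦ ((contDiffOn_metricMatrix_inv x₀ i j).of_le h1).mul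
      (hfd.clm_apply contDiffOn_const)
  refine h3.congr fun y hy ↦ ?_
  have hx := (extChartAt (𝓡 n) x₀).map_target hy
  simp only [Function.comp_apply]
  rw [chartD_grad hx (hf.mdifferentiable (by norm_num) _), metricMatrix_eq_gramMatrix hy,
    (extChartAt (𝓡 n) x₀).right_inv hy]

end Gradient

/-! ### How the volume density changes between charts. -/

section Transition

variable {n : ℕ} {M : Type*} [TopologicalSpace M] [ChartedSpace (E n) M]
  [IsManifold (𝓡 n) ∞ M] [RiemannianBundle (fun x : M ↦ TangentSpace (𝓡 n) x)]
  {x₀ x₁ x : M}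

variable (n) in
/-- The derivative of the transition map from the chart at `x₀` to the chart at `x₁`. -/
def transitionD (x₀ x₁ x : M) : E n →L[ℝ] E n := (chartD n x₁ x).comp (chartDSymm n x₀ x)

/-- With A the Jacobian matrix of the transition map, the Gram matrices satisfy G₀ = Aᵀ G₁ A; taking
determinants gives the square. -/
theorem gramMatrix_transition (h₁ : x ∈ (extChartAt (𝓡 n) x₁).source) :
    (gramMatrix n x₀ x).det = (transitionD n x₀ x₁ x).det ^ 2 * (gramMatrix n x₁ x).det := by
  let A : Matrix (Fin n) (Fin n) ℝ := LinearMap.toMatrix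
    (EuclideanSpace.basisFun (Fin n) ℝ).toBasis (EuclideanSpace.basisFun (Fin n) ℝ).toBasis
    (transitionD n x₀ x₁ x : E n →ₗ[ℝ] E n)
  have hA : A.det = (transitionD n x₀ x₁ x).det := LinearMap.det_toMatrix _ _
  have hAe : ∀ k i, A k i =
      chartD n x₁ x (chartDSymm n x₀ x (EuclideanSpace.single i 1)) k := by
    intro k i
    simp only [A, LinearMap.toMatrix_apply, OrthonormalBasis.coe_toBasis,
      EuclideanSpace.basisFun_apply]
    rfl
  have hg : gramMatrix n x₀ x = A.transpose * gramMatrix n x₁ x * A := by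
    ext i j
    rw [Matrix.mul_assoc]
    simp only [Matrix.mul_apply, Matrix.transpose_apply]
    conv_lhs => rw [gramMatrix, Matrix.gram_apply,
      eq_sum_coord h₁ (chartDSymm n x₀ x (EuclideanSpace.single i 1)),
      eq_sum_coord h₁ (chartDSymm n x₀ x (EuclideanSpace.single j 1))]
    simp only [sum_inner, inner_sum, inner_smul_left, inner_smul_right, ← hAe, gramMatrix,
      Matrix.gram_apply, Finset.mul_sum]
    rw [Finset.sum_comm]
    refine Finset.sum_congr rfl fun k _ ↦ Finset.sum_congr rfl fun l _ ↦ ?_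
    simp only [conj_trivial]
    ring
  rw [hg, Matrix.det_mul, Matrix.det_mul, Matrix.det_transpose, hA]
  ring

theorem volDensity_transition {y : E n} (hy : y ∈ (extChartAt (𝓡 n) x₀).target)
    (h₁ : (extChartAt (𝓡 n) x₀).symm y ∈ (extChartAt (𝓡 n) x₁).source) :
    volDensity n x₀ y = |(transitionD n x₀ x₁ ((extChartAt (𝓡 n) x₀).symm y)).det| *
      volDensity n x₁ (extChartAt (𝓡 n) x₁ ((extChartAt (𝓡 n) x₀).symm y)) := by
  rw [volDensity, volDensity, metricMatrix_eq_gramMatrix hy,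
    metricMatrix_eq_gramMatrix ((extChartAt (𝓡 n) x₁).map_source h₁),
    (extChartAt (𝓡 n) x₁).left_inv h₁, gramMatrix_transition h₁, Real.sqrt_mul (sq_nonneg _),
    Real.sqrt_sq_eq_abs]

theorem hasFDerivAt_transition {y : E n} (hy : y ∈ (extChartAt (𝓡 n) x₀).target)
    (h₁ : (extChartAt (𝓡 n) x₀).symm y ∈ (extChartAt (𝓡 n) x₁).source) :
    HasFDerivAt (extChartAt (𝓡 n) x₁ ∘ (extChartAt (𝓡 n) x₀).symm)
      (transitionD n x₀ x₁ ((extChartAt (𝓡 n) x₀).symm y)) y := by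
  have hx := (extChartAt (𝓡 n) x₀).map_target hy
  have hd : MDifferentiableAt (𝓡 n) 𝓘(ℝ, E n) (extChartAt (𝓡 n) x₁)
      ((extChartAt (𝓡 n) x₀).symm y) :=
    mdifferentiableAt_extChartAt (by rwa [extChartAt_source] at h₁)
  have hs : MDifferentiableAt 𝓘(ℝ, E n) (𝓡 n) (extChartAt (𝓡 n) x₀).symm y := by
    have := mdifferentiableWithinAt_extChartAt_symm hy
    rwa [ModelWithCorners.range_eq_univ, mdifferentiableWithinAt_univ] at this
  have hdiff : DifferentiableAt ℝ (extChartAt (𝓡 n) x₁ ∘ (extChartAt (𝓡 n) x₀).symm) y :=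
    (MDifferentiableAt.comp (I' := 𝓡 n) y hd hs).differentiableAt
  have heq : transitionD n x₀ x₁ ((extChartAt (𝓡 n) x₀).symm y) =
      fderiv ℝ (extChartAt (𝓡 n) x₁ ∘ (extChartAt (𝓡 n) x₀).symm) y := by
    ext1 v
    have := mfderiv_eq_fderiv_chartD hx hd (chartDSymm n x₀ _ v)
    rw [chartD_chartDSymm hx, (extChartAt (𝓡 n) x₀).right_inv hy, ← chartD_eq_mfderiv h₁] at this
    exact this
  rw [heq]
  exact hdiff.hasFDerivAt

end Transition

/-! ### The Riemannian volume agrees with the chart measures. -/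

section Volume

variable {n : ℕ} {M : Type*} [TopologicalSpace M] [ChartedSpace (E n) M]
  [IsManifold (𝓡 n) ∞ M] [RiemannianBundle (fun x : M ↦ TangentSpace (𝓡 n) x)]
  [MeasurableSpace M] [BorelSpace M]
  {x₀ x₁ x : M}

theorem measurableSet_target (x₀ : M) : MeasurableSet (extChartAt (𝓡 n) x₀).target :=
  (isOpen_extChartAt_target x₀).measurableSet

theorem measurableSet_source (x₀ : M) : MeasurableSet (extChartAt (𝓡 n) x₀).source :=
  (isOpen_extChartAt_source x₀).measurableSet

theorem measurableSet_target_inter_preimage (x₀ : M) {A : Set M} (hA : MeasurableSet A) :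
    MeasurableSet ((extChartAt (𝓡 n) x₀).target ∩ (extChartAt (𝓡 n) x₀).symm ⁻¹' A) := by
  have h : Measurable ((extChartAt (𝓡 n) x₀).target.domRestrict (extChartAt (𝓡 n) x₀).symm) :=
    (continuousOn_extChartAt_symm x₀).domRestrict.measurable
  have := (measurableSet_target (n := n) x₀).subtype_image (h hA)
  convert this using 1
  ext y
  exact ⟨fun hy ↦ ⟨⟨y, hy.1⟩, hy.2, rfl⟩, by rintro ⟨z, hz, rfl⟩; exact ⟨z.2, hz⟩⟩

theorem aemeasurable_symm (x₀ : M) (d : E n → ENNReal) :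
    AEMeasurable (extChartAt (𝓡 n) x₀).symm
      ((volume.restrict (extChartAt (𝓡 n) x₀).target).withDensity d) :=
  ((continuousOn_extChartAt_symm x₀).aemeasurable (measurableSet_target x₀)).mono_ac
    (withDensity_absolutelyContinuous _ _)

theorem chartVolume_apply (x₀ : M) {A : Set M} (hA : MeasurableSet A) :
    chartVolume n x₀ A =
      ∫⁻ y in (extChartAt (𝓡 n) x₀).target ∩ (extChartAt (𝓡 n) x₀).symm ⁻¹' A,
        ENNReal.ofReal (volDensity n x₀ y) := by
  rw [chartVolume, Measure.map_apply_of_aemeasurable (aemeasurable_symm x₀ _) hA,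
    withDensity_apply', Measure.restrict_restrict' (measurableSet_target x₀), inter_comm]

/-- Change of variables along the transition map: its Jacobian determinant is exactly the factor
relating the two densities in `volDensity_transition`. -/
theorem chartVolume_eq_of_subset {A : Set M} (hA : MeasurableSet A)
    (h₀ : A ⊆ (extChartAt (𝓡 n) x₀).source) (h₁ : A ⊆ (extChartAt (𝓡 n) x₁).source) :
    chartVolume n x₀ A = chartVolume n x₁ A := by
  rw [chartVolume_apply x₀ hA, chartVolume_apply x₁ hA]
  set S := (extChartAt (𝓡 n) x₀).target ∩ (extChartAt (𝓡 n) x₀).symm ⁻¹' A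
  have himg : (extChartAt (𝓡 n) x₁).target ∩ (extChartAt (𝓡 n) x₁).symm ⁻¹' A =
      (extChartAt (𝓡 n) x₁ ∘ (extChartAt (𝓡 n) x₀).symm) '' S := by
    ext z
    constructor
    · rintro ⟨hz, hzA⟩
      refine ⟨extChartAt (𝓡 n) x₀ ((extChartAt (𝓡 n) x₁).symm z),
        ⟨(extChartAt (𝓡 n) x₀).map_source (h₀ hzA), ?_⟩, ?_⟩
      · rw [mem_preimage, (extChartAt (𝓡 n) x₀).left_inv (h₀ hzA)]
        exact hzA
      · rw [Function.comp_apply, (extChartAt (𝓡 n) x₀).left_inv (h₀ hzA),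
          (extChartAt (𝓡 n) x₁).right_inv hz]
    · rintro ⟨y, ⟨hy, hyA⟩, rfl⟩
      refine ⟨(extChartAt (𝓡 n) x₁).map_source (h₁ hyA), ?_⟩
      rw [mem_preimage, Function.comp_apply, (extChartAt (𝓡 n) x₁).left_inv (h₁ hyA)]
      exact hyA
  have hinj : InjOn (extChartAt (𝓡 n) x₁ ∘ (extChartAt (𝓡 n) x₀).symm) S := by
    intro y hy z hz hyz
    exact (extChartAt (𝓡 n) x₀).symm.injOn hy.1 hz.1
      ((extChartAt (𝓡 n) x₁).injOn (h₁ hy.2) (h₁ hz.2) hyz)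
  rw [himg, lintegral_image_eq_lintegral_abs_det_fderiv_mul volume
    (measurableSet_target_inter_preimage x₀ hA)
    (fun y hy ↦ (hasFDerivAt_transition hy.1 (h₁ hy.2)).hasFDerivWithinAt) hinj]
  refine setLIntegral_congr_fun (measurableSet_target_inter_preimage x₀ hA) fun y hy ↦ ?_
  simp only [Function.comp_apply]
  rw [volDensity_transition hy.1 (h₁ hy.2), ENNReal.ofReal_mul (abs_nonneg _)]

theorem chartVolume_inter_source (x₀ : M) {A : Set M} (hA : MeasurableSet A) :
    chartVolume n x₀ A = chartVolume n x₀ (A ∩ (extChartAt (𝓡 n) x₀).source) := by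
  rw [chartVolume_apply x₀ hA, chartVolume_apply x₀ (hA.inter (measurableSet_source x₀))]
  congr 2
  ext y
  simp only [mem_inter_iff, mem_preimage]
  exact ⟨fun h ↦ ⟨h.1, h.2, (extChartAt (𝓡 n) x₀).map_target h.1⟩, fun h ↦ ⟨h.1, h.2.1⟩⟩

variable [SigmaCompactSpace M]

/-- On the domain of a chart, the Riemannian volume is the measure of the chart. -/
theorem vol_apply_of_subset {A : Set M} (hA : MeasurableSet A)
    (h₀ : A ⊆ (extChartAt (𝓡 n) x₀).source) : (vol n : Measure M) A = chartVolume n x₀ A := by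
  refine le_antisymm ?_ (Measure.le_iff'.1 (le_iSup (fun x₀ : M ↦ chartVolume n x₀) x₀) A)
  obtain ⟨t, htc, htu⟩ := countable_cover_nhds_of_sigmaCompact
    fun x : M ↦ extChartAt_source_mem_nhds (I := 𝓡 n) x
  obtain ⟨p, hp⟩ : ∃ p : ℕ → M, (⋃ k, (extChartAt (𝓡 n) (p k)).source) = univ := by
    have hne : t.Nonempty := by
      by_contra h
      rw [not_nonempty_iff_eq_empty] at h
      simp only [h, mem_empty_iff_false, iUnion_of_empty, iUnion_empty] at htu
      exact (htu.symm ▸ mem_univ x₀ : x₀ ∈ (∅ : Set M)).elim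
    obtain ⟨p, rfl⟩ := htc.exists_eq_range hne
    exact ⟨p, by simpa using htu⟩
  -- Countably many chart domains are cut into disjoint pieces, and the chart measures are glued
  -- along them. By `chartVolume_eq_of_subset` the glued measure agrees with every chart measure on
  -- its domain, so it dominates all of them and hence their supremum.
  let D : ℕ → Set M := disjointed fun k ↦ (extChartAt (𝓡 n) (p k)).source
  have hDm : ∀ k, MeasurableSet (D k) :=
    fun k ↦ MeasurableSet.disjointed (fun k ↦ measurableSet_source (p k)) k
  have hDs : ∀ k, D k ⊆ (extChartAt (𝓡 n) (p k)).source := fun k ↦ disjointed_subset _ k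
  have hDd : Pairwise (Function.onFun Disjoint D) := disjoint_disjointed _
  have hDu : (⋃ k, D k) = univ := by rw [← hp]; exact iUnion_disjointed
  let ν : Measure M := Measure.sum fun k ↦ (chartVolume n (p k)).restrict (D k)
  have key : ∀ (z : M) (B : Set M), MeasurableSet B → B ⊆ (extChartAt (𝓡 n) z).source →
      chartVolume n z B = ν B := by
    intro z B hB hBz
    have hB' : B = ⋃ k, B ∩ D k := by rw [← inter_iUnion, hDu, inter_univ]
    rw [Measure.sum_apply _ hB]
    conv_lhs => rw [hB', measure_iUnion
      (fun i j hij ↦ (hDd hij).mono inter_subset_right inter_subset_right)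
      (fun k ↦ hB.inter (hDm k))]
    refine tsum_congr fun k ↦ ?_
    rw [Measure.restrict_apply hB]
    exact chartVolume_eq_of_subset (hB.inter (hDm k)) (inter_subset_left.trans hBz)
      (inter_subset_right.trans (hDs k))
  have hle : (vol n : Measure M) ≤ ν := by
    refine iSup_le fun z ↦ Measure.le_iff.2 fun B hB ↦ ?_
    rw [chartVolume_inter_source z hB, key z _ (hB.inter (measurableSet_source z))
      inter_subset_right]
    exact measure_mono inter_subset_left
  rw [key x₀ A hA h₀]
  exact Measure.le_iff'.1 hle A

theorem vol_restrict_source (x₀ : M) :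
    (vol n : Measure M).restrict (extChartAt (𝓡 n) x₀).source = chartVolume n x₀ := by
  ext A hA
  rw [Measure.restrict_apply hA, chartVolume_inter_source x₀ hA,
    vol_apply_of_subset (hA.inter (measurableSet_source x₀)) inter_subset_right]

/-- Integration against the Riemannian volume in a chart. -/
theorem integral_vol_eq (x₀ : M) {f : M → ℝ} (hf : AEStronglyMeasurable f (vol n))
    (h0 : ∀ x ∉ (extChartAt (𝓡 n) x₀).source, f x = 0)
    (hd : AEMeasurable (volDensity n x₀) (volume.restrict (extChartAt (𝓡 n) x₀).target)) :
    ∫ x, f x ∂(vol n : Measure M) = ∫ y in (extChartAt (𝓡 n) x₀).target,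
      volDensity n x₀ y * f ((extChartAt (𝓡 n) x₀).symm y) := by
  rw [← setIntegral_eq_integral_of_forall_compl_eq_zero h0, vol_restrict_source]
  have hf' := hf.restrict (s := (extChartAt (𝓡 n) x₀).source)
  rw [vol_restrict_source] at hf'
  unfold chartVolume at hf' ⊢
  rw [integral_map (aemeasurable_symm x₀ _) hf',
    integral_withDensity_eq_integral_toReal_smul₀ hd.ennreal_ofReal (by simp)]
  simp only [ENNReal.toReal_ofReal (Real.sqrt_nonneg _), volDensity, smul_eq_mul]

variable [IsContMDiffRiemannianBundle (𝓡 n) ∞ (E n) (fun x : M ↦ TangentSpace (𝓡 n) x)]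

theorem aemeasurable_volDensity (x₀ : M) :
    AEMeasurable (volDensity n x₀) (volume.restrict (extChartAt (𝓡 n) x₀).target) :=
  (contDiffOn_volDensity x₀).continuousOn.aemeasurable (measurableSet_target x₀)

theorem isLocallyFiniteMeasure_vol [T2Space M] [LocallyCompactSpace M] :
    IsLocallyFiniteMeasure (vol n : Measure M) := by
  refine ⟨fun x₀ ↦ ?_⟩
  obtain ⟨K, hK, hKs, hKc⟩ := local_compact_nhds (extChartAt_source_mem_nhds (I := 𝓡 n) x₀)
  refine ⟨K, hK, ?_⟩
  rw [vol_apply_of_subset hKc.measurableSet hKs, chartVolume_apply x₀ hKc.measurableSet]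
  have himg : (extChartAt (𝓡 n) x₀).target ∩ (extChartAt (𝓡 n) x₀).symm ⁻¹' K =
      extChartAt (𝓡 n) x₀ '' K := by
    rw [(extChartAt (𝓡 n) x₀).image_eq_target_inter_inv_preimage hKs]
  rw [himg]
  have hc : IsCompact (extChartAt (𝓡 n) x₀ '' K) :=
    hKc.image_of_continuousOn ((continuousOn_extChartAt x₀).mono hKs)
  have hsub : extChartAt (𝓡 n) x₀ '' K ⊆ (extChartAt (𝓡 n) x₀).target :=
    himg ▸ inter_subset_left
  have hi : IntegrableOn (volDensity n x₀) (extChartAt (𝓡 n) x₀ '' K) :=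
    ((contDiffOn_volDensity x₀).continuousOn.mono hsub).integrableOn_compact hc
  refine lt_of_le_of_lt (lintegral_mono fun y ↦ ?_) hi.2
  exact Real.ofReal_le_enorm _

end Volume

/-! ### Extension by zero and vanishing integrals of derivatives in Euclidean space. -/

section Euclidean

variable {G H : Type*} [NormedAddCommGroup G] [NormedSpace ℝ G]
  [NormedAddCommGroup H] [NormedSpace ℝ H] {U K : Set G}

theorem indicator_eventuallyEq_zero {f : G → H} (hK : IsClosed K) (hKU : K ⊆ U)
    (hf : ∀ y ∈ U \ K, f y = 0) {y : G} (hy : y ∉ U) : U.indicator f =ᶠ[𝓝 y] 0 := by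
  filter_upwards [hK.isOpen_compl.mem_nhds fun h ↦ hy (hKU h)] with z hz
  by_cases hzU : z ∈ U
  · rw [indicator_of_mem hzU, hf z ⟨hzU, hz⟩, Pi.zero_apply]
  · rw [indicator_of_notMem hzU, Pi.zero_apply]

theorem indicator_eventuallyEq_self {f : G → H} (hU : IsOpen U) {y : G} (hy : y ∈ U) :
    U.indicator f =ᶠ[𝓝 y] f := by
  filter_upwards [hU.mem_nhds hy] with z hz using indicator_of_mem hz f

/-- Extension by zero of a function of class `C^k` on an open set, supported in a compact subset. -/
theorem contDiff_indicator {k : ℕ∞ω} {f : G → H} (hU : IsOpen U) (hK : IsClosed K) (hKU : K ⊆ U)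
    (hfc : ContDiffOn ℝ k f U) (hf : ∀ y ∈ U \ K, f y = 0) : ContDiff ℝ k (U.indicator f) := by
  rw [contDiff_iff_contDiffAt]
  intro y
  by_cases hy : y ∈ U
  · exact (hfc.contDiffAt (hU.mem_nhds hy)).congr_of_eventuallyEq
      (indicator_eventuallyEq_self hU hy)
  · exact contDiffAt_const.congr_of_eventuallyEq (indicator_eventuallyEq_zero hK hKU hf hy)

theorem support_indicator_subset_of_eq_zero {f : G → H} (hf : ∀ y ∈ U \ K, f y = 0) :
    Function.support (U.indicator f) ⊆ K := by
  intro y hy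
  by_contra hyK
  by_cases hyU : y ∈ U
  · exact hy (by rw [indicator_of_mem hyU, hf y ⟨hyU, hyK⟩])
  · exact hy (indicator_of_notMem hyU f)

theorem fderiv_eq_zero_of_eq_zero {f : G → H} (hU : IsOpen U) (hK : IsClosed K)
    (hf : ∀ y ∈ U \ K, f y = 0) {y : G} (hy : y ∈ U \ K) : fderiv ℝ f y = 0 := by
  have : f =ᶠ[𝓝 y] fun _ ↦ 0 := by
    filter_upwards [(hU.sdiff hK).mem_nhds hy] with z hz using hf z hz
  rw [this.fderiv_eq]
  simp

variable [FiniteDimensional ℝ G] [MeasurableSpace G] [BorelSpace G] {μ : Measure G}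

theorem integrableOn_of_continuousOn_of_eq_zero [IsLocallyFiniteMeasure μ] {f : G → ℝ}
    (hU : IsOpen U) (hK : IsCompact K) (hKU : K ⊆ U) (hfc : ContinuousOn f U)
    (hf : ∀ y ∈ U \ K, f y = 0) : IntegrableOn f U μ :=
  ((hfc.mono hKU).integrableOn_compact hK).of_forall_sdiff_eq_zero hU.measurableSet hf

variable [μ.IsAddHaarMeasure]

theorem integral_fderiv_eq_zero {f : G → ℝ} (hf : ContDiff ℝ 1 f) (hc : HasCompactSupport f)
    (v : G) : ∫ y, fderiv ℝ f y v ∂μ = 0 := by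
  have h := integral_mul_fderiv_eq_neg_fderiv_mul_of_integrable (μ := μ) (f := fun _ : G ↦ (1 : ℝ))
    (g := f) (v := v) (by simp) ?_ (by simpa using hf.continuous.integrable_of_hasCompactSupport hc)
    (fun _ _ ↦ differentiableAt_const _) (fun y _ ↦ hf.differentiable (by norm_num) y)
  · simpa using h
  · have h1 : Continuous fun y ↦ fderiv ℝ f y v := (hf.continuous_fderiv (by norm_num)).clm_apply
      continuous_const
    simpa using h1.integrable_of_hasCompactSupport (hc.fderiv_apply ℝ v)

/-- Functions read in a chart are controlled only on the chart target `U`. Extending by zero off `U`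
reduces the claim to the compactly supported case on the whole space. -/
theorem setIntegral_fderiv_eq_zero {f : G → ℝ} (hU : IsOpen U) (hK : IsCompact K) (hKU : K ⊆ U)
    (hfc : ContDiffOn ℝ 1 f U) (hf : ∀ y ∈ U \ K, f y = 0) (v : G) :
    ∫ y in U, fderiv ℝ f y v ∂μ = 0 := by
  rw [← integral_fderiv_eq_zero (μ := μ) (contDiff_indicator hU hK.isClosed hKU hfc hf)
    (HasCompactSupport.intro hK fun y hy ↦ by
      by_contra h
      exact hy (support_indicator_subset_of_eq_zero hf h)) v,
    ← integral_indicator hU.measurableSet]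
  congr 1
  ext y
  by_cases hy : y ∈ U
  · rw [indicator_of_mem hy, (indicator_eventuallyEq_self hU hy).fderiv_eq]
  · rw [indicator_of_notMem hy, (indicator_eventuallyEq_zero hK.isClosed hKU hf hy).fderiv_eq]
    simp

end Euclidean

/-! ### C¹ vector fields and integration by parts inside a chart. -/

section Fields

variable {n : ℕ} {M : Type*} [TopologicalSpace M] [ChartedSpace (E n) M]
  [IsManifold (𝓡 n) ∞ M] [RiemannianBundle (fun x : M ↦ TangentSpace (𝓡 n) x)]
  {x₀ x : M} {X : ∀ x : M, TangentSpace (𝓡 n) x} {f : M → ℝ}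

variable (n) in
/-- The vector field `X` is of class `C¹`. -/
def IsC1Field (X : ∀ x : M, TangentSpace (𝓡 n) x) : Prop :=
  ContMDiff (𝓡 n) (𝓡 n).tangent 1 (fun x ↦ (⟨x, X x⟩ : TangentBundle (𝓡 n) M))

theorem IsC1Field.smul (hX : IsC1Field n X) (hf : ContMDiff (𝓡 n) 𝓘(ℝ, ℝ) 1 f) :
    IsC1Field n (fun x ↦ f x • X x) :=
  ContMDiff.smul_section (V := fun x : M ↦ TangentSpace (𝓡 n) x) hf hX

theorem IsTestField.smul [T2Space M] (hX : IsTestField n X)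
    (hf : ContMDiff (𝓡 n) 𝓘(ℝ, ℝ) 1 f) : IsTestField n (fun x ↦ f x • X x) :=
  ⟨IsC1Field.smul hX.1 hf, hX.2.closure_of_subset fun x hx ↦ subset_closure fun h ↦ by
    simp [h] at hx⟩

theorem IsC1Field.smul_of_hasCompactSupport [T2Space M] (hX : IsC1Field n X)
    (hf : ContMDiff (𝓡 n) 𝓘(ℝ, ℝ) 1 f) (hc : HasCompactSupport f) :
    IsTestField n (fun x ↦ f x • X x) :=
  ⟨hX.smul hf, hc.isCompact.closure_of_subset fun x hx ↦ subset_tsupport _ fun h ↦ by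
    simp [h] at hx⟩

theorem contDiffOn_chartD (hX : IsC1Field n X) (x₀ : M) :
    ContDiffOn ℝ 1 (coordField n x₀ X) (extChartAt (𝓡 n) x₀).target := by
  have h := (contMDiffOn_section_iff_chartD one_le_smooth (isOpen_extChartAt_source x₀)
    subset_rfl X).1 (ContMDiff.contMDiffOn hX)
  exact ((contMDiffOn_iff_comp_symm one_le_smooth).1 h).congr fun y hy ↦ coordField_eq X hy

theorem contDiffOn_coordField (hX : IsC1Field n X) (x₀ : M) (i : Fin n) :
    ContDiffOn ℝ 1 (fun y ↦ coordField n x₀ X y i) (extChartAt (𝓡 n) x₀).target :=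
  contDiffOn_euclidean.1 (contDiffOn_chartD hX x₀) i

theorem fderiv_eq_sum (φ : E n →L[ℝ] ℝ) (v : E n) :
    φ v = ∑ i, φ (EuclideanSpace.single i 1) * v i := by
  have h : v = ∑ i, v i • (EuclideanSpace.single i (1 : ℝ) : E n) := by
    simpa using ((EuclideanSpace.basisFun (Fin n) ℝ).sum_repr v).symm
  conv_lhs => rw [h]
  simp only [map_sum, map_smul, smul_eq_mul]
  exact Finset.sum_congr rfl fun _ _ ↦ mul_comm _ _

/-- The derivative of a function along a vector field, in a chart. -/
theorem inner_grad_symm_eq_sum (hf : MDifferentiable (𝓡 n) 𝓘(ℝ, ℝ) f) {y : E n}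
    (hy : y ∈ (extChartAt (𝓡 n) x₀).target) :
    inner ℝ (grad n f ((extChartAt (𝓡 n) x₀).symm y)) (X ((extChartAt (𝓡 n) x₀).symm y)) =
      ∑ i, fderiv ℝ (f ∘ (extChartAt (𝓡 n) x₀).symm) y (EuclideanSpace.single i 1) *
        coordField n x₀ X y i := by
  rw [inner_grad, mfderiv_eq_fderiv_chartD ((extChartAt (𝓡 n) x₀).map_target hy) (hf _),
    (extChartAt (𝓡 n) x₀).right_inv hy, fderiv_eq_sum, coordField_eq X hy]

variable (n) in
/-- The function `∂ᵢ (√(det g) Xⁱ)` in the chart at `x₀`. -/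
def fluxDiv (x₀ : M) (X : ∀ x : M, TangentSpace (𝓡 n) x) (y : E n) : ℝ :=
  ∑ i : Fin n, fderiv ℝ (fun y : E n ↦ volDensity n x₀ y * coordField n x₀ X y i) y
    (EuclideanSpace.single i (1 : ℝ))

variable [IsContMDiffRiemannianBundle (𝓡 n) ∞ (E n) (fun x : M ↦ TangentSpace (𝓡 n) x)]

theorem contDiffOn_flux (hX : IsC1Field n X) (x₀ : M) (i : Fin n) :
    ContDiffOn ℝ 1 (fun y ↦ volDensity n x₀ y * coordField n x₀ X y i)
      (extChartAt (𝓡 n) x₀).target :=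
  ((contDiffOn_volDensity x₀).of_le one_le_smooth).mul (contDiffOn_coordField hX x₀ i)

theorem continuousOn_fluxDiv (hX : IsC1Field n X) (x₀ : M) :
    ContinuousOn (fluxDiv n x₀ X) (extChartAt (𝓡 n) x₀).target :=
  continuousOn_finsetSum _ fun i _ ↦ ((contDiffOn_flux hX x₀ i).continuousOn_fderiv_of_isOpen
    (isOpen_extChartAt_target x₀) le_rfl).clm_apply continuousOn_const

/-- Integration by parts in a chart. -/
theorem setIntegral_mul_fluxDiv (hX : IsC1Field n X) (x₀ : M)
    (hf : ContMDiff (𝓡 n) 𝓘(ℝ, ℝ) 1 f) (hc : HasCompactSupport f)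
    (hs : tsupport f ⊆ (extChartAt (𝓡 n) x₀).source) :
    ∫ y in (extChartAt (𝓡 n) x₀).target, f ((extChartAt (𝓡 n) x₀).symm y) * fluxDiv n x₀ X y =
      -∫ y in (extChartAt (𝓡 n) x₀).target, volDensity n x₀ y *
        inner ℝ (grad n f ((extChartAt (𝓡 n) x₀).symm y)) (X ((extChartAt (𝓡 n) x₀).symm y)) := by
  set U := (extChartAt (𝓡 n) x₀).target
  set K := extChartAt (𝓡 n) x₀ '' tsupport f
  have hU : IsOpen U := isOpen_extChartAt_target x₀
  have hK : IsCompact K := hc.isCompact.image_of_continuousOn ((continuousOn_extChartAt x₀).mono hs)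
  have hKU : K ⊆ U := by
    rintro _ ⟨z, hz, rfl⟩
    exact (extChartAt (𝓡 n) x₀).map_source (hs hz)
  have hf0 : ∀ y ∈ U \ K, (f ∘ (extChartAt (𝓡 n) x₀).symm) y = 0 := by
    intro y hy
    by_contra h
    exact hy.2 ⟨_, subset_tsupport _ h, (extChartAt (𝓡 n) x₀).right_inv hy.1⟩
  have hfc : ContDiffOn ℝ 1 (f ∘ (extChartAt (𝓡 n) x₀).symm) U :=
    ContMDiff.contDiffOn_comp_symm one_le_smooth hf x₀
  have hfd : ContinuousOn (fderiv ℝ (f ∘ (extChartAt (𝓡 n) x₀).symm)) U :=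
    hfc.continuousOn_fderiv_of_isOpen hU le_rfl
  -- Each product f·wᵢ is C¹ with compact support in `U`, so ∂ᵢ(f·wᵢ) has integral zero. Leibniz'
  -- rule and summation over i give the formula.
  let w : Fin n → E n → ℝ := fun i y ↦ volDensity n x₀ y * coordField n x₀ X y i
  have hw : ∀ i, ContDiffOn ℝ 1 (w i) U := fun i ↦ contDiffOn_flux hX x₀ i
  have h1 : ∀ i, ∫ y in U, fderiv ℝ (fun y ↦ (f ∘ (extChartAt (𝓡 n) x₀).symm) y * w i y) y
      (EuclideanSpace.single i 1) = 0 := fun i ↦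
    setIntegral_fderiv_eq_zero hU hK hKU (hfc.mul (hw i)) (fun y hy ↦ by rw [hf0 y hy, zero_mul]) _
  have hi1 : ∀ i, IntegrableOn (fun y ↦ f ((extChartAt (𝓡 n) x₀).symm y) *
      fderiv ℝ (w i) y (EuclideanSpace.single i 1)) U := fun i ↦
    integrableOn_of_continuousOn_of_eq_zero hU hK hKU
      (hfc.continuousOn.mul (((hw i).continuousOn_fderiv_of_isOpen hU le_rfl).clm_apply
        continuousOn_const)) fun y hy ↦ by
          have := hf0 y hy
          rw [Function.comp_apply] at this
          rw [this, zero_mul]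
  have hi2 : ∀ i, IntegrableOn (fun y ↦ fderiv ℝ (f ∘ (extChartAt (𝓡 n) x₀).symm) y
      (EuclideanSpace.single i 1) * w i y) U := fun i ↦
    integrableOn_of_continuousOn_of_eq_zero hU hK hKU
      ((hfd.clm_apply continuousOn_const).mul (hw i).continuousOn) fun y hy ↦ by
        rw [fderiv_eq_zero_of_eq_zero hU hK.isClosed hf0 hy, zero_apply,
          zero_mul]
  have h2 : ∀ i, ∫ y in U, f ((extChartAt (𝓡 n) x₀).symm y) *
      fderiv ℝ (w i) y (EuclideanSpace.single i 1) = -∫ y in U,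
        fderiv ℝ (f ∘ (extChartAt (𝓡 n) x₀).symm) y (EuclideanSpace.single i 1) * w i y := by
    intro i
    rw [eq_neg_iff_add_eq_zero, ← integral_add (hi1 i) (hi2 i), ← h1 i]
    refine setIntegral_congr_fun hU.measurableSet fun y hy ↦ ?_
    have d1 : DifferentiableAt ℝ (f ∘ (extChartAt (𝓡 n) x₀).symm) y :=
      (hfc.differentiableOn (by norm_num)).differentiableAt (hU.mem_nhds hy)
    have d2 : DifferentiableAt ℝ (w i) y :=
      ((hw i).differentiableOn (by norm_num)).differentiableAt (hU.mem_nhds hy)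
    rw [fderiv_fun_mul d1 d2]
    simp only [add_apply, smul_apply, smul_eq_mul,
      Function.comp_apply]
    ring
  have h3 : ∀ y, f ((extChartAt (𝓡 n) x₀).symm y) * fluxDiv n x₀ X y =
      ∑ i, f ((extChartAt (𝓡 n) x₀).symm y) * fderiv ℝ (w i) y (EuclideanSpace.single i 1) :=
    fun y ↦ Finset.mul_sum _ _ _
  simp only [h3]
  rw [integral_finsetSum _ fun i _ ↦ hi1 i]
  simp only [h2, Finset.sum_neg_distrib]
  rw [← integral_finsetSum _ fun i _ ↦ hi2 i]
  congr 1
  refine setIntegral_congr_fun hU.measurableSet fun y hy ↦ ?_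
  rw [inner_grad_symm_eq_sum (hf.mdifferentiable (by norm_num)) hy, Finset.mul_sum]
  refine Finset.sum_congr rfl fun i _ ↦ ?_
  simp only [w]
  ring

end Fields

theorem continuous_mul_of_tsupport_subset {X : Type*} [TopologicalSpace X] {f g : X → ℝ}
    {U : Set X} (hU : IsOpen U) (hf : Continuous f) (hs : tsupport f ⊆ U)
    (hg : ContinuousOn g U) : Continuous fun x ↦ f x * g x := by
  rw [continuous_iff_continuousAt]
  intro x
  by_cases hx : x ∈ U
  · exact hf.continuousAt.mul (hg.continuousAt (hU.mem_nhds hx))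
  · have h0 : f =ᶠ[𝓝 x] fun _ ↦ 0 :=
      notMem_tsupport_iff_eventuallyEq.1 fun h ↦ hx (hs h)
    have : (fun x ↦ f x * g x) =ᶠ[𝓝 x] fun _ ↦ 0 := by
      filter_upwards [h0] with z hz
      rw [hz, zero_mul]
    exact continuousAt_const.congr this.symm

/-! ### The divergence: independence of the chart, continuity, product rule. -/

section Divergence

variable {n : ℕ} {M : Type*} [TopologicalSpace M] [T2Space M] [LocallyCompactSpace M]
  [SigmaCompactSpace M] [ChartedSpace (E n) M]
  [IsManifold (𝓡 n) ∞ M] [RiemannianBundle (fun x : M ↦ TangentSpace (𝓡 n) x)]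
  [IsContMDiffRiemannianBundle (𝓡 n) ∞ (E n) (fun x : M ↦ TangentSpace (𝓡 n) x)]
  {x₀ x₁ x : M} {X : ∀ x : M, TangentSpace (𝓡 n) x} {f : M → ℝ}

theorem continuous_inner_field {X Y : ∀ x : M, TangentSpace (𝓡 n) x} (hX : IsC1Field n X)
    (hY : IsC1Field n Y) : Continuous fun x ↦ inner ℝ (X x) (Y x) :=
  have : IsContMDiffRiemannianBundle (𝓡 n) 1 (E n) (fun x : M ↦ TangentSpace (𝓡 n) x) :=
    IsContMDiffRiemannianBundle.of_le (n := ∞) one_le_smooth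
  (ContMDiff.inner_bundle (IB := 𝓡 n) (F := E n) (E := fun x : M ↦ TangentSpace (𝓡 n) x)
    hX hY).continuous

theorem continuous_norm_field (hX : IsC1Field n X) : Continuous fun x ↦ ‖X x‖ := by
  have : (fun x ↦ ‖X x‖) = fun x ↦ √(inner ℝ (X x) (X x)) := by
    ext x
    rw [real_inner_self_eq_norm_sq, Real.sqrt_sq (norm_nonneg _)]
  rw [this]
  exact (continuous_inner_field hX hX).sqrt

theorem continuous_inner_grad (hX : IsC1Field n X) (hf : ContMDiff (𝓡 n) 𝓘(ℝ, ℝ) 1 f) :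
    Continuous fun x ↦ inner ℝ (grad n f x) (X x) := by
  rw [continuous_iff_continuousAt]
  intro x₀
  have hU := extChartAt_source_mem_nhds (I := 𝓡 n) x₀
  have h1 : ContinuousOn (fun y ↦ ∑ i, fderiv ℝ (f ∘ (extChartAt (𝓡 n) x₀).symm) y
      (EuclideanSpace.single i 1) * coordField n x₀ X y i) (extChartAt (𝓡 n) x₀).target :=
    continuousOn_finsetSum _ fun i _ ↦
      (((ContMDiff.contDiffOn_comp_symm one_le_smooth hf x₀).continuousOn_fderiv_of_isOpen
        (isOpen_extChartAt_target x₀) le_rfl).clm_apply continuousOn_const).mul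
        (contDiffOn_coordField hX x₀ i).continuousOn
  have h2 := h1.comp (continuousOn_extChartAt x₀) fun x hx ↦ (extChartAt (𝓡 n) x₀).map_source hx
  refine ContinuousOn.continuousAt (s := (extChartAt (𝓡 n) x₀).source) (h2.congr fun x hx ↦ ?_) hU
  have := inner_grad_symm_eq_sum (X := X) (hf.mdifferentiable (by norm_num))
    ((extChartAt (𝓡 n) x₀).map_source hx)
  rw [(extChartAt (𝓡 n) x₀).left_inv hx] at this
  exact this

variable [MeasurableSpace M] [BorelSpace M]

/-- Near any point the volume is Lebesgue measure with a strictly positive density. This lets almost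
everywhere equality of continuous functions be upgraded to equality. -/
theorem isOpenPosMeasure_vol : (vol n : Measure M).IsOpenPosMeasure := by
  refine ⟨fun U hU ⟨x₀, hx₀⟩ h0 ↦ ?_⟩
  have hopen : IsOpen (U ∩ (extChartAt (𝓡 n) x₀).source) := hU.inter (isOpen_extChartAt_source x₀)
  have h1 : (vol n : Measure M) (U ∩ (extChartAt (𝓡 n) x₀).source) = 0 :=
    measure_mono_null inter_subset_left h0
  rw [vol_apply_of_subset hopen.measurableSet inter_subset_right,
    chartVolume_apply x₀ hopen.measurableSet] at h1
  have hS : IsOpen ((extChartAt (𝓡 n) x₀).target ∩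
      (extChartAt (𝓡 n) x₀).symm ⁻¹' (U ∩ (extChartAt (𝓡 n) x₀).source)) :=
    (continuousOn_extChartAt_symm x₀).isOpen_inter_preimage (isOpen_extChartAt_target x₀) hopen
  have hmem : extChartAt (𝓡 n) x₀ x₀ ∈ (extChartAt (𝓡 n) x₀).target ∩
      (extChartAt (𝓡 n) x₀).symm ⁻¹' (U ∩ (extChartAt (𝓡 n) x₀).source) := by
    refine ⟨mem_extChartAt_target x₀, ?_⟩
    rw [mem_preimage, extChartAt_to_inv x₀]
    exact ⟨hx₀, mem_extChartAt_source x₀⟩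
  refine (hS.measure_pos volume ⟨_, hmem⟩).ne' ?_
  rw [lintegral_eq_zero_iff' ((aemeasurable_volDensity x₀).mono_measure
      (Measure.restrict_mono inter_subset_left le_rfl)).ennreal_ofReal] at h1
  have h2 : ∀ᵐ y ∂(volume.restrict ((extChartAt (𝓡 n) x₀).target ∩
      (extChartAt (𝓡 n) x₀).symm ⁻¹' (U ∩ (extChartAt (𝓡 n) x₀).source))), False := by
    filter_upwards [h1, ae_restrict_mem hS.measurableSet] with y hy hyS
    exact (ENNReal.ofReal_pos.2 (volDensity_pos hyS.1)).ne' hy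
  rwa [Filter.eventually_false_iff_eq_bot, ae_eq_bot, Measure.restrict_eq_zero] at h2

variable (n) in
/-- The divergence of a vector field, computed in the chart at `x₀`. -/
def chartDiv (x₀ : M) (X : ∀ x : M, TangentSpace (𝓡 n) x) (x : M) : ℝ :=
  (volDensity n x₀ (extChartAt (𝓡 n) x₀ x))⁻¹ * fluxDiv n x₀ X (extChartAt (𝓡 n) x₀ x)

theorem divergence_eq_chartDiv_self (X : ∀ x : M, TangentSpace (𝓡 n) x) (x : M) :
    divergence n X x = chartDiv n x X x := rfl

theorem continuousOn_chartDiv (hX : IsC1Field n X) (x₀ : M) :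
    ContinuousOn (chartDiv n x₀ X) (extChartAt (𝓡 n) x₀).source := by
  have h : ContinuousOn (fun y ↦ (volDensity n x₀ y)⁻¹ * fluxDiv n x₀ X y)
      (extChartAt (𝓡 n) x₀).target :=
    ((contDiffOn_volDensity x₀).continuousOn.inv₀ fun y hy ↦ (volDensity_pos hy).ne').mul
      (continuousOn_fluxDiv hX x₀)
  exact h.comp (continuousOn_extChartAt x₀) fun x hx ↦ (extChartAt (𝓡 n) x₀).map_source hx

/-- The density of the volume cancels the factor 1/√(det g) in the divergence. -/
theorem integral_mul_chartDiv_eq_setIntegral (hX : IsC1Field n X) (x₀ : M)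
    (hf : Continuous f) (hs : tsupport f ⊆ (extChartAt (𝓡 n) x₀).source) :
    ∫ x, f x * chartDiv n x₀ X x ∂(vol n : Measure M) =
      ∫ y in (extChartAt (𝓡 n) x₀).target,
        f ((extChartAt (𝓡 n) x₀).symm y) * fluxDiv n x₀ X y := by
  rw [integral_vol_eq x₀ (f := fun x ↦ f x * chartDiv n x₀ X x) ?_ ?_ (aemeasurable_volDensity x₀)]
  · refine setIntegral_congr_fun (measurableSet_target x₀) fun y hy ↦ ?_
    have := (volDensity_pos hy).ne'
    simp only [chartDiv, (extChartAt (𝓡 n) x₀).right_inv hy]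
    field_simp
  · have := ChartedSpace.secondCountable_of_sigmaCompact (E n) M
    exact (continuous_mul_of_tsupport_subset (isOpen_extChartAt_source x₀) hf hs
      (continuousOn_chartDiv hX x₀)).aestronglyMeasurable
  · intro x hx
    rw [image_eq_zero_of_notMem_tsupport fun h ↦ hx (hs h), zero_mul]

/-- The right side does not mention the chart; this is what forces the divergences computed in
different charts to agree. -/
theorem integral_mul_chartDiv (hX : IsC1Field n X) (x₀ : M)
    (hf : ContMDiff (𝓡 n) 𝓘(ℝ, ℝ) 1 f) (hc : HasCompactSupport f)
    (hs : tsupport f ⊆ (extChartAt (𝓡 n) x₀).source) :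
    ∫ x, f x * chartDiv n x₀ X x ∂(vol n : Measure M) =
      -∫ x, inner ℝ (grad n f x) (X x) ∂(vol n : Measure M) := by
  have := ChartedSpace.secondCountable_of_sigmaCompact (E n) M
  rw [integral_mul_chartDiv_eq_setIntegral hX x₀ hf.continuous hs,
    setIntegral_mul_fluxDiv hX x₀ hf hc hs,
    integral_vol_eq x₀ (continuous_inner_grad hX hf).aestronglyMeasurable ?_
      (aemeasurable_volDensity x₀)]
  intro x hx
  have h0 : f =ᶠ[𝓝 x] fun _ ↦ 0 := notMem_tsupport_iff_eventuallyEq.1 fun h ↦ hx (hs h)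
  rw [inner_grad, h0.mfderiv_eq, mfderiv_const]
  rfl

/-- The divergence does not depend on the chart in which it is computed. -/
theorem chartDiv_eq_chartDiv (hX : IsC1Field n X) (x₀ x₁ : M) :
    EqOn (chartDiv n x₀ X) (chartDiv n x₁ X)
      ((extChartAt (𝓡 n) x₀).source ∩ (extChartAt (𝓡 n) x₁).source) := by
  have := isOpenPosMeasure_vol (n := n) (M := M)
  have := isLocallyFiniteMeasure_vol (n := n) (M := M)
  have := ChartedSpace.secondCountable_of_sigmaCompact (E n) M
  set U := (extChartAt (𝓡 n) x₀).source ∩ (extChartAt (𝓡 n) x₁).source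
  have hU : IsOpen U := (isOpen_extChartAt_source x₀).inter (isOpen_extChartAt_source x₁)
  have hc₀ : ContinuousOn (chartDiv n x₀ X) U :=
    (continuousOn_chartDiv hX x₀).mono inter_subset_left
  have hc₁ : ContinuousOn (chartDiv n x₁ X) U :=
    (continuousOn_chartDiv hX x₁).mono inter_subset_right
  refine Measure.eqOn_open_of_ae_eq (μ := vol n) ?_ hU hc₀ hc₁
  -- Both chart divergences have the same integral against every smooth `g` supported in the
  -- overlap, namely −∫⟨∇g,X⟩. Their difference vanishes almost everywhere there, and everywhere by
  -- continuity.
  have key := IsOpen.ae_eq_zero_of_integral_contMDiff_smul_eq_zero (𝓡 n) hU (μ := vol n)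
    (f := fun x ↦ chartDiv n x₀ X x - chartDiv n x₁ X x)
    ((hc₀.sub hc₁).locallyIntegrableOn hU.measurableSet) ?_
  · rw [Filter.EventuallyEq, ae_restrict_iff' hU.measurableSet]
    filter_upwards [key] with x hx hxU using sub_eq_zero.1 (hx hxU)
  · intro g hg hgc hgs
    have hg1 := hg.of_le one_le_smooth
    have hi : ∀ z, U ⊆ (extChartAt (𝓡 n) z).source →
        Integrable (fun x ↦ g x * chartDiv n z X x) (vol n) := fun z hz ↦
      (continuous_mul_of_tsupport_subset hU hg.continuous hgs
        ((continuousOn_chartDiv hX z).mono hz)).integrable_of_hasCompactSupport hgc.mul_right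
    simp only [smul_eq_mul, mul_sub]
    rw [integral_sub (hi x₀ inter_subset_left) (hi x₁ inter_subset_right),
      integral_mul_chartDiv hX x₀ hg1 hgc (hgs.trans inter_subset_left),
      integral_mul_chartDiv hX x₁ hg1 hgc (hgs.trans inter_subset_right), sub_self]

theorem divergence_eq_chartDiv (hX : IsC1Field n X) (hx : x ∈ (extChartAt (𝓡 n) x₀).source) :
    divergence n X x = chartDiv n x₀ X x :=
  chartDiv_eq_chartDiv hX x x₀ ⟨mem_extChartAt_source x, hx⟩

theorem continuous_divergence (hX : IsC1Field n X) : Continuous (divergence n X) := by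
  rw [continuous_iff_continuousAt]
  intro x₀
  exact ((continuousOn_chartDiv hX x₀).congr fun x hx ↦ divergence_eq_chartDiv hX hx).continuousAt
    (extChartAt_source_mem_nhds x₀)

/-- Leibniz' rule in the chart at `x` itself, since √(det g)(fX)ⁱ = f·(√(det g)Xⁱ). The extra term
Σᵢ ∂ᵢf Xⁱ is the pairing with ∇f. -/
theorem divergence_smul (hX : IsC1Field n X) (hf : ContMDiff (𝓡 n) 𝓘(ℝ, ℝ) 1 f) (x : M) :
    divergence n (fun x ↦ f x • X x) x = f x * divergence n X x + inner ℝ (grad n f x) (X x) := by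
  set y := extChartAt (𝓡 n) x x
  have hy : y ∈ (extChartAt (𝓡 n) x).target := mem_extChartAt_target x
  have hU := (isOpen_extChartAt_target (I := 𝓡 n) x).mem_nhds hy
  have hv := (volDensity_pos hy).ne'
  have hxy : (extChartAt (𝓡 n) x).symm y = x := extChartAt_to_inv x
  have hfd : DifferentiableAt ℝ (f ∘ (extChartAt (𝓡 n) x).symm) y :=
    ((ContMDiff.contDiffOn_comp_symm one_le_smooth hf x).differentiableOn
      (by norm_num)).differentiableAt hU
  have h1 : ∀ i, fderiv ℝ (fun z ↦ volDensity n x z *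
        coordField n x (fun x ↦ f x • X x) z i) y (EuclideanSpace.single i 1) =
      f x * fderiv ℝ (fun z ↦ volDensity n x z * coordField n x X z i) y
        (EuclideanSpace.single i 1) + volDensity n x y *
        (fderiv ℝ (f ∘ (extChartAt (𝓡 n) x).symm) y (EuclideanSpace.single i 1) *
          coordField n x X y i) := by
    intro i
    have heq : (fun z ↦ volDensity n x z * coordField n x (fun x ↦ f x • X x) z i) =ᶠ[𝓝 y]
        fun z ↦ (f ∘ (extChartAt (𝓡 n) x).symm) z *
          (volDensity n x z * coordField n x X z i) := by
      filter_upwards [hU] with z hz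
      rw [coordField_eq _ hz, coordField_eq _ hz, map_smul, PiLp.smul_apply, smul_eq_mul,
        Function.comp_apply]
      ring
    have hwd : DifferentiableAt ℝ (fun z ↦ volDensity n x z * coordField n x X z i) y :=
      ((contDiffOn_flux hX x i).differentiableOn (by norm_num)).differentiableAt hU
    rw [heq.fderiv_eq, fderiv_fun_mul hfd hwd]
    simp only [add_apply, smul_apply, smul_eq_mul, Function.comp_apply, hxy]
    ring
  have h2 := inner_grad_symm_eq_sum (X := X) (hf.mdifferentiable (by norm_num)) hy
  rw [hxy] at h2
  rw [h2, divergence_eq_chartDiv_self, divergence_eq_chartDiv_self, chartDiv, chartDiv, fluxDiv,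
    fluxDiv]
  simp only [y] at h1 h2 hv ⊢
  simp only [h1, Finset.sum_add_distrib, ← Finset.mul_sum]
  field_simp

end Divergence

/-! ### Mollification and the chain rule for the reciprocal of a continuous function. -/

section Mollification

variable {G : Type*} [NormedAddCommGroup G] [InnerProductSpace ℝ G] [FiniteDimensional ℝ G]
  [MeasurableSpace G] [BorelSpace G] {μ : Measure G} [μ.IsAddHaarMeasure] {g f : G → ℝ} {v x : G}
  {K U : Set G}

variable (G) in
/-- A sequence of bump functions whose supports shrink to the origin. -/
def bump (k : ℕ) : ContDiffBump (0 : G) where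
  rIn := 1 / (2 * ((k : ℝ) + 1))
  rOut := 1 / ((k : ℝ) + 1)
  rIn_pos := by positivity
  rIn_lt_rOut := by
    apply one_div_lt_one_div_of_lt <;> linarith [(Nat.cast_nonneg k : (0 : ℝ) ≤ k)]

theorem tendsto_bump_rOut : Tendsto (fun k ↦ (bump G k).rOut) atTop (𝓝 0) :=
  tendsto_one_div_add_atTop_nhds_zero_nat

variable (μ) in
/-- The mollification of a function at scale `1 / (k + 1)`. -/
def mollify (k : ℕ) (g : G → ℝ) : G → ℝ :=
  MeasureTheory.convolution ((bump G k).normed μ) g (ContinuousLinearMap.lsmul ℝ ℝ) μ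

theorem mollify_apply (k : ℕ) (g : G → ℝ) (x : G) :
    mollify μ k g x = ∫ t, (bump G k).normed μ t * g (x - t) ∂μ := rfl

theorem mollify_apply_swap (k : ℕ) (g : G → ℝ) (x : G) :
    mollify μ k g x = ∫ y, (bump G k).normed μ (x - y) * g y ∂μ :=
  convolution_lsmul_swap

theorem contDiff_mollify (hg : Continuous g) (k : ℕ) : ContDiff ℝ ∞ (mollify μ k g) :=
  (bump G k).hasCompactSupport_normed.contDiff_convolution_left _ (bump G k).contDiff_normed
    hg.locallyIntegrable

theorem integrable_mollify (hg : Continuous g) (k : ℕ) (x : G) :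
    Integrable (fun t ↦ (bump G k).normed μ t * g (x - t)) μ := by
  refine Continuous.integrable_of_hasCompactSupport ?_
    (bump G k).hasCompactSupport_normed.mul_right
  exact (bump G k).continuous_normed.mul (hg.comp (continuous_const.sub continuous_id))

theorem le_mollify (hg : Continuous g) {c : ℝ} (hc : ∀ y, c ≤ g y) (k : ℕ) (x : G) :
    c ≤ mollify μ k g x := by
  have h : c = ∫ t, (bump G k).normed μ t * c ∂μ := by
    rw [integral_mul_const, (bump G k).integral_normed, one_mul]
  rw [h, mollify_apply]
  exact integral_mono ((bump G k).integrable_normed.mul_const c) (integrable_mollify hg k x)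
    fun t ↦ mul_le_mul_of_nonneg_left (hc _) ((bump G k).nonneg_normed t)

theorem mollify_le (hg : Continuous g) {c : ℝ} (hc : ∀ y, g y ≤ c) (k : ℕ) (x : G) :
    mollify μ k g x ≤ c := by
  have h : c = ∫ t, (bump G k).normed μ t * c ∂μ := by
    rw [integral_mul_const, (bump G k).integral_normed, one_mul]
  rw [h, mollify_apply]
  exact integral_mono (integrable_mollify hg k x) ((bump G k).integrable_normed.mul_const c)
    fun t ↦ mul_le_mul_of_nonneg_left (hc _) ((bump G k).nonneg_normed t)

theorem abs_mollify_le (hg : Continuous g) {B : ℝ} (hB : ∀ y, |g y| ≤ B) (k : ℕ) (x : G) :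
    |mollify μ k g x| ≤ B :=
  abs_le.2 ⟨le_mollify hg (fun y ↦ (abs_le.1 (hB y)).1) k x,
    mollify_le hg (fun y ↦ (abs_le.1 (hB y)).2) k x⟩

theorem tendsto_mollify (hg : Continuous g) (x : G) :
    Tendsto (fun k ↦ mollify μ k g x) atTop (𝓝 (g x)) :=
  ContDiffBump.convolution_tendsto_right_of_continuous tendsto_bump_rOut hg x

/-- Convergence jointly in the scale and the point. Pointwise convergence would not suffice for
`tendsto_mollify_of_tendsto`, where the function being mollified varies with the scale. -/
theorem tendsto_mollify_prod (hg : Continuous g) (x : G) :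
    Tendsto (Function.uncurry fun k ↦ mollify μ k g) (atTop ×ˢ 𝓝 x) (𝓝 (g x)) :=
  ContDiffBump.convolution_tendsto_right (φ := fun p : ℕ × G ↦ bump G p.1) (g := fun _ ↦ g)
    (k := fun p ↦ p.2) (tendsto_bump_rOut.comp tendsto_fst)
    (Eventually.of_forall fun _ ↦ hg.aestronglyMeasurable) ((hg.tendsto x).comp tendsto_snd)
    tendsto_snd

theorem tendsto_mollify_of_tendsto {h : ℕ → G → ℝ} (hh : ∀ k, Continuous (h k))
    {z : ℝ} {x : G} (hz : Tendsto (Function.uncurry h) (atTop ×ˢ 𝓝 x) (𝓝 z)) :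
    Tendsto (fun k ↦ mollify μ k (h k) x) atTop (𝓝 z) :=
  ContDiffBump.convolution_tendsto_right tendsto_bump_rOut
    (Eventually.of_forall fun k ↦ (hh k).aestronglyMeasurable) hz tendsto_const_nhds

theorem fderiv_mollify (hg : ContDiff ℝ 1 g) (hc : HasCompactSupport g) (k : ℕ) (x v : G) :
    fderiv ℝ (mollify μ k g) x v = mollify μ k (fun y ↦ fderiv ℝ g y v) x := by
  have h := hc.hasFDerivAt_convolution_right (ContinuousLinearMap.lsmul ℝ ℝ) (μ := μ)
    (f := (bump G k).normed μ) (bump G k).continuous_normed.locallyIntegrable hg x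
  unfold mollify
  rw [h.fderiv, convolution_precompR_apply _ (bump G k).continuous_normed.locallyIntegrable
    (hc.fderiv ℝ) (hg.continuous_fderiv one_ne_zero)]

theorem mollify_eq_zero {k : ℕ} (hx : x ∉ Metric.cthickening (1 / ((k : ℝ) + 1)) (tsupport g)) :
    mollify μ k g x = 0 := by
  rw [mollify_apply]
  have : ∀ t, (bump G k).normed μ t * g (x - t) = 0 := by
    intro t
    by_cases ht : t ∈ Function.support ((bump G k).normed μ)
    · rw [(bump G k).support_normed_eq, mem_ball_zero_iff] at ht
      have : x - t ∉ tsupport g := fun h ↦ hx (Metric.mem_cthickening_of_dist_le x (x - t) _ _ h (by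
        rw [dist_eq_norm, sub_sub_cancel]
        exact ht.le))
      rw [image_eq_zero_of_notMem_tsupport this, mul_zero]
    · rw [Function.notMem_support.1 ht, zero_mul]
  simp [this]

/-- Mollification is symmetric with respect to the `L²` pairing. -/
theorem integral_mul_mollify (hf : Continuous f) (hg : Continuous g) (hc : HasCompactSupport g)
    (k : ℕ) : ∫ x, f x * mollify μ k g x ∂μ = ∫ y, mollify μ k f y * g y ∂μ := by
  have hint : Integrable (Function.uncurry fun x y ↦ f x * ((bump G k).normed μ (x - y) * g y))
      (μ.prod μ) := by
    refine Continuous.integrable_of_hasCompactSupport ?_ ?_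
    · exact (hf.comp continuous_fst).mul (((bump G k).continuous_normed.comp
        (continuous_fst.sub continuous_snd)).mul (hg.comp continuous_snd))
    · refine HasCompactSupport.intro ((hc.isCompact.cthickening (r := 1 / ((k : ℝ) + 1))).prod
        hc.isCompact) ?_
      rintro ⟨x, y⟩ hxy
      simp only [Function.uncurry_apply_pair]
      by_cases hy : y ∈ tsupport g
      · by_cases ht : x - y ∈ Function.support ((bump G k).normed μ)
        · refine absurd ⟨?_, hy⟩ hxy
          rw [(bump G k).support_normed_eq, mem_ball_zero_iff] at ht
          exact Metric.mem_cthickening_of_dist_le x y _ _ hy (by rw [dist_eq_norm]; exact ht.le)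
        · rw [Function.notMem_support.1 ht, zero_mul, mul_zero]
      · rw [image_eq_zero_of_notMem_tsupport hy, mul_zero, mul_zero]
  simp only [mollify_apply_swap, ← integral_const_mul, ← integral_mul_const]
  rw [integral_integral_swap hint]
  refine integral_congr_ae (Eventually.of_forall fun y ↦
    integral_congr_ae (Eventually.of_forall fun x ↦ ?_))
  simp only
  -- Symmetry of the pairing comes from the bump being an even function.
  rw [← (bump G k).normed_neg (x - y), neg_sub]
  ring

/-- Mollification at scale 1/(k+1) enlarges supports by at most that amount. From scale `N` on they
stay in one compact `K'` inside `U`, which is why indices are later shifted by `N`. -/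
theorem exists_cthickening_subset (hU : IsOpen U) (hK : IsCompact K) (hKU : K ⊆ U) :
    ∃ K' : Set G, IsCompact K' ∧ K' ⊆ U ∧
      ∃ N : ℕ, ∀ k ≥ N, Metric.cthickening (1 / ((k : ℝ) + 1)) K ⊆ K' := by
  obtain ⟨δ, hδ, hsub⟩ := hK.exists_cthickening_subset_open hU hKU
  refine ⟨_, hK.cthickening, hsub, ?_⟩
  obtain ⟨N, hN⟩ := (tendsto_one_div_add_atTop_nhds_zero_nat.eventually
    (gt_mem_nhds hδ)).exists_forall_of_atTop
  exact ⟨N, fun k hk ↦ Metric.cthickening_mono (hN k hk).le K⟩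

/-- Approximation of a nonnegative `C¹` function with compact support by smooth ones. -/
theorem exists_smooth_approx (hU : IsOpen U) (hf : ContDiff ℝ 1 f) (hc : HasCompactSupport f)
    (hfU : tsupport f ⊆ U) (hf0 : ∀ y, 0 ≤ f y) :
    ∃ (K : Set G) (g : ℕ → G → ℝ), IsCompact K ∧ K ⊆ U ∧ (∀ k, ContDiff ℝ ∞ (g k)) ∧
      (∀ k y, 0 ≤ g k y) ∧ (∀ k, ∀ y ∉ K, g k y = 0) ∧
      (∃ B, ∀ k y, |g k y| ≤ B) ∧ (∀ v, ∃ B, ∀ k y, |fderiv ℝ (g k) y v| ≤ B) ∧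
      (∀ y, Tendsto (fun k ↦ g k y) atTop (𝓝 (f y))) ∧
      ∀ y v, Tendsto (fun k ↦ fderiv ℝ (g k) y v) atTop (𝓝 (fderiv ℝ f y v)) := by
  obtain ⟨K, hK, hKU, N, hN⟩ := exists_cthickening_subset hU hc.isCompact hfU
  have hd : ∀ v, Continuous fun y ↦ fderiv ℝ f y v := fun v ↦
    (hf.continuous_fderiv one_ne_zero).clm_apply continuous_const
  refine ⟨K, fun k ↦ mollify volume (k + N) f, hK, hKU, fun k ↦ contDiff_mollify hf.continuous _,
    fun k y ↦ le_mollify hf.continuous hf0 _ y, fun k y hy ↦ mollify_eq_zero fun h ↦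
      hy (hN (k + N) (Nat.le_add_left N k) h), ?_, fun v ↦ ?_, fun y ↦ ?_, fun y v ↦ ?_⟩
  · obtain ⟨B, hB⟩ := hc.exists_bound_of_continuous hf.continuous
    exact ⟨B, fun k y ↦ abs_mollify_le hf.continuous hB _ y⟩
  · obtain ⟨B, hB⟩ := (hc.fderiv_apply ℝ v).exists_bound_of_continuous (hd v)
    refine ⟨B, fun k y ↦ ?_⟩
    rw [fderiv_mollify hf hc]
    exact abs_mollify_le (hd v) hB _ y
  · exact (tendsto_mollify hf.continuous y).comp (tendsto_add_atTop_nat N)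
  · simp only [fderiv_mollify hf hc]
    exact (tendsto_mollify (hd v) y).comp (tendsto_add_atTop_nat N)

/-- The chain rule for the reciprocal of a continuous function with a weak derivative. The weak
derivative is given as the functional `f ↦ L f`, continuous for bounded pointwise convergence with
supports in a fixed compact set. -/
theorem weak_deriv_inv {φ : G → ℝ} (hφ : Continuous φ) {c : ℝ} (hc : 0 < c) (hcφ : ∀ y, c ≤ φ y)
    (hU : IsOpen U) (L : (G → ℝ) → ℝ)
    (hL : ∀ f, ContDiff ℝ 1 f → HasCompactSupport f → tsupport f ⊆ U →
      L f = -∫ y, φ y * fderiv ℝ f y v ∂μ)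
    (hLc : ∀ (K : Set G) (f : ℕ → G → ℝ) (h : G → ℝ) (B : ℝ), IsCompact K → K ⊆ U →
      (∀ k, Continuous (f k)) → (∀ k, ∀ y ∉ K, f k y = 0) → (∀ k y, |f k y| ≤ B) →
      (∀ y, Tendsto (fun k ↦ f k y) atTop (𝓝 (h y))) → Tendsto (fun k ↦ L (f k)) atTop (𝓝 (L h)))
    (hf : ContDiff ℝ 1 f) (hfc : HasCompactSupport f) (hfU : tsupport f ⊆ U) :
    L (fun y ↦ f y / φ y ^ 2) = ∫ y, fderiv ℝ f y v / φ y ∂μ := by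
  obtain ⟨K, hK, hKU, N, hN⟩ := exists_cthickening_subset hU hfc.isCompact hfU
  let p : ℕ → G → ℝ := fun k ↦ mollify μ k φ
  have hp : ∀ k, ContDiff ℝ 1 (p k) := fun k ↦ (contDiff_mollify hφ k).of_le one_le_smooth
  have hpc : ∀ k y, c ≤ p k y := fun k y ↦ le_mollify hφ hcφ k y
  have hp0 : ∀ k y, p k y ≠ 0 := fun k y ↦ (hc.trans_le (hpc k y)).ne'
  -- With φ replaced by its mollification pₖ, the test function f/φ² becomes the C¹ function hₖ =
  -- f/pₖ². It is mollified once more, at the same scale, so that the second mollifier can be moved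
  -- onto φ.
  let h : ℕ → G → ℝ := fun k y ↦ f y / p k y ^ 2
  have hh : ∀ k, ContDiff ℝ 1 (h k) := fun k ↦
    hf.div ((hp k).pow 2) fun y ↦ pow_ne_zero 2 (hp0 k y)
  have hhs : ∀ k, Function.support (h k) ⊆ Function.support f := by
    intro k y hy hy0
    exact hy (by simp only [h, hy0, zero_div])
  have hht : ∀ k, tsupport (h k) ⊆ tsupport f := fun k ↦ closure_mono (hhs k)
  have hhc : ∀ k, HasCompactSupport (h k) := fun k ↦ hfc.mono (hhs k)
  obtain ⟨B, hB⟩ := hfc.exists_bound_of_continuous hf.continuous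
  have hB0 : 0 ≤ B := (norm_nonneg _).trans (hB 0)
  have hhB : ∀ k y, |h k y| ≤ B / c ^ 2 := by
    intro k y
    simp only [h, abs_div, abs_pow]
    rw [abs_of_pos (hc.trans_le (hpc k y))]
    exact div_le_div₀ hB0 (hB y) (by positivity) (by gcongr; exact hpc k y)
  let q : ℕ → G → ℝ := fun k ↦ mollify μ (k + N) (h (k + N))
  have hq : ∀ k, ContDiff ℝ ∞ (q k) := fun k ↦ contDiff_mollify (hh _).continuous _
  have hq0 : ∀ k, ∀ y ∉ K, q k y = 0 := fun k y hy ↦ mollify_eq_zero fun hy' ↦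
    hy (hN (k + N) (Nat.le_add_left N k)
      (Metric.cthickening_subset_of_subset _ (hht _) hy'))
  have hqK : ∀ k, tsupport (q k) ⊆ K := fun k ↦ closure_minimal
    (fun y hy ↦ by_contra fun hyK ↦ hy (hq0 k y hyK)) hK.isClosed
  have hqc : ∀ k, HasCompactSupport (q k) := fun k ↦ HasCompactSupport.intro hK (hq0 k)
  have hqlim : ∀ y, Tendsto (fun k ↦ q k y) atTop (𝓝 (f y / φ y ^ 2)) := by
    intro y
    refine (tendsto_mollify_of_tendsto (μ := μ) (h := h) (fun k ↦ (hh k).continuous) ?_).comp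
      (tendsto_add_atTop_nat N)
    have h1 : Tendsto (fun z : ℕ × G ↦ f z.2) (atTop ×ˢ 𝓝 y) (𝓝 (f y)) :=
      (hf.continuous.tendsto y).comp tendsto_snd
    exact h1.div ((tendsto_mollify_prod (μ := μ) hφ y).pow 2)
      (pow_ne_zero 2 (hc.trans_le (hcφ y)).ne')
  have lim1 : Tendsto (fun k ↦ L (q k)) atTop (𝓝 (L fun y ↦ f y / φ y ^ 2)) :=
    hLc K q _ (B / c ^ 2) hK hKU (fun k ↦ (hq k).continuous) hq0
      (fun k y ↦ abs_mollify_le (hh _).continuous (hhB _) _ y) hqlim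
  have hfd : Continuous fun y ↦ fderiv ℝ f y v :=
    (hf.continuous_fderiv one_ne_zero).clm_apply continuous_const
  have hint1 : ∀ k, Integrable (fun y ↦ fderiv ℝ f y v / p k y) μ := fun k ↦
    (hfd.div (hp k).continuous (hp0 k)).integrable_of_hasCompactSupport
      ((hfc.fderiv_apply ℝ v).mono fun y hy hy0 ↦ hy (by
        rw [Pi.div_apply, show fderiv ℝ f y v = 0 from hy0, zero_div]))
  -- L(qₖ) = −∫ φ ∂ᵥqₖ, and ∂ᵥqₖ is the mollification of ∂ᵥhₖ. Symmetry of mollification turns this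
  -- into −∫ pₖ ∂ᵥhₖ, an expression in C¹ functions only.
  have key : ∀ k, L (q k) = ∫ y, fderiv ℝ f y v / p (k + N) y ∂μ := by
    intro k
    rw [hL (q k) ((hq k).of_le one_le_smooth) (hqc k) ((hqK k).trans hKU)]
    simp only [q, fderiv_mollify (hh _) (hhc _)]
    generalize k + N = k
    have hhd : Continuous fun y ↦ fderiv ℝ (h k) y v :=
      ((hh k).continuous_fderiv one_ne_zero).clm_apply continuous_const
    rw [integral_mul_mollify hφ hhd ((hhc k).fderiv_apply ℝ v), neg_eq_iff_add_eq_zero]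
    have hint2 : Integrable (fun y ↦ p k y * fderiv ℝ (h k) y v) μ :=
      ((hp k).continuous.mul hhd).integrable_of_hasCompactSupport
        ((hhc k).fderiv_apply ℝ v).mul_left
    rw [← integral_add hint2 (hint1 k)]
    have hz := integral_fderiv_eq_zero (μ := μ) ((hp k).mul (hh k)) (hhc k).mul_left v
    -- Since f = p²h, one has ∂f/p = 2h ∂p + p ∂h; adding p ∂h gives 2∂(ph), whose integral is zero.
    have heq : ∀ y, p k y * fderiv ℝ (h k) y v + fderiv ℝ f y v / p k y =
        2 * fderiv ℝ (fun y ↦ p k y * h k y) y v := by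
      intro y
      have dp := (hp k).differentiable one_ne_zero y
      have dh := (hh k).differentiable one_ne_zero y
      have hf_eq : f = fun y ↦ p k y * (p k y * h k y) := by
        ext y
        have := hp0 k y
        simp only [h]
        field_simp
      have hfd_eq : fderiv ℝ f y = fderiv ℝ (fun y ↦ p k y * (p k y * h k y)) y :=
        congrArg (fun F ↦ fderiv ℝ F y) hf_eq
      rw [hfd_eq, fderiv_fun_mul dp (dp.fun_mul dh), fderiv_fun_mul dp dh]
      simp only [add_apply, smul_apply, smul_eq_mul]
      have := hp0 k y
      field_simp
      ring
    simp only [heq, integral_const_mul]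
    rw [show ∫ y, fderiv ℝ (fun y ↦ p k y * h k y) y v ∂μ = 0 from hz, mul_zero]
  have lim2 : Tendsto (fun k ↦ L (q k)) atTop (𝓝 (∫ y, fderiv ℝ f y v / φ y ∂μ)) := by
    simp only [key]
    refine tendsto_integral_of_dominated_convergence (fun y ↦ |fderiv ℝ f y v| / c)
      (fun k ↦ (hint1 _).aestronglyMeasurable) ?_ (fun k ↦ Eventually.of_forall fun y ↦ ?_)
      (Eventually.of_forall fun y ↦ ?_)
    · exact ((hfd.integrable_of_hasCompactSupport (hfc.fderiv_apply ℝ v)).abs).div_const c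
    · rw [Real.norm_eq_abs, abs_div, abs_of_pos (hc.trans_le (hpc _ y))]
      exact div_le_div_of_nonneg_left (abs_nonneg _) hc (hpc _ y)
    · exact tendsto_const_nhds.div ((tendsto_mollify hφ y).comp (tendsto_add_atTop_nat N))
        (hc.trans_le (hcφ y)).ne'
  exact tendsto_nhds_unique lim1 lim2

end Mollification

/-! ### Cutoff functions, partitions of unity and pullbacks from charts. -/

section Cutoffs

variable {n : ℕ} {M : Type*} [TopologicalSpace M] [T2Space M] [LocallyCompactSpace M]
  [SigmaCompactSpace M] [ChartedSpace (E n) M] [IsManifold (𝓡 n) ∞ M] {x₀ : M} {K U : Set M}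

variable (n) in
theorem exists_cutoff (hK : IsCompact K) (hU : IsOpen U) (hKU : K ⊆ U) :
    ∃ χ : M → ℝ, ContMDiff (𝓡 n) 𝓘(ℝ, ℝ) ∞ χ ∧ HasCompactSupport χ ∧ tsupport χ ⊆ U ∧
      (∀ x ∈ K, χ x = 1) ∧ ∀ x, 0 ≤ χ x := by
  obtain ⟨L, hL, hKL, hLU⟩ := exists_compact_between hK hU hKU
  obtain ⟨χ, h0, h1, h01⟩ := exists_contMDiffMap_zero_one_of_isClosed (n := ⊤) (𝓡 n)
    (isOpen_interior (s := L)).isClosed_compl hK.isClosed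
    (disjoint_compl_left_iff_subset.2 hKL)
  have hs : Function.support χ ⊆ L := fun x hx ↦ interior_subset (by_contra fun h ↦ hx (h0 h))
  have hts : tsupport χ ⊆ L := closure_minimal hs hL.isClosed
  exact ⟨χ, χ.contMDiff, hL.of_isClosed_subset (isClosed_tsupport _) hts, hts.trans hLU,
    fun x hx ↦ h1 hx, fun x ↦ (h01 x).1⟩

-- Used to reduce global integral identities and inequalities to ones supported in a single chart.
variable (n) in
theorem exists_chart_partition (hK : IsCompact K) :
    ∃ (t : Finset M) (χ : M → M → ℝ), (∀ p, ContMDiff (𝓡 n) 𝓘(ℝ, ℝ) ∞ (χ p)) ∧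
      (∀ p, tsupport (χ p) ⊆ (extChartAt (𝓡 n) p).source) ∧ (∀ p x, 0 ≤ χ p x) ∧
      ∀ x ∈ K, ∑ p ∈ t, χ p x = 1 := by
  obtain ⟨t, -, ht⟩ := hK.elim_nhds_subcover (fun p ↦ (extChartAt (𝓡 n) p).source)
    fun x _ ↦ extChartAt_source_mem_nhds x
  obtain ⟨f, hf⟩ := SmoothPartitionOfUnity.exists_isSubordinate (𝓡 n) hK.isClosed
    (fun p : t ↦ (extChartAt (𝓡 n) (p : M)).source) (fun p ↦ isOpen_extChartAt_source (p : M))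
    (fun x hx ↦ by
      obtain ⟨p, hp, hxp⟩ := mem_iUnion₂.1 (ht hx)
      exact mem_iUnion.2 ⟨⟨p, hp⟩, hxp⟩)
  classical
  -- Indexing by all points, with the value 0 outside `t`, keeps later sums free of subtypes.
  refine ⟨t, fun p ↦ if h : p ∈ t then f ⟨p, h⟩ else 0, fun p ↦ ?_, fun p ↦ ?_, fun p x ↦ ?_,
    fun x hx ↦ ?_⟩
  · by_cases h : p ∈ t
    · simp only [h, dif_pos]
      exact (f ⟨p, h⟩).contMDiff
    · simp only [h, dif_neg, not_false_iff]
      exact contMDiff_const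
  · by_cases h : p ∈ t
    · simp only [h, dif_pos]
      exact hf ⟨p, h⟩
    · simp [h, tsupport]
  · by_cases h : p ∈ t
    · simp only [h, dif_pos]
      exact f.nonneg _ x
    · simp [h]
  · rw [← f.sum_eq_one hx, finsum_eq_sum_of_fintype, ← Finset.sum_attach]
    refine Finset.sum_congr rfl fun p _ ↦ ?_
    simp

/-- A function on a chart target with compact support, as a function on the manifold. -/
theorem contMDiff_pullback {k : ℕ∞ω} (hk : k ≤ ∞) {g : E n → ℝ} {C : Set (E n)}
    (hC : IsCompact C) (hCU : C ⊆ (extChartAt (𝓡 n) x₀).target)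
    (hg : ContDiffOn ℝ k g (extChartAt (𝓡 n) x₀).target)
    (hg0 : ∀ y ∈ (extChartAt (𝓡 n) x₀).target \ C, g y = 0) :
    ContMDiff (𝓡 n) 𝓘(ℝ, ℝ) k
      ((extChartAt (𝓡 n) x₀).source.indicator (g ∘ extChartAt (𝓡 n) x₀)) ∧
    HasCompactSupport ((extChartAt (𝓡 n) x₀).source.indicator (g ∘ extChartAt (𝓡 n) x₀)) ∧
    tsupport ((extChartAt (𝓡 n) x₀).source.indicator (g ∘ extChartAt (𝓡 n) x₀)) ⊆
      (extChartAt (𝓡 n) x₀).symm '' C := by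
  set F := (extChartAt (𝓡 n) x₀).source.indicator (g ∘ extChartAt (𝓡 n) x₀)
  have hK : IsCompact ((extChartAt (𝓡 n) x₀).symm '' C) :=
    hC.image_of_continuousOn ((continuousOn_extChartAt_symm x₀).mono hCU)
  have hF0 : ∀ x ∉ (extChartAt (𝓡 n) x₀).symm '' C, F x = 0 := by
    intro x hx
    by_cases hxs : x ∈ (extChartAt (𝓡 n) x₀).source
    · refine (indicator_of_mem hxs _).trans ?_
      exact hg0 _ ⟨(extChartAt (𝓡 n) x₀).map_source hxs, fun h ↦
        hx ⟨_, h, (extChartAt (𝓡 n) x₀).left_inv hxs⟩⟩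
    · exact indicator_of_notMem hxs _
  have hts : tsupport F ⊆ (extChartAt (𝓡 n) x₀).symm '' C :=
    closure_minimal (fun x hx ↦ by_contra fun h ↦ hx (hF0 x h)) hK.isClosed
  refine ⟨?_, HasCompactSupport.intro hK hF0, hts⟩
  have hKs : (extChartAt (𝓡 n) x₀).symm '' C ⊆ (extChartAt (𝓡 n) x₀).source := by
    rintro _ ⟨y, hy, rfl⟩
    exact (extChartAt (𝓡 n) x₀).map_target (hCU hy)
  intro x
  by_cases hxs : x ∈ (extChartAt (𝓡 n) x₀).source
  · refine ContMDiffOn.contMDiffAt (s := (extChartAt (𝓡 n) x₀).source) ?_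
      ((isOpen_extChartAt_source x₀).mem_nhds hxs)
    rw [contMDiffOn_iff_comp_symm hk]
    refine hg.congr fun y hy ↦ ?_
    refine (indicator_of_mem ((extChartAt (𝓡 n) x₀).map_target hy) _).trans ?_
    rw [Function.comp_apply, (extChartAt (𝓡 n) x₀).right_inv hy]
  · refine (contMDiffAt_const (c := (0 : ℝ))).congr_of_eventuallyEq ?_
    filter_upwards [hK.isClosed.isOpen_compl.mem_nhds fun h ↦ hxs (hKs h)] with z hz
    exact hF0 z hz

end Cutoffs

/-! ### Pairing a weak gradient with test fields. -/

section WeakGradient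

variable {n : ℕ} {M : Type*} [TopologicalSpace M] [T2Space M] [LocallyCompactSpace M]
  [SigmaCompactSpace M] [ChartedSpace (E n) M]
  [IsManifold (𝓡 n) ∞ M] [RiemannianBundle (fun x : M ↦ TangentSpace (𝓡 n) x)]
  [IsContMDiffRiemannianBundle (𝓡 n) ∞ (E n) (fun x : M ↦ TangentSpace (𝓡 n) x)]
  [MeasurableSpace M] [BorelSpace M]
  {x₀ : M} {X : ∀ x : M, TangentSpace (𝓡 n) x} {φ : M → ℝ}
  {Φ : ∀ x : M, TangentSpace (𝓡 n) x}

theorem exists_forall_abs_le {K : Set M} (hK : IsCompact K) {h : M → ℝ} (hh : ContinuousOn h K) :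
    ∃ B, 0 ≤ B ∧ ∀ x ∈ K, |h x| ≤ B := by
  obtain ⟨B, hB⟩ := hK.exists_bound_of_continuousOn hh
  exact ⟨max B 0, le_max_right _ _, fun x hx ↦ (hB x hx).trans (le_max_left _ _)⟩

theorem IsH1Loc.integrableOn_norm (hΦ : IsH1Loc n (vol n) φ Φ) {K : Set M} (hK : IsCompact K) :
    IntegrableOn (fun x ↦ ‖Φ x‖) K (vol n) := by
  have := isLocallyFiniteMeasure_vol (n := n) (M := M)
  have : IsFiniteMeasure ((vol n : Measure M).restrict K) := ⟨by
    rw [Measure.restrict_apply_univ]; exact hK.measure_lt_top⟩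
  exact (hΦ.memL2Loc_grad K hK).integrable one_le_two

/-- The pairing of a weak gradient with a multiple of a test field is integrable. -/
theorem IsH1Loc.integrable_inner_mul (hΦ : IsH1Loc n (vol n) φ Φ) (hX : IsTestField n X)
    {h : M → ℝ} (hh : Continuous h) :
    Integrable (fun x ↦ inner ℝ (Φ x) (X x) * h x) (vol n) := by
  have := ChartedSpace.secondCountable_of_sigmaCompact (E n) M
  set K := closure {x | X x ≠ 0}
  have hXK : ∀ x ∉ K, X x = 0 := fun x hx ↦ by_contra fun h ↦ hx (subset_closure h)
  obtain ⟨B, hB0, hB⟩ := exists_forall_abs_le hX.2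
    ((continuous_norm_field hX.1).mul hh).continuousOn
  refine IntegrableOn.integrable_of_forall_notMem_eq_zero (s := K) ?_ fun x hx ↦ by
    rw [hXK x hx, inner_zero_right, zero_mul]
  refine Integrable.mono' ((hΦ.integrableOn_norm hX.2).const_mul B)
    ((hΦ.aestronglyMeasurable X hX).mul hh.aestronglyMeasurable).restrict ?_
  filter_upwards [ae_restrict_mem hX.2.measurableSet] with x hx
  have h1 := abs_real_inner_le_norm (Φ x) (X x)
  have h2 := hB x hx
  rw [Pi.mul_apply, abs_mul, abs_of_nonneg (norm_nonneg _)] at h2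
  rw [Real.norm_eq_abs, abs_mul]
  calc |inner ℝ (Φ x) (X x)| * |h x| ≤ ‖Φ x‖ * ‖X x‖ * |h x| := by gcongr
    _ = ‖X x‖ * |h x| * ‖Φ x‖ := by ring
    _ ≤ B * ‖Φ x‖ := by gcongr

/-- Cut-off coordinate fields are defined on all of M; through them a weak gradient is read as
partial derivatives in a chart. -/
theorem contMDiff_smul_coord {χ : M → ℝ} (hχ : ContMDiff (𝓡 n) 𝓘(ℝ, ℝ) ∞ χ)
    (hs : tsupport χ ⊆ (extChartAt (𝓡 n) x₀).source) (v : E n) :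
    IsC1Field n (fun x ↦ χ x • chartDSymm n x₀ x v) :=
  (ContMDiffOn.smul_section_of_tsupport (V := fun x : M ↦ TangentSpace (𝓡 n) x)
    (s := fun x ↦ chartDSymm n x₀ x v) hχ.contMDiffOn (isOpen_extChartAt_source x₀) hs
    (contMDiffOn_coord x₀ v)).of_le one_le_smooth

theorem isTestField_smul_coord {χ : M → ℝ} (hχ : ContMDiff (𝓡 n) 𝓘(ℝ, ℝ) ∞ χ)
    (hc : HasCompactSupport χ)
    (hs : tsupport χ ⊆ (extChartAt (𝓡 n) x₀).source) (v : E n) :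
    IsTestField n (fun x ↦ χ x • chartDSymm n x₀ x v) :=
  ⟨contMDiff_smul_coord hχ hs v, hc.isCompact.closure_of_subset fun x hx ↦
    subset_tsupport _ fun h ↦ by simp [h] at hx⟩

/-- Only the germ of `X` at `x` enters, and it is zero; no regularity of `X` is needed. -/
theorem divergence_eq_zero_of_notMem {x : M} (hx : x ∉ closure {x | X x ≠ 0}) :
    divergence n X x = 0 := by
  have hev : ∀ i, (fun y ↦ volDensity n x y * coordField n x X y i) =ᶠ[𝓝 (extChartAt (𝓡 n) x x)]
      fun _ ↦ 0 := by
    intro i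
    have hcont : ContinuousAt (extChartAt (𝓡 n) x).symm (extChartAt (𝓡 n) x x) :=
      continuousAt_extChartAt_symm x
    have hnb : (closure {x | X x ≠ 0})ᶜ ∈ 𝓝 ((extChartAt (𝓡 n) x).symm (extChartAt (𝓡 n) x x)) := by
      rw [extChartAt_to_inv x]
      exact isClosed_closure.isOpen_compl.mem_nhds hx
    filter_upwards [hcont.preimage_mem_nhds hnb,
      (isOpen_extChartAt_target (I := 𝓡 n) x).mem_nhds (mem_extChartAt_target x)] with y hy hyt
    have h0 : X ((extChartAt (𝓡 n) x).symm y) = 0 := by_contra fun h ↦ hy (subset_closure h)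
    rw [coordField_eq X hyt, h0, map_zero, PiLp.zero_apply, mul_zero]
  unfold divergence
  rw [Finset.sum_eq_zero fun i _ ↦ ?_, mul_zero]
  rw [(hev i).fderiv_eq]
  simp

/-- The integral of a continuous function against the divergence of a test field supported in the
domain of a chart. -/
theorem integral_mul_divergence_eq (hX : IsTestField n X)
    (hs : closure {x | X x ≠ 0} ⊆ (extChartAt (𝓡 n) x₀).source) {h : M → ℝ} (hh : Continuous h) :
    ∫ x, h x * divergence n X x ∂(vol n : Measure M) =
      ∫ y in (extChartAt (𝓡 n) x₀).target,
        h ((extChartAt (𝓡 n) x₀).symm y) * fluxDiv n x₀ X y := by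
  -- The expression `chartDiv` has no meaning outside the chart domain. The cutoff is 1 on the
  -- support of `X` and removes the values there.
  obtain ⟨χ, hχ, hχc, hχs, hχ1, -⟩ := exists_cutoff n hX.2 (isOpen_extChartAt_source x₀) hs
  have hdiv0 : ∀ x ∉ closure {x | X x ≠ 0}, divergence n X x = 0 := fun x hx ↦
    divergence_eq_zero_of_notMem hx
  have h1 : ∀ x, h x * divergence n X x = (h x * χ x) * chartDiv n x₀ X x := by
    intro x
    by_cases hx : x ∈ closure {x | X x ≠ 0}
    · rw [hχ1 x hx, mul_one, divergence_eq_chartDiv hX.1 (hs hx)]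
    · rw [hdiv0 x hx, mul_zero]
      by_cases hxs : x ∈ (extChartAt (𝓡 n) x₀).source
      · rw [← divergence_eq_chartDiv hX.1 hxs, hdiv0 x hx, mul_zero]
      · rw [image_eq_zero_of_notMem_tsupport fun h ↦ hxs (hχs h), mul_zero, zero_mul]
  simp only [h1]
  rw [integral_mul_chartDiv_eq_setIntegral (f := fun x ↦ h x * χ x) hX.1 x₀
    (hh.mul hχ.continuous) ((tsupport_mul_subset_right (f := h) (g := χ)).trans hχs)]
  refine setIntegral_congr_fun (measurableSet_target x₀) fun y hy ↦ ?_
  have hys := (extChartAt (𝓡 n) x₀).map_target hy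
  have h2 := h1 ((extChartAt (𝓡 n) x₀).symm y)
  rw [divergence_eq_chartDiv hX.1 hys, chartDiv, (extChartAt (𝓡 n) x₀).right_inv hy] at h2
  have h3 := (inv_pos.2 (volDensity_pos hy)).ne'
  have h4 : (volDensity n x₀ y)⁻¹ * ((h ((extChartAt (𝓡 n) x₀).symm y) *
      χ ((extChartAt (𝓡 n) x₀).symm y)) * fluxDiv n x₀ X y) =
      (volDensity n x₀ y)⁻¹ * (h ((extChartAt (𝓡 n) x₀).symm y) * fluxDiv n x₀ X y) := by
    linear_combination -h2
  exact mul_left_cancel₀ h3 h4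

end WeakGradient

/-- A positive continuous function on a compact set extends to a continuous function with a positive
lower bound. -/
theorem exists_continuous_extension_pos {G : Type*} [TopologicalSpace G] [NormalSpace G]
    [T2Space G] {K : Set G} (hK : IsCompact K) {f : G → ℝ} (hf : ContinuousOn f K)
    (hpos : ∀ y ∈ K, 0 < f y) :
    ∃ (g : G → ℝ) (c : ℝ), Continuous g ∧ 0 < c ∧ (∀ y, c ≤ g y) ∧ ∀ y ∈ K, g y = f y := by
  obtain ⟨c, hc, hcf⟩ := hK.exists_forall_le' hf hpos
  obtain ⟨g, hg, hgf⟩ := ContinuousMap.exists_restrict_eq_forall_mem_of_closed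
    (⟨K.domRestrict f, hf.domRestrict⟩ : C(K, ℝ)) (t := Ici c) (fun y ↦ hcf y y.2)
    ⟨c, self_mem_Ici⟩ hK.isClosed
  exact ⟨g, c, g.continuous, hc, hg, fun y hy ↦ DFunLike.congr_fun hgf ⟨y, hy⟩⟩

/-! ### The weak gradient of 1/φ for test fields supported in a chart. -/

section ChainRule

variable {n : ℕ} {M : Type*} [TopologicalSpace M] [T2Space M] [LocallyCompactSpace M]
  [SigmaCompactSpace M] [ChartedSpace (E n) M]
  [IsManifold (𝓡 n) ∞ M] [RiemannianBundle (fun x : M ↦ TangentSpace (𝓡 n) x)]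
  [IsContMDiffRiemannianBundle (𝓡 n) ∞ (E n) (fun x : M ↦ TangentSpace (𝓡 n) x)]
  [MeasurableSpace M] [BorelSpace M]
  {x₀ : M} {X : ∀ x : M, TangentSpace (𝓡 n) x} {φ : M → ℝ}
  {Φ : ∀ x : M, TangentSpace (𝓡 n) x} {χ : M → ℝ} {U : Set (E n)}

/-- A weak gradient, as a weak partial derivative in a chart. -/
theorem IsH1Loc.chart_weak_deriv (hΦ : IsH1Loc n (vol n) φ Φ) (hφ : Continuous φ)
    (hU : U ⊆ (extChartAt (𝓡 n) x₀).target)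
    (hχ : ContMDiff (𝓡 n) 𝓘(ℝ, ℝ) ∞ χ) (hχc : HasCompactSupport χ)
    (hχs : tsupport χ ⊆ (extChartAt (𝓡 n) x₀).source)
    (hχ1 : ∀ y ∈ U, χ ((extChartAt (𝓡 n) x₀).symm y) = 1) (i : Fin n)
    {f : E n → ℝ} (hf : ContDiff ℝ 1 f) (hfc : HasCompactSupport f) (hfU : tsupport f ⊆ U) :
    ∫ x in (extChartAt (𝓡 n) x₀).source,
      inner ℝ (Φ x) (χ x • chartDSymm n x₀ x (EuclideanSpace.single i 1)) *
        (f (extChartAt (𝓡 n) x₀ x) / volDensity n x₀ (extChartAt (𝓡 n) x₀ x)) ∂(vol n : Measure M) =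
    -∫ y in (extChartAt (𝓡 n) x₀).target, φ ((extChartAt (𝓡 n) x₀).symm y) *
      fderiv ℝ f y (EuclideanSpace.single i 1) := by
  set Xi : ∀ x : M, TangentSpace (𝓡 n) x :=
    fun x ↦ χ x • chartDSymm n x₀ x (EuclideanSpace.single i 1)
  have hXi : IsTestField n Xi := isTestField_smul_coord hχ hχc hχs _
  have hv0 : ∀ y ∈ (extChartAt (𝓡 n) x₀).target, volDensity n x₀ y ≠ 0 :=
    fun y hy ↦ (volDensity_pos hy).ne'
  -- Dividing by the density gives F·Xi the single component f/√(det g) in direction i. Its flux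
  -- √(det g)(F·Xi)ʲ is then f δᵢⱼ, with divergence ∂ᵢf.
  obtain ⟨hF, hFc, hFs⟩ := contMDiff_pullback (x₀ := x₀) (g := fun y ↦ f y / volDensity n x₀ y)
    one_le_smooth hfc.isCompact (hfU.trans hU)
    (hf.contDiffOn.div ((contDiffOn_volDensity x₀).of_le one_le_smooth) hv0)
    fun y hy ↦ by rw [image_eq_zero_of_notMem_tsupport hy.2, zero_div]
  set F := (extChartAt (𝓡 n) x₀).source.indicator
    ((fun y ↦ f y / volDensity n x₀ y) ∘ extChartAt (𝓡 n) x₀)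
  have hFm : ∀ x ∈ (extChartAt (𝓡 n) x₀).source, F x =
      f (extChartAt (𝓡 n) x₀ x) / volDensity n x₀ (extChartAt (𝓡 n) x₀ x) :=
    fun x hx ↦ indicator_of_mem hx _
  have hF0 : ∀ x ∉ (extChartAt (𝓡 n) x₀).source, F x = 0 := fun x hx ↦ indicator_of_notMem hx _
  have hZ := hXi.smul hF
  have hZs : closure {x | F x • Xi x ≠ 0} ⊆ (extChartAt (𝓡 n) x₀).source := by
    have h1 : closure {x | F x • Xi x ≠ 0} ⊆ tsupport F :=
      closure_mono fun x hx h0 ↦ hx (by rw [h0, zero_smul])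
    refine (h1.trans hFs).trans ?_
    rintro _ ⟨y, hy, rfl⟩
    exact (extChartAt (𝓡 n) x₀).map_target (hU (hfU hy))
  have hcoord : ∀ y ∈ (extChartAt (𝓡 n) x₀).target, ∀ j,
      volDensity n x₀ y * coordField n x₀ (fun x ↦ F x • Xi x) y j =
        f y * (EuclideanSpace.single i (1 : ℝ) : E n) j := by
    intro y hy j
    have hx := (extChartAt (𝓡 n) x₀).map_target hy
    rw [coordField_eq _ hy, map_smul, map_smul, chartD_chartDSymm hx, hFm _ hx,
      (extChartAt (𝓡 n) x₀).right_inv hy, PiLp.smul_apply, PiLp.smul_apply, smul_eq_mul,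
      smul_eq_mul]
    have := hv0 y hy
    by_cases hfy : f y = 0
    · simp [hfy]
    · rw [hχ1 y (hfU (subset_tsupport _ hfy))]
      field_simp
  have hflux : ∀ y ∈ (extChartAt (𝓡 n) x₀).target, fluxDiv n x₀ (fun x ↦ F x • Xi x) y =
      fderiv ℝ f y (EuclideanSpace.single i 1) := by
    intro y hy
    have h1 : ∀ j, fderiv ℝ (fun y ↦ volDensity n x₀ y *
        coordField n x₀ (fun x ↦ F x • Xi x) y j) y (EuclideanSpace.single j 1) =
        fderiv ℝ f y (EuclideanSpace.single j 1) * (EuclideanSpace.single i (1 : ℝ) : E n) j := by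
      intro j
      have heq : (fun y ↦ volDensity n x₀ y * coordField n x₀ (fun x ↦ F x • Xi x) y j) =ᶠ[𝓝 y]
          fun y ↦ f y * (EuclideanSpace.single i (1 : ℝ) : E n) j := by
        filter_upwards [(isOpen_extChartAt_target x₀).mem_nhds hy] with z hz using hcoord z hz j
      rw [heq.fderiv_eq, fderiv_mul_const (hf.differentiable one_ne_zero y), smul_apply,
        smul_eq_mul, mul_comm]
    rw [fluxDiv]
    simp only [h1]
    exact (fderiv_eq_sum _ _).symm
  have h2 : ∫ x in (extChartAt (𝓡 n) x₀).source, inner ℝ (Φ x) (Xi x) *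
      (f (extChartAt (𝓡 n) x₀ x) / volDensity n x₀ (extChartAt (𝓡 n) x₀ x)) ∂(vol n : Measure M) =
      ∫ x, inner ℝ (Φ x) (F x • Xi x) ∂(vol n) := by
    have h3 : ∫ x in (extChartAt (𝓡 n) x₀).source, inner ℝ (Φ x) (F x • Xi x) ∂(vol n : Measure M) =
        ∫ x, inner ℝ (Φ x) (F x • Xi x) ∂(vol n) :=
      setIntegral_eq_integral_of_forall_compl_eq_zero
        fun x hx ↦ by rw [hF0 x hx, zero_smul, inner_zero_right]
    rw [← h3]
    refine setIntegral_congr_fun (measurableSet_source x₀) fun x hx ↦ ?_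
    refine Eq.trans ?_ (real_inner_smul_right (Φ x) (Xi x) (F x)).symm
    rw [hFm x hx, mul_comm]
  rw [h2, hΦ.integral_eq _ hZ, integral_mul_divergence_eq hZ hZs hφ]
  congr 1
  exact setIntegral_congr_fun (measurableSet_target x₀) fun y hy ↦ by rw [hflux y hy]

/-- This supplies the continuity hypothesis of `weak_deriv_inv`. It is dominated convergence: ⟨Φ,X⟩
is integrable, and the factors f/√(det g) are uniformly bounded, since the density is bounded below
on `K`. -/
theorem IsH1Loc.tendsto_chart_pairing (hΦ : IsH1Loc n (vol n) φ Φ) (hX : IsTestField n X)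
    (K : Set (E n)) (f : ℕ → E n → ℝ) (h : E n → ℝ) (B : ℝ) (hK : IsCompact K)
    (hKU : K ⊆ (extChartAt (𝓡 n) x₀).target) (hf : ∀ k, Continuous (f k))
    (hf0 : ∀ k, ∀ y ∉ K, f k y = 0) (hB : ∀ k y, |f k y| ≤ B)
    (hlim : ∀ y, Tendsto (fun k ↦ f k y) atTop (𝓝 (h y))) :
    Tendsto (fun k ↦ ∫ x in (extChartAt (𝓡 n) x₀).source, inner ℝ (Φ x) (X x) *
        (f k (extChartAt (𝓡 n) x₀ x) / volDensity n x₀ (extChartAt (𝓡 n) x₀ x))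
          ∂(vol n : Measure M)) atTop
      (𝓝 (∫ x in (extChartAt (𝓡 n) x₀).source, inner ℝ (Φ x) (X x) *
        (h (extChartAt (𝓡 n) x₀ x) / volDensity n x₀ (extChartAt (𝓡 n) x₀ x))
          ∂(vol n : Measure M))) := by
  have := ChartedSpace.secondCountable_of_sigmaCompact (E n) M
  have hinv : ContinuousOn (fun y ↦ (volDensity n x₀ y)⁻¹) (extChartAt (𝓡 n) x₀).target :=
    (contDiffOn_volDensity x₀).continuousOn.inv₀ fun y hy ↦ (volDensity_pos hy).ne'
  obtain ⟨D, hD⟩ := hK.exists_bound_of_continuousOn (hinv.mono hKU)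
  have hB0 : 0 ≤ B := (abs_nonneg _).trans (hB 0 0)
  have hI : Integrable (fun x ↦ inner ℝ (Φ x) (X x)) (vol n : Measure M) := by
    simpa using hΦ.integrable_inner_mul hX (continuous_const (y := (1 : ℝ)))
  refine tendsto_integral_of_dominated_convergence
    (fun x ↦ |inner ℝ (Φ x) (X x)| * (B * |D|)) (fun k ↦ ?_)
    (hI.abs.mul_const _).restrict (fun k ↦ ?_) ?_
  · refine hI.aestronglyMeasurable.restrict.mul ?_
    refine ContinuousOn.aestronglyMeasurable ?_ (measurableSet_source x₀)
    have h1 : ContinuousOn (fun y ↦ f k y / volDensity n x₀ y) (extChartAt (𝓡 n) x₀).target := by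
      simp only [div_eq_mul_inv]
      exact (hf k).continuousOn.mul hinv
    exact h1.comp (continuousOn_extChartAt x₀) fun x hx ↦ (extChartAt (𝓡 n) x₀).map_source hx
  · refine Eventually.of_forall fun x ↦ ?_
    rw [Real.norm_eq_abs, abs_mul]
    refine mul_le_mul_of_nonneg_left ?_ (abs_nonneg _)
    by_cases hx : extChartAt (𝓡 n) x₀ x ∈ K
    · rw [div_eq_mul_inv, abs_mul]
      exact mul_le_mul (hB k _) ((hD _ hx).trans (le_abs_self D)) (abs_nonneg _) hB0
    · rw [hf0 k _ hx, zero_div, abs_zero]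
      positivity
  · exact Eventually.of_forall fun x ↦ ((hlim _).div_const _).const_mul _

/-- The weak gradient of `1 / φ`, tested with a field supported in the domain of a chart. -/
theorem IsH1Loc.integral_inv_of_subset (hΦ : IsH1Loc n (vol n) φ Φ) (hφ : Continuous φ)
    (hpos : ∀ x, 0 < φ x) (hX : IsTestField n X)
    (hs : closure {x | X x ≠ 0} ⊆ (extChartAt (𝓡 n) x₀).source) :
    ∫ x, inner ℝ (Φ x) (X x) * (1 / φ x ^ 2) ∂(vol n : Measure M) =
      ∫ x, 1 / φ x * divergence n X x ∂(vol n : Measure M) := by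
  set T := (extChartAt (𝓡 n) x₀).target
  set K := extChartAt (𝓡 n) x₀ '' closure {x | X x ≠ 0}
  have hTo : IsOpen T := isOpen_extChartAt_target x₀
  have hK : IsCompact K := hX.2.image_of_continuousOn ((continuousOn_extChartAt x₀).mono hs)
  have hKT : K ⊆ T := by
    rintro _ ⟨x, hx, rfl⟩
    exact (extChartAt (𝓡 n) x₀).map_source (hs hx)
  -- `weak_deriv_inv` needs a function on the whole Euclidean space with a positive lower bound. So
  -- φ is kept on a compact neighbourhood `K'` of the support and extended from there; the test
  -- functions live in the interior of `K'`, where the extension is φ itself.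
  obtain ⟨K', hK', hKK', hK'T⟩ := exists_compact_between hK hTo hKT
  have hsymmc : ContinuousOn (φ ∘ (extChartAt (𝓡 n) x₀).symm) T :=
    hφ.comp_continuousOn (continuousOn_extChartAt_symm x₀)
  obtain ⟨φ', c, hφ', hc, hcφ', hφφ'⟩ := exists_continuous_extension_pos hK' (hsymmc.mono hK'T)
    fun y _ ↦ hpos _
  obtain ⟨χ, hχ, hχc, hχs, hχ1, -⟩ := exists_cutoff n
    (hK'.image_of_continuousOn ((continuousOn_extChartAt_symm x₀).mono hK'T))
    (isOpen_extChartAt_source x₀) (by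
      rintro _ ⟨y, hy, rfl⟩
      exact (extChartAt (𝓡 n) x₀).map_target (hK'T hy))
  let e : Fin n → E n := fun i ↦ EuclideanSpace.single i 1
  let Y : Fin n → ∀ x : M, TangentSpace (𝓡 n) x := fun i x ↦ χ x • chartDSymm n x₀ x (e i)
  have hY : ∀ i, IsTestField n (Y i) := fun i ↦ isTestField_smul_coord hχ hχc hχs _
  -- In coordinates this is h ↦ ∫ ∂ᵢφ · h dy: the measure dν contributes √(det g), which the
  -- division removes.
  let L : Fin n → (E n → ℝ) → ℝ := fun i h ↦
    ∫ x in (extChartAt (𝓡 n) x₀).source, inner ℝ (Φ x) (Y i x) *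
      (h (extChartAt (𝓡 n) x₀ x) / volDensity n x₀ (extChartAt (𝓡 n) x₀ x)) ∂(vol n : Measure M)
  have hX0 : ∀ y ∈ T \ K, coordField n x₀ X y = 0 := by
    intro y hy
    have : X ((extChartAt (𝓡 n) x₀).symm y) = 0 := by_contra fun h ↦
      hy.2 ⟨_, subset_closure h, (extChartAt (𝓡 n) x₀).right_inv hy.1⟩
    rw [coordField_eq X hy.1, this, map_zero]
  let w : Fin n → E n → ℝ := fun i y ↦ volDensity n x₀ y * coordField n x₀ X y i
  have hw0 : ∀ i, ∀ y ∈ T \ K, w i y = 0 := fun i y hy ↦ by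
    simp only [w, hX0 y hy, PiLp.zero_apply, mul_zero]
  have hwc : ∀ i, ContDiffOn ℝ 1 (w i) T := fun i ↦ contDiffOn_flux hX.1 x₀ i
  -- The right test function in direction i is the flux √(det g)Xⁱ: its density cancels in `L`, and
  -- Σᵢ ∂ᵢ of it is the flux divergence of `X`.
  let f : Fin n → E n → ℝ := fun i ↦ T.indicator (w i)
  have hf : ∀ i, ContDiff ℝ 1 (f i) := fun i ↦
    contDiff_indicator hTo hK.isClosed hKT (hwc i) (hw0 i)
  have hfsupp : ∀ i, Function.support (f i) ⊆ K := fun i ↦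
    support_indicator_subset_of_eq_zero (hw0 i)
  have hfts : ∀ i, tsupport (f i) ⊆ K := fun i ↦ closure_minimal (hfsupp i) hK.isClosed
  have hfc : ∀ i, HasCompactSupport (f i) := fun i ↦
    hK.of_isClosed_subset (isClosed_tsupport _) (hfts i)
  have hmain : ∀ i, L i (fun y ↦ f i y / φ' y ^ 2) = ∫ y, fderiv ℝ (f i) y (e i) / φ' y := by
    intro i
    refine weak_deriv_inv (U := interior K') hφ' hc hcφ' isOpen_interior (L i) ?_ ?_
      (hf i) (hfc i) ((hfts i).trans hKK')
    · intro g hg hgc hgU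
      have h1 := hΦ.chart_weak_deriv hφ (interior_subset.trans hK'T) hχ hχc hχs
        (fun y hy ↦ hχ1 _ ⟨y, interior_subset hy, rfl⟩) i hg hgc hgU
      refine h1.trans ?_
      congr 1
      have h0 : ∀ y ∉ tsupport g, fderiv ℝ g y = 0 := fun y hy ↦
        image_eq_zero_of_notMem_tsupport fun h ↦ hy (tsupport_fderiv_subset ℝ h)
      have h2 : ∫ y in T, φ' y * fderiv ℝ g y (e i) = ∫ y, φ' y * fderiv ℝ g y (e i) :=
        setIntegral_eq_integral_of_forall_compl_eq_zero fun y hy ↦ by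
          rw [h0 y fun h ↦ hy (hK'T (interior_subset (hgU h))), zero_apply, mul_zero]
      rw [← h2]
      refine setIntegral_congr_fun hTo.measurableSet fun y hy ↦ ?_
      by_cases hyg : y ∈ tsupport g
      · simp only [hφφ' y (interior_subset (hgU hyg)), Function.comp_apply, e]
      · simp only [h0 y hyg, zero_apply, mul_zero]
    · intro C g h B hC hCU
      exact hΦ.tendsto_chart_pairing (hY i) C g h B hC (hCU.trans (interior_subset.trans hK'T))
  have hright : ∑ i, ∫ y, fderiv ℝ (f i) y (e i) / φ' y =
      ∫ x, 1 / φ x * divergence n X x ∂(vol n : Measure M) := by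
    have hone : Continuous fun x ↦ 1 / φ x := continuous_const.div hφ fun x ↦ (hpos x).ne'
    rw [integral_mul_divergence_eq hX hs hone, ← integral_finsetSum, ←
      setIntegral_eq_integral_of_forall_compl_eq_zero (s := T)]
    · refine setIntegral_congr_fun hTo.measurableSet fun y hy ↦ ?_
      have h1 : ∀ i, fderiv ℝ (f i) y = fderiv ℝ (w i) y := fun i ↦
        (indicator_eventuallyEq_self hTo hy).fderiv_eq
      simp only [h1, fluxDiv, Finset.mul_sum]
      refine Finset.sum_congr rfl fun i _ ↦ ?_
      by_cases hyK : y ∈ K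
      · rw [hφφ' y (interior_subset (hKK' hyK)), Function.comp_apply, div_eq_mul_one_div, mul_comm]
      · have h2 : fderiv ℝ (w i) y = 0 :=
          fderiv_eq_zero_of_eq_zero hTo hK.isClosed (hw0 i) ⟨hy, hyK⟩
        rw [h2]
        simp only [zero_apply, zero_div, mul_zero]
    · intro y hy
      refine Finset.sum_eq_zero fun i _ ↦ ?_
      rw [show fderiv ℝ (f i) y = 0 from image_eq_zero_of_notMem_tsupport fun h ↦
        hy (hKT (hfts i (tsupport_fderiv_subset ℝ h))), zero_apply, zero_div]
    · intro i _
      refine Continuous.integrable_of_hasCompactSupport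
        ((((hf i).continuous_fderiv one_ne_zero).clm_apply continuous_const).div hφ'
          fun y ↦ (hc.trans_le (hcφ' y)).ne') ?_
      refine ((hfc i).fderiv_apply ℝ (e i)).mono fun y hy hy0 ↦ hy ?_
      change fderiv ℝ (f i) y (e i) / φ' y = 0
      rw [show fderiv ℝ (f i) y (e i) = 0 from hy0, zero_div]
  have hone2 : Continuous fun x ↦ 1 / φ x ^ 2 :=
    continuous_const.div (hφ.pow 2) fun x ↦ (pow_pos (hpos x) 2).ne'
  have hFi := fun i ↦ contMDiff_pullback (x₀ := x₀) (g := fun y ↦ coordField n x₀ X y i)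
    one_le_smooth hK hKT (contDiffOn_coordField hX.1 x₀ i)
    fun y hy ↦ by rw [hX0 y hy, PiLp.zero_apply]
  have hFint := fun i ↦ hΦ.integrable_inner_mul ((hY i).smul (hFi i).1) hone2
  -- Summing over i reassembles X = Σᵢ Xⁱ∂ᵢ, because the cutoff χ equals 1 wherever `X` is nonzero.
  have hleft : ∑ i, L i (fun y ↦ f i y / φ' y ^ 2) =
      ∫ x, inner ℝ (Φ x) (X x) * (1 / φ x ^ 2) ∂(vol n : Measure M) := by
    have h1 : ∀ i, L i (fun y ↦ f i y / φ' y ^ 2) =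
        ∫ x, inner ℝ (Φ x) ((extChartAt (𝓡 n) x₀).source.indicator
          ((fun y ↦ coordField n x₀ X y i) ∘ extChartAt (𝓡 n) x₀) x • Y i x) * (1 / φ x ^ 2)
            ∂(vol n : Measure M) := by
      intro i
      refine Eq.trans ?_ (setIntegral_eq_integral_of_forall_compl_eq_zero
        (s := (extChartAt (𝓡 n) x₀).source) fun x hx ↦ by
          rw [indicator_of_notMem hx, zero_smul, inner_zero_right, zero_mul])
      refine setIntegral_congr_fun (measurableSet_source x₀) fun x hx ↦ ?_
      have hxT : extChartAt (𝓡 n) x₀ x ∈ T := (extChartAt (𝓡 n) x₀).map_source hx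
      have hv := (volDensity_pos hxT).ne'
      have hφx := (hpos x).ne'
      simp only [indicator_of_mem hx, f, indicator_of_mem hxT, Function.comp_apply,
        inner_smul_right, w]
      by_cases hxK : extChartAt (𝓡 n) x₀ x ∈ K
      · have hφe : φ' (extChartAt (𝓡 n) x₀ x) = φ x := by
          rw [hφφ' _ (interior_subset (hKK' hxK)), Function.comp_apply,
            (extChartAt (𝓡 n) x₀).left_inv hx]
        rw [hφe]
        field_simp
      · simp only [hX0 _ ⟨hxT, hxK⟩, PiLp.zero_apply, mul_zero, zero_div, zero_mul]
    simp only [h1]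
    rw [← integral_finsetSum _ fun i _ ↦ hFint i]
    refine integral_congr_ae (Eventually.of_forall fun x ↦ ?_)
    simp only
    rw [← Finset.sum_mul, ← inner_sum]
    congr 2
    by_cases hx : x ∈ (extChartAt (𝓡 n) x₀).source
    · by_cases hX0' : X x = 0
      · rw [hX0']
        refine Finset.sum_eq_zero fun i _ ↦ ?_
        rw [indicator_of_mem hx, Function.comp_apply,
          coordField_eq X ((extChartAt (𝓡 n) x₀).map_source hx), (extChartAt (𝓡 n) x₀).left_inv hx,
          hX0', map_zero, PiLp.zero_apply, zero_smul]
      · have hxK : extChartAt (𝓡 n) x₀ x ∈ K := ⟨x, subset_closure hX0', rfl⟩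
        have hχx : χ x = 1 := hχ1 x ⟨_, interior_subset (hKK' hxK),
          (extChartAt (𝓡 n) x₀).left_inv hx⟩
        conv_rhs => rw [eq_sum_coord hx (X x)]
        refine Finset.sum_congr rfl fun i _ ↦ ?_
        rw [indicator_of_mem hx, Function.comp_apply,
          coordField_eq X ((extChartAt (𝓡 n) x₀).map_source hx), (extChartAt (𝓡 n) x₀).left_inv hx]
        simp only [Y, hχx, one_smul, e]
    · have : X x = 0 := by_contra fun h ↦ hx (hs (subset_closure h))
      rw [this]
      exact Finset.sum_eq_zero fun i _ ↦ by rw [indicator_of_notMem hx, zero_smul]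
  rw [← hleft, ← hright]
  exact Finset.sum_congr rfl fun i _ ↦ hmain i

end ChainRule

/-! ### Globalizing the chain rule, and C² test functions in the supersolution inequality. -/

section Supersolution

variable {n : ℕ} {M : Type*} [TopologicalSpace M] [T2Space M] [LocallyCompactSpace M]
  [SigmaCompactSpace M] [ChartedSpace (E n) M]
  [IsManifold (𝓡 n) ∞ M] [RiemannianBundle (fun x : M ↦ TangentSpace (𝓡 n) x)]
  [IsContMDiffRiemannianBundle (𝓡 n) ∞ (E n) (fun x : M ↦ TangentSpace (𝓡 n) x)]
  [MeasurableSpace M] [BorelSpace M]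
  {x₀ : M} {X : ∀ x : M, TangentSpace (𝓡 n) x} {φ V : M → ℝ}
  {Φ : ∀ x : M, TangentSpace (𝓡 n) x}

theorem contMDiff_sum_fun {k : ℕ∞ω} {ι : Type*} (s : Finset ι) {f : ι → M → ℝ}
    (hf : ∀ i, ContMDiff (𝓡 n) 𝓘(ℝ, ℝ) k (f i)) :
    ContMDiff (𝓡 n) 𝓘(ℝ, ℝ) k fun x ↦ ∑ i ∈ s, f i x :=
  contMDiff_finsetSum fun i _ ↦ hf i

theorem grad_add {f g : M → ℝ} {x : M} (hf : MDifferentiableAt (𝓡 n) 𝓘(ℝ, ℝ) f x)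
    (hg : MDifferentiableAt (𝓡 n) 𝓘(ℝ, ℝ) g x) :
    grad n (fun x ↦ f x + g x) x = grad n f x + grad n g x := by
  refine ext_inner_right ℝ fun v ↦ ?_
  rw [inner_add_left, inner_grad, inner_grad, inner_grad,
    show (fun x ↦ f x + g x) = f + g from rfl, (hf.hasMFDerivAt.add hg.hasMFDerivAt).mfderiv]
  rfl

theorem grad_const (c : ℝ) (x : M) : grad n (fun _ ↦ c) x = 0 := by
  refine ext_inner_right ℝ fun v ↦ ?_
  rw [inner_grad, inner_zero_left, mfderiv_const]
  rfl

theorem grad_sum {ι : Type*} (s : Finset ι) {f : ι → M → ℝ}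
    (hf : ∀ i, ContMDiff (𝓡 n) 𝓘(ℝ, ℝ) 1 (f i)) (x : M) :
    grad n (fun x ↦ ∑ i ∈ s, f i x) x = ∑ i ∈ s, grad n (f i) x := by
  classical
  induction s using Finset.induction_on with
  | empty => simpa using grad_const 0 x
  | insert i s hi ih =>
    simp only [Finset.sum_insert hi]
    rw [grad_add ((hf i).mdifferentiable one_ne_zero x)
      ((contMDiff_sum_fun s hf).mdifferentiable one_ne_zero x), ih]

theorem grad_mul {f g : M → ℝ} {x : M} (hf : MDifferentiableAt (𝓡 n) 𝓘(ℝ, ℝ) f x)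
    (hg : MDifferentiableAt (𝓡 n) 𝓘(ℝ, ℝ) g x) :
    grad n (fun x ↦ f x * g x) x = f x • grad n g x + g x • grad n f x := by
  refine ext_inner_right ℝ fun v ↦ ?_
  rw [inner_add_left, real_inner_smul_left, real_inner_smul_left, inner_grad, inner_grad,
    inner_grad, show (fun x ↦ f x * g x) = f * g from rfl,
    (hf.hasMFDerivAt.mul hg.hasMFDerivAt).mfderiv]
  rfl

/-- The weak gradient of `1 / φ`. -/
theorem IsH1Loc.integral_inv (hΦ : IsH1Loc n (vol n) φ Φ) (hφ : Continuous φ)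
    (hpos : ∀ x, 0 < φ x) (hX : IsTestField n X) :
    ∫ x, inner ℝ (Φ x) (X x) * (1 / φ x ^ 2) ∂(vol n : Measure M) =
      ∫ x, 1 / φ x * divergence n X x ∂(vol n : Measure M) := by
  -- `X` is the sum of the fields χₚX, each supported in one chart, and both sides of the identity
  -- are additive over this sum.
  obtain ⟨t, χ, hχ, hχs, -, hχ1⟩ := exists_chart_partition n hX.2
  have hχ' := fun p ↦ (hχ p).of_le one_le_smooth
  have hXp : ∀ p, IsTestField n fun x ↦ χ p x • X x := fun p ↦ hX.smul (hχ' p)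
  have hX0 : ∀ x ∉ closure {x | X x ≠ 0}, X x = 0 := fun x hx ↦
    by_contra fun h ↦ hx (subset_closure h)
  have hsX : (fun x ↦ (∑ p ∈ t, χ p x) • X x) = X := by
    ext1 x
    by_cases hx : x ∈ closure {x | X x ≠ 0}
    · rw [hχ1 x hx, one_smul]
    · rw [hX0 x hx, smul_zero]
  have hdiv : ∀ x, divergence n X x = ∑ p ∈ t, divergence n (fun x ↦ χ p x • X x) x := by
    intro x
    conv_lhs => rw [← hsX, divergence_smul hX.1 (contMDiff_sum_fun t hχ') x,
      grad_sum t hχ', sum_inner, Finset.sum_mul,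
      ← Finset.sum_add_distrib]
    exact Finset.sum_congr rfl fun p _ ↦ (divergence_smul hX.1 (hχ' p) x).symm
  have hsub : ∀ p, closure {x | χ p x • X x ≠ 0} ⊆ (extChartAt (𝓡 n) p).source := fun p ↦
    (closure_mono fun x (hx : χ p x • X x ≠ 0) (h0 : χ p x = 0) ↦
      hx (by rw [h0, zero_smul])).trans (hχs p)
  have hone : Continuous fun x ↦ 1 / φ x := continuous_const.div hφ fun x ↦ (hpos x).ne'
  have hone2 : Continuous fun x ↦ 1 / φ x ^ 2 :=
    continuous_const.div (hφ.pow 2) fun x ↦ (pow_pos (hpos x) 2).ne'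
  have := isLocallyFiniteMeasure_vol (n := n) (M := M)
  have hint : ∀ p, Integrable (fun x ↦ 1 / φ x * divergence n (fun x ↦ χ p x • X x) x)
      (vol n : Measure M) := fun p ↦
    (hone.mul (continuous_divergence (hXp p).1)).integrable_of_hasCompactSupport
      (HasCompactSupport.intro (hXp p).2 fun x hx ↦ 
        mul_eq_zero_of_right _ (divergence_eq_zero_of_notMem hx))
  have hl : ∀ x, inner ℝ (Φ x) (X x) * (1 / φ x ^ 2) =
      ∑ p ∈ t, inner ℝ (Φ x) (χ p x • X x) * (1 / φ x ^ 2) := by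
    intro x
    conv_lhs => rw [← congr_fun hsX x]
    rw [Finset.sum_smul, inner_sum, Finset.sum_mul]
  simp only [hl, hdiv, Finset.mul_sum]
  rw [integral_finsetSum _ fun p _ ↦ hΦ.integrable_inner_mul (hXp p) hone2,
    integral_finsetSum _ fun p _ ↦ hint p]
  exact Finset.sum_congr rfl fun p _ ↦ hΦ.integral_inv_of_subset hφ hpos (hXp p) (hsub p)

/-- Compactly supported smooth functions that are the coordinates of a chart near a compact set. -/
theorem exists_coord_functions {K : Set M} (hK : IsCompact K)
    (hKs : K ⊆ (extChartAt (𝓡 n) x₀).source) :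
    ∃ ξ : Fin n → M → ℝ, (∀ i, ContMDiff (𝓡 n) 𝓘(ℝ, ℝ) ∞ (ξ i)) ∧
      (∀ i, HasCompactSupport (ξ i)) ∧
      ∀ x ∈ K, ∀ v : TangentSpace (𝓡 n) x, ∀ i, inner ℝ (grad n (ξ i) x) v = chartD n x₀ x v i := by
  have hK' := hK.image_of_continuousOn ((continuousOn_extChartAt x₀).mono hKs)
  have hKT : extChartAt (𝓡 n) x₀ '' K ⊆ (extChartAt (𝓡 n) x₀).target := by
    rintro _ ⟨x, hx, rfl⟩
    exact (extChartAt (𝓡 n) x₀).map_source (hKs hx)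
  obtain ⟨L, hL, hKL, hLT⟩ := exists_compact_between hK' (isOpen_extChartAt_target x₀) hKT
  obtain ⟨χ, hχ, hχc, hχs, hχ1, -⟩ := exists_cutoff (M := E n) n hL
    (isOpen_extChartAt_target x₀) hLT
  have hcoord : ∀ i, ContDiff ℝ ∞ fun y : E n ↦ y i := fun i ↦ contDiff_euclidean.1 contDiff_id i
  have hpb := fun i ↦ contMDiff_pullback (x₀ := x₀) (k := ∞) le_rfl hχc.isCompact hχs
    (g := fun y ↦ χ y * y i) ((contMDiff_iff_contDiff.1 hχ).mul (hcoord i)).contDiffOn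
    fun y hy ↦ by rw [image_eq_zero_of_notMem_tsupport hy.2, zero_mul]
  refine ⟨_, fun i ↦ (hpb i).1, fun i ↦ (hpb i).2.1, fun x hx v i ↦ ?_⟩
  rw [inner_grad, mfderiv_eq_fderiv_chartD (hKs hx) ((hpb i).1.mdifferentiable (by simp) x)]
  have hev : ((extChartAt (𝓡 n) x₀).source.indicator
      ((fun y ↦ χ y * y i) ∘ extChartAt (𝓡 n) x₀) ∘ (extChartAt (𝓡 n) x₀).symm)
      =ᶠ[𝓝 (extChartAt (𝓡 n) x₀ x)] EuclideanSpace.proj (𝕜 := ℝ) i := by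
    filter_upwards [isOpen_interior.mem_nhds (hKL ⟨x, hx, rfl⟩)] with y hy
    have hyT := hLT (interior_subset hy)
    rw [Function.comp_apply, indicator_of_mem ((extChartAt (𝓡 n) x₀).map_target hyT),
      Function.comp_apply, (extChartAt (𝓡 n) x₀).right_inv hyT, hχ1 y (interior_subset hy), one_mul]
    rfl
  rw [hev.fderiv_eq, ContinuousLinearMap.fderiv]
  rfl

/-- Expresses ∇f through the gradients of finitely many fixed functions. Limits and measurability
for varying `f` then concern only scalar coefficients. -/
theorem inner_eq_sum_coord {K : Set M} (hKs : K ⊆ (extChartAt (𝓡 n) x₀).source)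
    {ξ : Fin n → M → ℝ} (hξ : ∀ x ∈ K, ∀ v : TangentSpace (𝓡 n) x, ∀ i,
      inner ℝ (grad n (ξ i) x) v = chartD n x₀ x v i) {x : M} (hx : x ∈ K) {f : M → ℝ}
    (hf : MDifferentiableAt (𝓡 n) 𝓘(ℝ, ℝ) f x) (v : TangentSpace (𝓡 n) x) :
    inner ℝ (grad n f x) v = ∑ i, fderiv ℝ (f ∘ (extChartAt (𝓡 n) x₀).symm)
      (extChartAt (𝓡 n) x₀ x) (EuclideanSpace.single i 1) * inner ℝ (grad n (ξ i) x) v := by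
  rw [inner_grad, mfderiv_eq_fderiv_chartD (hKs hx) hf, fderiv_eq_sum]
  exact Finset.sum_congr rfl fun i _ ↦ by rw [hξ x hx]

theorem grad_eq_zero_of_notMem_tsupport {f : M → ℝ} {x : M} (hx : x ∉ tsupport f) :
    grad n f x = 0 := by
  refine ext_inner_right ℝ fun v ↦ ?_
  have h : f =ᶠ[𝓝 x] fun _ ↦ 0 := notMem_tsupport_iff_eventuallyEq.1 hx
  rw [inner_grad, inner_zero_left, h.mfderiv_eq, mfderiv_const]
  rfl

theorem isTestField_grad {f : M → ℝ} (hf : ContMDiff (𝓡 n) 𝓘(ℝ, ℝ) 2 f)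
    (hc : HasCompactSupport f) : IsTestField n (grad n f) :=
  ⟨contMDiff_grad hf, hc.isCompact.closure_of_subset fun _ hx ↦
    by_contra fun h ↦ hx (grad_eq_zero_of_notMem_tsupport h)⟩

/-- The supersolution inequality for a test function of class `C²` supported in the domain of a
chart. -/
theorem supersolution_of_subset (hΦ : IsH1Loc n (vol n) φ Φ) (hφ : Continuous φ)
    (hV : Continuous V)
    (hsup : ∀ η ∈ testFunctions n M, (∀ x, 0 ≤ η x) →
      0 ≤ ∫ x, inner ℝ (Φ x) (grad n η x) ∂(vol n : Measure M) + ∫ x, V x * φ x * η x ∂(vol n))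
    {η : M → ℝ} (hη : ContMDiff (𝓡 n) 𝓘(ℝ, ℝ) 2 η) (hc : HasCompactSupport η)
    (hs : tsupport η ⊆ (extChartAt (𝓡 n) x₀).source) (h0 : ∀ x, 0 ≤ η x) :
    0 ≤ ∫ x, inner ℝ (Φ x) (grad n η x) ∂(vol n : Measure M) + ∫ x, V x * φ x * η x ∂(vol n) := by
  have := ChartedSpace.secondCountable_of_sigmaCompact (E n) M
  have := isLocallyFiniteMeasure_vol (n := n) (M := M)
  set T := (extChartAt (𝓡 n) x₀).target
  have hTo : IsOpen T := isOpen_extChartAt_target x₀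
  set C := extChartAt (𝓡 n) x₀ '' tsupport η
  have hC : IsCompact C := hc.isCompact.image_of_continuousOn
    ((continuousOn_extChartAt x₀).mono hs)
  have hCT : C ⊆ T := by
    rintro _ ⟨x, hx, rfl⟩
    exact (extChartAt (𝓡 n) x₀).map_source (hs hx)
  have hηC : ∀ y ∈ T \ C, (η ∘ (extChartAt (𝓡 n) x₀).symm) y = 0 := fun y hy ↦
    image_eq_zero_of_notMem_tsupport (f := η) fun h ↦
      hy.2 ⟨_, h, (extChartAt (𝓡 n) x₀).right_inv hy.1⟩
  have hηT := ContMDiff.contDiffOn_comp_symm one_le_smooth (hη.of_le one_le_two) x₀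
  -- The function η read in the chart, extended by zero. Its mollifications, pulled back to M, are
  -- smooth nonnegative test functions supported in one fixed compact set.
  set f : E n → ℝ := T.indicator (η ∘ (extChartAt (𝓡 n) x₀).symm)
  have hf : ContDiff ℝ 1 f := contDiff_indicator hTo hC.isClosed hCT hηT hηC
  have hfC : tsupport f ⊆ C :=
    closure_minimal (support_indicator_subset_of_eq_zero hηC) hC.isClosed
  obtain ⟨L, g, hL, hLT, hg, hg0, hgL, ⟨B, hB⟩, hB', hlim, hlim'⟩ := exists_smooth_approx hTo hf
    (hC.of_isClosed_subset (isClosed_tsupport _) hfC) (hfC.trans hCT)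
    fun y ↦ indicator_nonneg (fun _ _ ↦ h0 _) y
  choose B' hB' using fun i : Fin n ↦ hB' (EuclideanSpace.single i 1)
  set K := (extChartAt (𝓡 n) x₀).symm '' (L ∪ C)
  have hLC : L ∪ C ⊆ T := union_subset hLT hCT
  have hK : IsCompact K := (hL.union hC).image_of_continuousOn
    ((continuousOn_extChartAt_symm x₀).mono hLC)
  have hKs : K ⊆ (extChartAt (𝓡 n) x₀).source := by
    rintro _ ⟨y, hy, rfl⟩
    exact (extChartAt (𝓡 n) x₀).map_target (hLC hy)
  let G : ℕ → M → ℝ := fun k ↦ (extChartAt (𝓡 n) x₀).source.indicator (g k ∘ extChartAt (𝓡 n) x₀)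
  have hG := fun k ↦ contMDiff_pullback (x₀ := x₀) (k := ∞) le_rfl hL hLT (hg k).contDiffOn
    fun y hy ↦ hgL k y hy.2
  have hGm : ∀ k, ∀ x ∈ (extChartAt (𝓡 n) x₀).source, G k x = g k (extChartAt (𝓡 n) x₀ x) :=
    fun k x hx ↦ indicator_of_mem hx _
  have hGK : ∀ k, tsupport (G k) ⊆ K := fun k ↦ (hG k).2.2.trans (image_mono subset_union_left)
  have hηK : tsupport η ⊆ K := fun x hx ↦
    ⟨_, Or.inr ⟨x, hx, rfl⟩, (extChartAt (𝓡 n) x₀).left_inv (hs hx)⟩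
  have hGpos : ∀ k x, 0 ≤ G k x := fun k x ↦ indicator_nonneg (fun _ _ ↦ hg0 k _) x
  have hGη : ∀ x, Tendsto (fun k ↦ G k x) atTop (𝓝 (η x)) := by
    intro x
    by_cases hx : x ∈ (extChartAt (𝓡 n) x₀).source
    · simp only [hGm _ x hx]
      have h1 : f (extChartAt (𝓡 n) x₀ x) = η x := by
        simp only [f]
        rw [indicator_of_mem ((extChartAt (𝓡 n) x₀).map_source hx), Function.comp_apply,
          (extChartAt (𝓡 n) x₀).left_inv hx]
      exact h1 ▸ hlim _
    · have h1 : ∀ k, G k x = 0 := fun k ↦ indicator_of_notMem hx _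
      simp only [h1, image_eq_zero_of_notMem_tsupport fun h ↦ hx (hs h), tendsto_const_nhds]
  have hGB : ∀ k x, |G k x| ≤ B := by
    intro k x
    by_cases hx : x ∈ (extChartAt (𝓡 n) x₀).source
    · rw [hGm k x hx]
      exact hB k _
    · rw [show G k x = 0 from indicator_of_notMem hx _, abs_zero]
      exact (abs_nonneg _).trans (hB 0 0)
  obtain ⟨ξ, hξ, hξc, hξK⟩ := exists_coord_functions hK hKs
  -- The pairings ⟨Φ,∇ξᵢ⟩ are integrable and independent of k, and the coefficients ∂ᵢgₖ are bounded
  -- and converge pointwise. Dominated convergence therefore applies although `Φ` is only locally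
  -- square integrable.
  have hGs : ∀ k, ∀ x ∈ K, inner ℝ (Φ x) (grad n (G k) x) =
      ∑ i, fderiv ℝ (g k) (extChartAt (𝓡 n) x₀ x) (EuclideanSpace.single i 1) *
        inner ℝ (Φ x) (grad n (ξ i) x) := by
    intro k x hx
    have hev : G k ∘ (extChartAt (𝓡 n) x₀).symm =ᶠ[𝓝 (extChartAt (𝓡 n) x₀ x)] g k := by
      filter_upwards [hTo.mem_nhds ((extChartAt (𝓡 n) x₀).map_source (hKs hx))] with y hy
      rw [Function.comp_apply, hGm k _ ((extChartAt (𝓡 n) x₀).map_target hy),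
        (extChartAt (𝓡 n) x₀).right_inv hy]
    rw [real_inner_comm, inner_eq_sum_coord hKs hξK hx ((hG k).1.mdifferentiable (by simp) x),
      hev.fderiv_eq]
    exact Finset.sum_congr rfl fun i _ ↦ by rw [real_inner_comm]
  have hηs : ∀ x ∈ K, inner ℝ (Φ x) (grad n η x) =
      ∑ i, fderiv ℝ f (extChartAt (𝓡 n) x₀ x) (EuclideanSpace.single i 1) *
        inner ℝ (Φ x) (grad n (ξ i) x) := by
    intro x hx
    have hev : f =ᶠ[𝓝 (extChartAt (𝓡 n) x₀ x)] η ∘ (extChartAt (𝓡 n) x₀).symm :=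
      indicator_eventuallyEq_self hTo ((extChartAt (𝓡 n) x₀).map_source (hKs hx))
    rw [real_inner_comm, inner_eq_sum_coord hKs hξK hx (hη.mdifferentiable two_ne_zero x),
      hev.fderiv_eq]
    exact Finset.sum_congr rfl fun i _ ↦ by rw [real_inner_comm]
  have hIξ : ∀ i, Integrable (fun x ↦ inner ℝ (Φ x) (grad n (ξ i) x)) (vol n : Measure M) :=
    fun i ↦ by
      simpa using hΦ.integrable_inner_mul
        (isTestField_grad ((hξ i).of_le two_le_smooth) (hξc i)) (continuous_const (y := (1 : ℝ)))
  have htend1 : Tendsto (fun k ↦ ∫ x, inner ℝ (Φ x) (grad n (G k) x) ∂(vol n : Measure M)) atTop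
      (𝓝 (∫ x, inner ℝ (Φ x) (grad n η x) ∂(vol n : Measure M))) := by
    refine tendsto_integral_of_dominated_convergence
      (fun x ↦ ∑ i, B' i * |inner ℝ (Φ x) (grad n (ξ i) x)|) (fun k ↦ ?_)
      (integrable_finsetSum _ fun i _ ↦ (hIξ i).abs.const_mul _) (fun k ↦ ?_) ?_
    · exact hΦ.aestronglyMeasurable _
        (isTestField_grad ((hG k).1.of_le two_le_smooth) (hG k).2.1)
    · refine Eventually.of_forall fun x ↦ ?_
      have hB0 : ∀ i, 0 ≤ B' i := fun i ↦ (abs_nonneg _).trans (hB' i 0 0)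
      by_cases hx : x ∈ K
      · rw [hGs k x hx, Real.norm_eq_abs]
        refine (Finset.abs_sum_le_sum_abs _ _).trans (Finset.sum_le_sum fun i _ ↦ ?_)
        rw [abs_mul]
        exact mul_le_mul_of_nonneg_right (hB' i k _) (abs_nonneg _)
      · rw [grad_eq_zero_of_notMem_tsupport fun h ↦ hx (hGK k h), inner_zero_right, norm_zero]
        exact Finset.sum_nonneg fun i _ ↦ mul_nonneg (hB0 i) (abs_nonneg _)
    · refine Eventually.of_forall fun x ↦ ?_
      by_cases hx : x ∈ K
      · simp only [hGs _ x hx, hηs x hx]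
        exact tendsto_finsetSum _ fun i _ ↦ (hlim' _ _).mul_const _
      · simp only [grad_eq_zero_of_notMem_tsupport fun h ↦ hx (hGK _ h),
          grad_eq_zero_of_notMem_tsupport fun h ↦ hx (hηK h), tendsto_const_nhds]
  have htend2 : Tendsto (fun k ↦ ∫ x, V x * φ x * G k x ∂(vol n : Measure M)) atTop
      (𝓝 (∫ x, V x * φ x * η x ∂(vol n : Measure M))) := by
    have hVK : Integrable (K.indicator fun x ↦ |V x * φ x| * B) (vol n : Measure M) :=
      (((hV.mul hφ).abs.mul continuous_const).continuousOn.integrableOn_compact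
        hK).integrable_indicator hK.measurableSet
    refine tendsto_integral_of_dominated_convergence _ (fun k ↦ ?_) hVK (fun k ↦ ?_) ?_
    · exact ((hV.mul hφ).mul (hG k).1.continuous).aestronglyMeasurable
    · refine Eventually.of_forall fun x ↦ ?_
      by_cases hx : x ∈ K
      · rw [indicator_of_mem hx, Real.norm_eq_abs, abs_mul]
        exact mul_le_mul_of_nonneg_left (hGB k x) (abs_nonneg _)
      · rw [indicator_of_notMem hx, image_eq_zero_of_notMem_tsupport fun h ↦ hx (hGK k h), mul_zero,
          norm_zero]
    · exact Eventually.of_forall fun x ↦ (hGη x).const_mul _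
  exact ge_of_tendsto' (htend1.add htend2) fun k ↦ hsup (G k) ⟨(hG k).1, (hG k).2.1⟩ (hGpos k)

/-- The supersolution inequality for a test function of class `C²`. -/
theorem supersolution_of_contMDiff_two (hΦ : IsH1Loc n (vol n) φ Φ) (hφ : Continuous φ)
    (hV : Continuous V)
    (hsup : ∀ η ∈ testFunctions n M, (∀ x, 0 ≤ η x) →
      0 ≤ ∫ x, inner ℝ (Φ x) (grad n η x) ∂(vol n : Measure M) + ∫ x, V x * φ x * η x ∂(vol n))
    {η : M → ℝ} (hη : ContMDiff (𝓡 n) 𝓘(ℝ, ℝ) 2 η) (hc : HasCompactSupport η)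
    (h0 : ∀ x, 0 ≤ η x) :
    0 ≤ ∫ x, inner ℝ (Φ x) (grad n η x) ∂(vol n : Measure M) + ∫ x, V x * φ x * η x ∂(vol n) := by
  have := isLocallyFiniteMeasure_vol (n := n) (M := M)
  -- The pieces χₚη remain nonnegative, so the inequality can be applied to each and summed.
  obtain ⟨t, χ, hχ, hχs, hχ0, hχ1⟩ := exists_chart_partition n hc.isCompact
  have hη' : ∀ p, ContMDiff (𝓡 n) 𝓘(ℝ, ℝ) 2 fun x ↦ χ p x * η x := fun p ↦
    ((hχ p).of_le two_le_smooth).mul hη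
  have hc' : ∀ p, HasCompactSupport fun x ↦ χ p x * η x := fun p ↦ hc.mul_left
  have hsum : η = fun x ↦ ∑ p ∈ t, χ p x * η x := by
    ext x
    rw [← Finset.sum_mul]
    by_cases hx : x ∈ tsupport η
    · rw [hχ1 x hx, one_mul]
    · rw [image_eq_zero_of_notMem_tsupport hx, mul_zero]
  have hgrad : ∀ x, grad n η x = ∑ p ∈ t, grad n (fun x ↦ χ p x * η x) x := by
    intro x
    conv_lhs => rw [hsum]
    exact grad_sum t (fun p ↦ (hη' p).of_le one_le_two) x
  have h1 : ∫ x, inner ℝ (Φ x) (grad n η x) ∂(vol n : Measure M) =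
      ∑ p ∈ t, ∫ x, inner ℝ (Φ x) (grad n (fun x ↦ χ p x * η x) x) ∂(vol n : Measure M) := by
    simp only [hgrad, inner_sum]
    refine integral_finsetSum _ fun p _ ↦ ?_
    simpa using hΦ.integrable_inner_mul (isTestField_grad (hη' p) (hc' p))
      (continuous_const (y := (1 : ℝ)))
  have h2 : ∫ x, V x * φ x * η x ∂(vol n : Measure M) =
      ∑ p ∈ t, ∫ x, V x * φ x * (χ p x * η x) ∂(vol n : Measure M) := by
    have hint : ∀ p, Integrable (fun x ↦ V x * φ x * (χ p x * η x)) (vol n : Measure M) := fun p ↦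
      ((hV.mul hφ).mul (hη' p).continuous).integrable_of_hasCompactSupport (hc' p).mul_left
    rw [← integral_finsetSum _ fun p _ ↦ hint p]
    refine integral_congr_ae (Eventually.of_forall fun x ↦ ?_)
    simp only
    rw [← Finset.mul_sum, ← congr_fun hsum x]
  rw [h1, h2, ← Finset.sum_add_distrib]
  refine Finset.sum_nonneg fun p _ ↦ supersolution_of_subset (x₀ := p) hΦ hφ hV hsup (hη' p) (hc' p)
    ?_ fun x ↦ mul_nonneg (hχ0 p x) (h0 x)
  exact (tsupport_mul_subset_left (f := χ p) (g := η)).trans (hχs p)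

end Supersolution

theorem continuous_of_continuousOn_of_eq_zero {X Y : Type*} [TopologicalSpace X]
    [TopologicalSpace Y] [Zero Y] {f : X → Y} {U K : Set X} (hU : IsOpen U) (hK : IsClosed K)
    (hKU : K ⊆ U) (hf : ContinuousOn f U) (h0 : ∀ x ∉ K, f x = 0) : Continuous f := by
  rw [continuous_iff_continuousAt]
  intro x
  by_cases hx : x ∈ U
  · exact hf.continuousAt (hU.mem_nhds hx)
  · have h : f =ᶠ[𝓝 x] fun _ ↦ 0 := by
      filter_upwards [hK.isOpen_compl.mem_nhds fun h ↦ hx (hKU h)] with y hy using h0 y hy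
    exact continuousAt_const.congr h.symm

theorem continuousOn_univ_prod_of_local {X Y Z : Type*} [TopologicalSpace X] [TopologicalSpace Y]
    [TopologicalSpace Z] {f : X × Y → Z} {J : Set Y}
    (h : ∀ x, ∃ K ∈ 𝓝 x, ContinuousOn f (K ×ˢ J)) : ContinuousOn f (univ ×ˢ J) := by
  rintro ⟨x, y⟩ ⟨-, hy⟩
  obtain ⟨K, hK, hf⟩ := h x
  refine (hf (x, y) ⟨mem_of_mem_nhds hK, hy⟩).mono_of_mem_nhdsWithin ?_
  rw [nhdsWithin_prod_eq, nhdsWithin_univ]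
  exact prod_mem_prod hK self_mem_nhdsWithin

/-! ### Joint continuity and measurability in space and time. -/

section JointC1

variable {n : ℕ} {M : Type*} [TopologicalSpace M] [T2Space M] [LocallyCompactSpace M]
  [SigmaCompactSpace M] [ChartedSpace (E n) M]
  [IsManifold (𝓡 n) ∞ M] [RiemannianBundle (fun x : M ↦ TangentSpace (𝓡 n) x)]
  [IsContMDiffRiemannianBundle (𝓡 n) ∞ (E n) (fun x : M ↦ TangentSpace (𝓡 n) x)]
  [MeasurableSpace M] [BorelSpace M]
  {T : ℝ} {v u : M → ℝ → ℝ} {X : ∀ x : M, TangentSpace (𝓡 n) x}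

variable (n) in
/-- The functions on `M × (0, T)` that are continuous, together with their first derivatives in
space. -/
structure IsJointC1 (T : ℝ) (v : M → ℝ → ℝ) : Prop where
  contMDiff : ∀ t ∈ Ioo 0 T, ContMDiff (𝓡 n) 𝓘(ℝ, ℝ) 1 fun x ↦ v x t
  continuousOn_chart : ∀ x₀ : M, ContinuousOn
    (fun p : E n × ℝ ↦ v ((extChartAt (𝓡 n) x₀).symm p.1) p.2)
    ((extChartAt (𝓡 n) x₀).target ×ˢ Ioo 0 T)
  continuousOn_fderiv : ∀ (x₀ : M) (e : E n), ContinuousOn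
    (fun p : E n × ℝ ↦ fderiv ℝ (fun y ↦ v ((extChartAt (𝓡 n) x₀).symm y) p.2) p.1 e)
    ((extChartAt (𝓡 n) x₀).target ×ˢ Ioo 0 T)

/-- Together with `isJointC1_of_contMDiff` this puts the subsolution and the space-time test
functions into one class. -/
theorem IsC21.isJointC1 (hu : IsC21 n T u) : IsJointC1 n T u where
  contMDiff t ht := (hu.contMDiff t ht).of_le one_le_two
  continuousOn_chart x₀ := by
    have h := hu.continuousOn_space x₀ 0 (by norm_num)
    have h1 := (ContinuousMultilinearMap.apply ℝ (fun _ : Fin 0 ↦ E n) ℝ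
      fun _ ↦ 0).continuous.comp_continuousOn h
    refine h1.congr fun p _ ↦ ?_
    simp
  continuousOn_fderiv x₀ e := by
    have h := hu.continuousOn_space x₀ 1 (by norm_num)
    have h1 := (ContinuousMultilinearMap.apply ℝ (fun _ : Fin 1 ↦ E n) ℝ
      fun _ ↦ e).continuous.comp_continuousOn h
    refine h1.congr fun p _ ↦ ?_
    simp

theorem contDiffOn_comp_chart_prod {ψ : M × ℝ → ℝ}
    (hψ : ContMDiff ((𝓡 n).prod 𝓘(ℝ, ℝ)) 𝓘(ℝ, ℝ) ∞ ψ) (x₀ : M) :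
    ContDiffOn ℝ 1 (fun p : E n × ℝ ↦ ψ ((extChartAt (𝓡 n) x₀).symm p.1, p.2))
      ((extChartAt (𝓡 n) x₀).target ×ˢ univ) := by
  rw [← contMDiffOn_iff_contDiffOn]
  have h1 : ContMDiffOn 𝓘(ℝ, E n × ℝ) ((𝓡 n).prod 𝓘(ℝ, ℝ)) ∞
      (fun p : E n × ℝ ↦ ((extChartAt (𝓡 n) x₀).symm p.1, p.2))
      ((extChartAt (𝓡 n) x₀).target ×ˢ univ) :=
    ((contMDiffOn_extChartAt_symm x₀).comp contDiff_fst.contMDiff.contMDiffOn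
      fun p hp ↦ hp.1).prodMk contDiff_snd.contMDiff.contMDiffOn
  exact (hψ.comp_contMDiffOn h1).of_le one_le_smooth

theorem isJointC1_of_contMDiff {ψ : M × ℝ → ℝ}
    (hψ : ContMDiff ((𝓡 n).prod 𝓘(ℝ, ℝ)) 𝓘(ℝ, ℝ) ∞ ψ) : IsJointC1 n T fun x t ↦ ψ (x, t) := by
  have hd := contDiffOn_comp_chart_prod hψ
  have ho : ∀ x₀ : M, IsOpen ((extChartAt (𝓡 n) x₀).target ×ˢ (univ : Set ℝ)) := fun x₀ ↦
    (isOpen_extChartAt_target x₀).prod isOpen_univ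
  refine ⟨fun t _ ↦ ?_, fun x₀ ↦ ?_, fun x₀ e ↦ ?_⟩
  · exact (hψ.comp (contMDiff_id.prodMk contMDiff_const)).of_le one_le_smooth
  · exact (hd x₀).continuousOn.mono (prod_mono_right (subset_univ _))
  · have h1 : ContinuousOn (fun p : E n × ℝ ↦ fderiv ℝ
        (fun p : E n × ℝ ↦ ψ ((extChartAt (𝓡 n) x₀).symm p.1, p.2)) p (e, 0))
        ((extChartAt (𝓡 n) x₀).target ×ˢ Ioo 0 T) :=
      (((hd x₀).continuousOn_fderiv_of_isOpen (ho x₀) le_rfl).clm_apply continuousOn_const).mono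
        (prod_mono_right (subset_univ _))
    refine h1.congr fun p hp ↦ ?_
    have h2 := ((hd x₀).differentiableOn one_ne_zero).differentiableAt
      ((ho x₀).mem_nhds ⟨hp.1, mem_univ p.2⟩)
    have h3 : HasFDerivAt (fun y : E n ↦ (y, p.2)) (ContinuousLinearMap.inl ℝ (E n) ℝ) p.1 :=
      hasFDerivAt_prodMk_left p.1 p.2
    have h4 := (HasFDerivAt.comp p.1 (f := fun y : E n ↦ (y, p.2)) h2.hasFDerivAt h3).fderiv
    have h5 := DFunLike.congr_fun h4 e
    exact h5

theorem continuous_deriv_time {ψ : M × ℝ → ℝ}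
    (hψ : ContMDiff ((𝓡 n).prod 𝓘(ℝ, ℝ)) 𝓘(ℝ, ℝ) ∞ ψ) :
    Continuous fun p : M × ℝ ↦ deriv (fun s ↦ ψ (p.1, s)) p.2 := by
  rw [← continuousOn_univ, ← univ_prod_univ]
  refine continuousOn_univ_prod_of_local fun x₀ ↦
    ⟨(extChartAt (𝓡 n) x₀).source, extChartAt_source_mem_nhds x₀, ?_⟩
  have ho : IsOpen ((extChartAt (𝓡 n) x₀).target ×ˢ (univ : Set ℝ)) :=
    (isOpen_extChartAt_target x₀).prod isOpen_univ
  have hd := contDiffOn_comp_chart_prod hψ x₀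
  have h : ContinuousOn (fun p : M × ℝ ↦ (extChartAt (𝓡 n) x₀ p.1, p.2))
      ((extChartAt (𝓡 n) x₀).source ×ˢ univ) :=
    ((continuousOn_extChartAt x₀).comp continuousOn_fst fun p hp ↦ hp.1).prodMk continuousOn_snd
  have hmaps : MapsTo (fun p : M × ℝ ↦ (extChartAt (𝓡 n) x₀ p.1, p.2))
      ((extChartAt (𝓡 n) x₀).source ×ˢ univ) ((extChartAt (𝓡 n) x₀).target ×ˢ univ) :=
    fun p hp ↦ ⟨(extChartAt (𝓡 n) x₀).map_source hp.1, hp.2⟩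
  refine (((hd.continuousOn_fderiv_of_isOpen ho le_rfl).clm_apply
    (continuousOn_const (c := ((0 : E n), (1 : ℝ))))).comp h hmaps).congr fun p hp ↦ ?_
  have h2 := (hd.differentiableOn one_ne_zero).differentiableAt (ho.mem_nhds (hmaps hp))
  have h3 : HasDerivAt (fun s : ℝ ↦ (extChartAt (𝓡 n) x₀ p.1, s)) ((0 : E n), (1 : ℝ)) p.2 :=
    (hasDerivAt_const _ _).prodMk (hasDerivAt_id _)
  have h4 := (HasFDerivAt.comp_hasDerivAt p.2 (f := fun s : ℝ ↦ (extChartAt (𝓡 n) x₀ p.1, s))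
    h2.hasFDerivAt h3).deriv
  rw [Function.comp_def] at h4
  simp only [(extChartAt (𝓡 n) x₀).left_inv hp.1] at h4
  exact h4

theorem IsJointC1.continuousOn (hv : IsJointC1 n T v) :
    ContinuousOn (fun p : M × ℝ ↦ v p.1 p.2) (univ ×ˢ Ioo 0 T) := by
  refine continuousOn_univ_prod_of_local fun x₀ ↦
    ⟨(extChartAt (𝓡 n) x₀).source, extChartAt_source_mem_nhds x₀, ?_⟩
  have h : ContinuousOn (fun p : M × ℝ ↦ (extChartAt (𝓡 n) x₀ p.1, p.2))
      ((extChartAt (𝓡 n) x₀).source ×ˢ Ioo 0 T) :=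
    ((continuousOn_extChartAt x₀).comp continuousOn_fst fun p hp ↦ hp.1).prodMk continuousOn_snd
  refine ((hv.continuousOn_chart x₀).comp h fun p hp ↦
    ⟨(extChartAt (𝓡 n) x₀).map_source hp.1, hp.2⟩).congr fun p hp ↦ ?_
  simp only [Function.comp_apply, (extChartAt (𝓡 n) x₀).left_inv hp.1]

/-- Near a point, the spatial gradient is a combination with continuous coefficients of the
gradients of smooth functions on `M`. -/
theorem IsJointC1.exists_local (hv : IsJointC1 n T v) (x₀ : M) :
    ∃ K ∈ 𝓝 x₀, IsCompact K ∧ ∃ (ξ : Fin n → M → ℝ) (d : Fin n → M × ℝ → ℝ),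
      (∀ i, ContMDiff (𝓡 n) 𝓘(ℝ, ℝ) ∞ (ξ i)) ∧ (∀ i, HasCompactSupport (ξ i)) ∧
      (∀ i, ContinuousOn (d i) (K ×ˢ Ioo 0 T)) ∧
      ∀ x ∈ K, ∀ t ∈ Ioo 0 T, ∀ Y : TangentSpace (𝓡 n) x,
        inner ℝ (grad n (fun y ↦ v y t) x) Y = ∑ i, d i (x, t) * inner ℝ (grad n (ξ i) x) Y := by
  obtain ⟨K, hK, hKs, hKc⟩ := local_compact_nhds (extChartAt_source_mem_nhds (I := 𝓡 n) x₀)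
  obtain ⟨ξ, hξ, hξc, hξK⟩ := exists_coord_functions hKc hKs
  refine ⟨K, hK, hKc, ξ, fun i p ↦ fderiv ℝ (fun y ↦ v ((extChartAt (𝓡 n) x₀).symm y) p.2)
    (extChartAt (𝓡 n) x₀ p.1) (EuclideanSpace.single i 1), hξ, hξc, fun i ↦ ?_,
    fun x hx t ht Y ↦ ?_⟩
  · have h : ContinuousOn (fun p : M × ℝ ↦ (extChartAt (𝓡 n) x₀ p.1, p.2)) (K ×ˢ Ioo 0 T) :=
      ((continuousOn_extChartAt x₀).comp continuousOn_fst fun p hp ↦ hKs hp.1).prodMk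
        continuousOn_snd
    exact (hv.continuousOn_fderiv x₀ (EuclideanSpace.single i 1)).comp h fun p hp ↦
      ⟨(extChartAt (𝓡 n) x₀).map_source (hKs hp.1), hp.2⟩
  · exact inner_eq_sum_coord hKs hξK hx ((hv.contMDiff t ht).mdifferentiable one_ne_zero x) Y

theorem IsJointC1.continuousOn_inner_grad (hv : IsJointC1 n T v) (hX : IsC1Field n X) :
    ContinuousOn (fun p : M × ℝ ↦ inner ℝ (grad n (fun y ↦ v y p.2) p.1) (X p.1))
      (univ ×ˢ Ioo 0 T) := by
  refine continuousOn_univ_prod_of_local fun x₀ ↦ ?_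
  obtain ⟨K, hK, -, ξ, d, hξ, -, hd, h⟩ := hv.exists_local x₀
  refine ⟨K, hK, ContinuousOn.congr (continuousOn_finsetSum _ fun i _ ↦ (hd i).mul
    ((continuous_inner_field (contMDiff_grad ((hξ i).of_le two_le_smooth)) hX).comp
      continuous_fst).continuousOn) fun p hp ↦ h p.1 hp.1 p.2 hp.2 _⟩

/-- Only one gradient is expanded locally in the fixed fields ∇ξᵢ; each remaining pairing is that of
a gradient with a time-independent C¹ field. -/
theorem IsJointC1.continuousOn_inner_grad_grad (hv : IsJointC1 n T v) (hu : IsJointC1 n T u) :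
    ContinuousOn (fun p : M × ℝ ↦ inner ℝ (grad n (fun y ↦ v y p.2) p.1)
      (grad n (fun y ↦ u y p.2) p.1)) (univ ×ˢ Ioo 0 T) := by
  refine continuousOn_univ_prod_of_local fun x₀ ↦ ?_
  obtain ⟨K, hK, -, ξ, d, hξ, -, hd, h⟩ := hv.exists_local x₀
  refine ⟨K, hK, ContinuousOn.congr (continuousOn_finsetSum Finset.univ fun i _ ↦ (hd i).mul
    ((hu.continuousOn_inner_grad (contMDiff_grad ((hξ i).of_le two_le_smooth))).mono
      (prod_mono_left (subset_univ K)))) fun p hp ↦ (h p.1 hp.1 p.2 hp.2 _).trans <|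
        Finset.sum_congr rfl fun i _ ↦ by rw [real_inner_comm]; rfl⟩

theorem IsJointC1.continuousOn_norm_grad (hv : IsJointC1 n T v) :
    ContinuousOn (fun p : M × ℝ ↦ ‖grad n (fun y ↦ v y p.2) p.1‖) (univ ×ˢ Ioo 0 T) := by
  refine (hv.continuousOn_inner_grad_grad hv).sqrt.congr fun p _ ↦ ?_
  simp only [real_inner_self_eq_norm_sq, Real.sqrt_sq (norm_nonneg _)]

variable {m : Measure M} [SFinite m]

theorem aestronglyMeasurable_prod_of_local {f : M × ℝ → ℝ} {J : Set ℝ}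
    (h : ∀ x, ∃ K ∈ 𝓝 x, AEStronglyMeasurable f ((m.prod volume).restrict (K ×ˢ J))) :
    AEStronglyMeasurable f (m.prod (volume.restrict J)) := by
  choose K hK hf using h
  obtain ⟨s, hs, hsu⟩ := countable_cover_nhds_of_sigmaCompact hK
  have := hs.to_subtype
  have h1 : (⋃ x : s, K x ×ˢ J) = univ ×ˢ J := by
    rw [← iUnion_prod_const, ← hsu, biUnion_eq_iUnion]
  have h2 := (aestronglyMeasurable_iUnion_iff (μ := m.prod volume) (f := f)
    (s := fun x : s ↦ K x ×ˢ J)).2 fun x ↦ hf x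
  rwa [h1, ← Measure.prod_restrict, Measure.restrict_univ] at h2

/-- `F` is measurable only through its pairings with fixed test fields, whereas ∇v depends on time.
Locally ∇v is a combination of fixed fields ∇ξᵢ with jointly continuous coefficients. -/
theorem IsJointC1.aestronglyMeasurable_inner_grad (hv : IsJointC1 n T v)
    {F : ∀ x : M, TangentSpace (𝓡 n) x} (hF : ∀ X : (∀ x : M, TangentSpace (𝓡 n) x),
      IsTestField n X → AEStronglyMeasurable (fun x ↦ inner ℝ (F x) (X x)) m) :
    AEStronglyMeasurable (fun p : M × ℝ ↦ inner ℝ (F p.1) (grad n (fun y ↦ v y p.2) p.1))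
      (m.prod (volume.restrict (Ioo 0 T))) := by
  have := ChartedSpace.secondCountable_of_sigmaCompact (E n) M
  refine aestronglyMeasurable_prod_of_local fun x₀ ↦ ?_
  obtain ⟨K, hK, hKc, ξ, d, hξ, hξc, hd, h⟩ := hv.exists_local x₀
  have hm : MeasurableSet (K ×ˢ Ioo 0 T) := hKc.measurableSet.prod measurableSet_Ioo
  have h1 : AEStronglyMeasurable (fun p : M × ℝ ↦ ∑ i, d i p * inner ℝ (F p.1) (grad n (ξ i) p.1))
      ((m.prod volume).restrict (K ×ˢ Ioo 0 T)) := by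
    refine Finset.aestronglyMeasurable_fun_sum _ fun i _ ↦ ?_
    refine ((hd i).aestronglyMeasurable hm).mul ?_
    exact (AEStronglyMeasurable.comp_fst (hF _ (isTestField_grad ((hξ i).of_le two_le_smooth)
      (hξc i)))).restrict
  refine ⟨K, hK, h1.congr ?_⟩
  filter_upwards [ae_restrict_mem hm] with p hp
  rw [real_inner_comm, h p.1 hp.1 p.2 hp.2]
  exact Finset.sum_congr rfl fun i _ ↦ by rw [real_inner_comm]

end JointC1

theorem aestronglyMeasurable_prod_of_continuousOn {X : Type*} [TopologicalSpace X]
    [MeasurableSpace X] [BorelSpace X] [SecondCountableTopology X] {m : Measure X} [SFinite m]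
    {f : X × ℝ → ℝ} {J : Set ℝ} (hJ : MeasurableSet J) (hf : ContinuousOn f (univ ×ˢ J)) :
    AEStronglyMeasurable f (m.prod (volume.restrict J)) := by
  have h := hf.aestronglyMeasurable (μ := m.prod volume) (MeasurableSet.univ.prod hJ)
  rwa [← Measure.prod_restrict, Measure.restrict_univ] at h

theorem memL2Loc_of_continuous {X : Type*} [TopologicalSpace X] [T2Space X] [MeasurableSpace X]
    [BorelSpace X] [SecondCountableTopology X] {m : Measure X} [IsLocallyFiniteMeasure m]
    {f : X → ℝ} (hf : Continuous f) : MemL2Loc m f := fun K hK ↦ by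
  have : IsFiniteMeasure (m.restrict K) := isFiniteMeasure_restrict.2 hK.measure_lt_top.ne
  obtain ⟨B, hB⟩ := hK.exists_bound_of_continuousOn hf.continuousOn
  exact MemLp.of_bound hf.aestronglyMeasurable B
    ((ae_restrict_mem hK.measurableSet).mono fun x hx ↦ hB x hx)

/-! ### The weighted measure and the quotient rule in H¹_loc. -/

section Weighted

variable {n : ℕ} {M : Type*} [TopologicalSpace M] [T2Space M] [LocallyCompactSpace M]
  [SigmaCompactSpace M] [ChartedSpace (E n) M]
  [IsManifold (𝓡 n) ∞ M] [RiemannianBundle (fun x : M ↦ TangentSpace (𝓡 n) x)]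
  [IsContMDiffRiemannianBundle (𝓡 n) ∞ (E n) (fun x : M ↦ TangentSpace (𝓡 n) x)]
  [MeasurableSpace M] [BorelSpace M]
  {φ f : M → ℝ} {Φ X : ∀ x : M, TangentSpace (𝓡 n) x} {T : ℝ} {u : M → ℝ → ℝ}

theorem isLocallyFiniteMeasure_weightedVol (hφ : Continuous φ) :
    IsLocallyFiniteMeasure (weightedVol n φ) := by
  have := isLocallyFiniteMeasure_vol (n := n) (M := M)
  exact IsLocallyFiniteMeasure.withDensity_ofReal (hφ.pow 2)

theorem sigmaFinite_vol : SigmaFinite (vol n : Measure M) := by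
  have := isLocallyFiniteMeasure_vol (n := n) (M := M)
  have := ChartedSpace.secondCountable_of_sigmaCompact (E n) M
  infer_instance

theorem sigmaFinite_weightedVol (φ : M → ℝ) : SigmaFinite (weightedVol n φ) := by
  have := sigmaFinite_vol (n := n) (M := M)
  exact SigmaFinite.withDensity_ofReal _

theorem weightedVol_absolutelyContinuous (φ : M → ℝ) : weightedVol n φ ≪ (vol n : Measure M) :=
  withDensity_absolutelyContinuous _ _

theorem integral_weightedVol (hφ : Continuous φ) (f : M → ℝ) :
    ∫ x, f x ∂(weightedVol n φ) = ∫ x, φ x ^ 2 * f x ∂(vol n : Measure M) := by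
  have hm : Measurable fun x ↦ ENNReal.ofReal (φ x ^ 2) := (hφ.pow 2).measurable.ennreal_ofReal
  rw [weightedVol, integral_withDensity_eq_integral_toReal_smul hm
    (Eventually.of_forall fun x ↦ ENNReal.ofReal_lt_top)]
  simp only [ENNReal.toReal_ofReal (sq_nonneg _), smul_eq_mul]

theorem integral_weightedVol_prod (hφ : Continuous φ) (ρ : Measure ℝ) [SFinite ρ]
    (f : M × ℝ → ℝ) : ∫ p, f p ∂((weightedVol n φ).prod ρ) =
      ∫ p, φ p.1 ^ 2 * f p ∂((vol n : Measure M).prod ρ) := by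
  have := sigmaFinite_vol (n := n) (M := M)
  have := sigmaFinite_weightedVol (n := n) φ
  have hm : Measurable fun x ↦ ENNReal.ofReal (φ x ^ 2) := (hφ.pow 2).measurable.ennreal_ofReal
  have hm' : Measurable fun p : M × ℝ ↦ ENNReal.ofReal (φ p.1 ^ 2) := hm.comp measurable_fst
  rw [weightedVol, prod_withDensity_left hm,
    integral_withDensity_eq_integral_toReal_smul hm'
      (Eventually.of_forall fun x ↦ ENNReal.ofReal_lt_top)]
  simp only [ENNReal.toReal_ofReal (sq_nonneg _), smul_eq_mul]

/-- The density φ² is bounded on compact sets, so local integrability with respect to ν passes to μ.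
-/
theorem exists_weightedVol_restrict_le (hφ : Continuous φ) {K : Set M} (hK : IsCompact K) :
    ∃ c : ENNReal, c ≠ ⊤ ∧ (weightedVol n φ).restrict K ≤ c • (vol n : Measure M).restrict K := by
  obtain ⟨B, -, hB⟩ := exists_forall_abs_le hK (hφ.pow 2).continuousOn
  refine ⟨ENNReal.ofReal B, ENNReal.ofReal_ne_top, ?_⟩
  rw [weightedVol, restrict_withDensity hK.measurableSet, ← withDensity_const]
  refine withDensity_mono ?_
  filter_upwards [ae_restrict_mem hK.measurableSet] with x hx
  exact ENNReal.ofReal_le_ofReal ((le_abs_self _).trans (hB x hx))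

theorem IsH1Loc.memL2Loc_norm_weightedVol (hΦ : IsH1Loc n (vol n) φ Φ) (hφ : Continuous φ) :
    MemL2Loc (weightedVol n φ) fun x ↦ ‖Φ x‖ := fun K hK ↦ by
  obtain ⟨c, hc, hle⟩ := exists_weightedVol_restrict_le (n := n) hφ hK
  exact (hΦ.memL2Loc_grad K hK).of_measure_le_smul hc hle

variable (n) in
/-- The weak gradient `∇f / φ - (f / φ²) Φ` of the quotient `f / φ` of a function of class `C¹` by a
function with weak gradient `Φ`. -/
def quotGrad (f φ : M → ℝ) (Φ : ∀ x : M, TangentSpace (𝓡 n) x) (x : M) : TangentSpace (𝓡 n) x :=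
  (1 / φ x) • grad n f x - (f x / φ x ^ 2) • Φ x

theorem inner_quotGrad (x : M) (v : TangentSpace (𝓡 n) x) :
    inner ℝ (quotGrad n f φ Φ x) v =
      1 / φ x * inner ℝ (grad n f x) v - f x / φ x ^ 2 * inner ℝ (Φ x) v := by
  rw [quotGrad, inner_sub_left, real_inner_smul_left, real_inner_smul_left]

/-- This form provides measurability of the norm: it uses only scalar functions, namely the two
norms and the pairing of `Φ` with ∇f. -/
theorem norm_quotGrad (x : M) : ‖quotGrad n f φ Φ x‖ =
    √((1 / φ x * ‖grad n f x‖) ^ 2 - 2 * (1 / φ x * (f x / φ x ^ 2 * inner ℝ (Φ x) (grad n f x))) +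
      (f x / φ x ^ 2 * ‖Φ x‖) ^ 2) := by
  have h := norm_sub_sq_real ((1 / φ x) • grad n f x) ((f x / φ x ^ 2) • Φ x)
  rw [norm_smul, norm_smul, real_inner_smul_left, real_inner_smul_right, mul_pow, mul_pow,
    Real.norm_eq_abs, Real.norm_eq_abs, sq_abs, sq_abs, real_inner_comm] at h
  rw [quotGrad, mul_pow, mul_pow, ← h, Real.sqrt_sq (norm_nonneg _)]

theorem norm_quotGrad_le (x : M) :
    ‖quotGrad n f φ Φ x‖ ≤ |1 / φ x * ‖grad n f x‖| + |f x / φ x ^ 2| * ‖Φ x‖ := by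
  refine (norm_sub_le _ _).trans (le_of_eq ?_)
  rw [norm_smul, norm_smul, Real.norm_eq_abs, Real.norm_eq_abs, abs_mul, abs_norm]

/-- The quotient rule for weak gradients. -/
theorem IsH1Loc.integral_inner_quotGrad (hΦ : IsH1Loc n (vol n) φ Φ) (hφ : Continuous φ)
    (hpos : ∀ x, 0 < φ x) (hf : ContMDiff (𝓡 n) 𝓘(ℝ, ℝ) 1 f) (hX : IsTestField n X) :
    ∫ x, inner ℝ (quotGrad n f φ Φ x) (X x) ∂(vol n : Measure M) =
      -∫ x, f x / φ x * divergence n X x ∂(vol n : Measure M) := by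
  have := isLocallyFiniteMeasure_vol (n := n) (M := M)
  have hone : Continuous fun x ↦ 1 / φ x := continuous_const.div hφ fun x ↦ (hpos x).ne'
  have hone2 : Continuous fun x ↦ 1 / φ x ^ 2 :=
    continuous_const.div (hφ.pow 2) fun x ↦ (pow_pos (hpos x) 2).ne'
  -- Testing the weak gradient of 1/φ with fX reduces the quotient rule to the product rule for
  -- div(fX).
  have h1 := hΦ.integral_inv hφ hpos (hX.smul hf)
  have hX0 : ∀ x ∉ closure {x | X x ≠ 0}, X x = 0 := fun x hx ↦
    by_contra fun h ↦ hx (subset_closure h)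
  have hi1 : Integrable (fun x ↦ 1 / φ x * inner ℝ (grad n f x) (X x)) (vol n : Measure M) :=
    (hone.mul (continuous_inner_grad hX.1 hf)).integrable_of_hasCompactSupport
      (HasCompactSupport.intro hX.2 fun x hx ↦
        mul_eq_zero_of_right _ ((congrArg _ (hX0 x hx)).trans (inner_zero_right _)))
  have hi2 : Integrable (fun x ↦ f x / φ x * divergence n X x) (vol n : Measure M) :=
    ((hf.continuous.div hφ fun x ↦ (hpos x).ne').mul
      (continuous_divergence hX.1)).integrable_of_hasCompactSupport
      (HasCompactSupport.intro hX.2 fun x hx ↦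
        mul_eq_zero_of_right _ (divergence_eq_zero_of_notMem hx))
  have hi3 := hΦ.integrable_inner_mul (hX.smul hf) hone2
  have h2 : ∫ x, 1 / φ x * divergence n (fun x ↦ f x • X x) x ∂(vol n : Measure M) =
      ∫ x, f x / φ x * divergence n X x ∂(vol n : Measure M) +
        ∫ x, 1 / φ x * inner ℝ (grad n f x) (X x) ∂(vol n : Measure M) := by
    rw [← integral_add hi2 hi1]
    refine integral_congr_ae (Eventually.of_forall fun x ↦ ?_)
    simp only
    rw [divergence_smul hX.1 hf]
    ring
  have h3 : ∫ x, inner ℝ (quotGrad n f φ Φ x) (X x) ∂(vol n : Measure M) =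
      ∫ x, 1 / φ x * inner ℝ (grad n f x) (X x) ∂(vol n : Measure M) -
        ∫ x, inner ℝ (Φ x) (f x • X x) * (1 / φ x ^ 2) ∂(vol n : Measure M) := by
    rw [← integral_sub hi1 hi3]
    refine integral_congr_ae (Eventually.of_forall fun x ↦ ?_)
    simp only
    rw [inner_quotGrad, real_inner_smul_right]
    ring
  rw [h3, h1, h2]
  ring

/-- The quotient rule in `H¹_loc`. -/
theorem IsH1Loc.isH1Loc_quotGrad (hΦ : IsH1Loc n (vol n) φ Φ) (hφ : Continuous φ)
    (hpos : ∀ x, 0 < φ x) (hf : ContMDiff (𝓡 n) 𝓘(ℝ, ℝ) 2 f) :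
    IsH1Loc n (weightedVol n φ) (fun x ↦ f x / φ x) (quotGrad n f φ Φ) := by
  have := ChartedSpace.secondCountable_of_sigmaCompact (E n) M
  have := isLocallyFiniteMeasure_weightedVol (n := n) hφ
  have hf1 : ContMDiff (𝓡 n) 𝓘(ℝ, ℝ) 1 f := hf.of_le one_le_two
  have hone : Continuous fun x ↦ 1 / φ x := continuous_const.div hφ fun x ↦ (hpos x).ne'
  have hf2 : Continuous fun x ↦ f x / φ x ^ 2 :=
    hf.continuous.div (hφ.pow 2) fun x ↦ (pow_pos (hpos x) 2).ne'
  have hinner : ∀ X : (∀ x : M, TangentSpace (𝓡 n) x), IsTestField n X →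
      AEStronglyMeasurable (fun x ↦ inner ℝ (Φ x) (X x)) (weightedVol n φ) := fun X hX ↦
    (hΦ.aestronglyMeasurable X hX).mono_ac (weightedVol_absolutelyContinuous φ)
  have hg := continuous_norm_field (contMDiff_grad hf)
  refine ⟨memL2Loc_of_continuous (hf.continuous.div hφ fun x ↦ (hpos x).ne'),
    fun X hX ↦ ?_, fun K hK ↦ ?_, fun X hX ↦ hΦ.integral_inner_quotGrad hφ hpos hf1 hX⟩
  · simp only [inner_quotGrad]
    exact (hone.mul (continuous_inner_grad hX.1 hf1)).aestronglyMeasurable.sub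
      (hf2.aestronglyMeasurable.mul (hinner X hX))
  · have hN := hΦ.memL2Loc_norm_weightedVol hφ K hK
    have : IsFiniteMeasure ((weightedVol n φ).restrict K) :=
      isFiniteMeasure_restrict.2 hK.measure_lt_top.ne
    -- ∇f itself need not have compact support; χ∇f is a test field and agrees with it on `K`.
    obtain ⟨χ, hχ, hχc, -, hχ1, -⟩ := exists_cutoff n hK isOpen_univ (subset_univ K)
    have hpair : AEStronglyMeasurable (fun x ↦ inner ℝ (Φ x) (grad n f x))
        ((weightedVol n φ).restrict K) := by
      refine (hinner _ (IsC1Field.smul_of_hasCompactSupport (contMDiff_grad hf)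
        (hχ.of_le one_le_smooth) hχc)).restrict.congr ?_
      filter_upwards [ae_restrict_mem hK.measurableSet] with x hx
      rw [hχ1 x hx, one_smul]
    obtain ⟨B₁, -, hB₁⟩ := exists_forall_abs_le hK (hone.mul hg).continuousOn
    obtain ⟨B₂, -, hB₂⟩ := exists_forall_abs_le hK hf2.continuousOn
    refine MemLp.mono' ((memLp_const B₁).add (hN.const_mul B₂)) ?_ ?_
    · simp only [norm_quotGrad]
      exact Real.continuous_sqrt.comp_aestronglyMeasurable
        ((((hone.mul hg).aestronglyMeasurable.pow 2).sub ((hone.aestronglyMeasurable.mul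
          (hf2.aestronglyMeasurable.mul hpair)).const_mul 2)).add
          ((hf2.aestronglyMeasurable.mul hN.1).pow 2))
    · filter_upwards [ae_restrict_mem hK.measurableSet] with x hx
      rw [norm_norm]
      exact (norm_quotGrad_le x).trans (add_le_add (hB₁ x hx)
        (mul_le_mul_of_nonneg_right (hB₂ x hx) (norm_nonneg _)))

/-- The quotient rule in `L²_loc((0, T); H¹_loc)`. -/
theorem IsH1Loc.isL2LocH1Loc_quotGrad (hΦ : IsH1Loc n (vol n) φ Φ) (hφ : Continuous φ)
    (hpos : ∀ x, 0 < φ x) (hu : IsC21 n T u) :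
    IsL2LocH1Loc n (weightedVol n φ) T (fun x t ↦ u x t / φ x)
      (fun x t ↦ quotGrad n (fun y ↦ u y t) φ Φ x) := by
  have := ChartedSpace.secondCountable_of_sigmaCompact (E n) M
  have := isLocallyFiniteMeasure_weightedVol (n := n) hφ
  have := sigmaFinite_weightedVol (n := n) φ
  have hj := hu.isJointC1
  have hφ1 : Continuous fun p : M × ℝ ↦ φ p.1 := hφ.comp continuous_fst
  have hone : Continuous fun p : M × ℝ ↦ 1 / φ p.1 :=
    continuous_const.div hφ1 fun p ↦ (hpos p.1).ne'
  have hu1 : ContinuousOn (fun p : M × ℝ ↦ u p.1 p.2 / φ p.1) (univ ×ˢ Ioo 0 T) :=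
    hj.continuousOn.div hφ1.continuousOn fun p _ ↦ (hpos p.1).ne'
  have hu2 : ContinuousOn (fun p : M × ℝ ↦ u p.1 p.2 / φ p.1 ^ 2) (univ ×ˢ Ioo 0 T) :=
    hj.continuousOn.div (hφ1.pow 2).continuousOn fun p _ ↦ (pow_pos (hpos p.1) 2).ne'
  have hug : ContinuousOn (fun p : M × ℝ ↦ 1 / φ p.1 * ‖grad n (fun y ↦ u y p.2) p.1‖)
      (univ ×ˢ Ioo 0 T) := hone.continuousOn.mul hj.continuousOn_norm_grad
  have hinner : ∀ X : (∀ x : M, TangentSpace (𝓡 n) x), IsTestField n X →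
      AEStronglyMeasurable (fun x ↦ inner ℝ (Φ x) (X x)) (weightedVol n φ) := fun X hX ↦
    (hΦ.aestronglyMeasurable X hX).mono_ac (weightedVol_absolutelyContinuous φ)
  have hm : ∀ {g : M × ℝ → ℝ}, ContinuousOn g (univ ×ˢ Ioo 0 T) →
      AEStronglyMeasurable g ((weightedVol n φ).prod (volume.restrict (Ioo 0 T))) := fun hg ↦
    aestronglyMeasurable_prod_of_continuousOn measurableSet_Ioo hg
  have hle : ∀ (K : Set M) {a b : ℝ}, 0 < a → b < T →
      ((weightedVol n φ).restrict K).prod (volume.restrict (Icc a b)) ≤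
        (weightedVol n φ).prod (volume.restrict (Ioo 0 T)) := fun K a b ha hb ↦
    Measure.prod_mono Measure.restrict_le_self
      (Measure.restrict_mono (Icc_subset_Ioo ha hb) le_rfl)
  have hsub : ∀ (K : Set M) {a b : ℝ}, 0 < a → b < T → K ×ˢ Icc a b ⊆ univ ×ˢ Ioo 0 T :=
    fun K a b ha hb ↦ prod_mono (subset_univ K) (Icc_subset_Ioo ha hb)
  have hfin : ∀ K : Set M, IsCompact K → IsFiniteMeasure ((weightedVol n φ).restrict K) :=
    fun K hK ↦ isFiniteMeasure_restrict.2 hK.measure_lt_top.ne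
  have hmem : ∀ (K : Set M) (a b : ℝ), IsCompact K →
      ∀ᵐ p ∂(((weightedVol n φ).restrict K).prod (volume.restrict (Icc a b))),
        p ∈ K ×ˢ Icc a b := fun K a b hK ↦ by
    rw [Measure.prod_restrict]
    exact ae_restrict_mem (hK.measurableSet.prod measurableSet_Icc)
  refine ⟨?_, fun K hK a b ha hb ↦ ?_, fun X hX ↦ ?_, fun K hK a b ha hb ↦ ?_⟩
  · filter_upwards [ae_restrict_mem measurableSet_Ioo] with t ht
    exact hΦ.isH1Loc_quotGrad hφ hpos (hu.contMDiff t ht)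
  · have := hfin K hK
    obtain ⟨B, hB⟩ := (hK.prod (isCompact_Icc (a := a) (b := b))).exists_bound_of_continuousOn
      (hu1.mono (hsub K ha hb))
    refine MemLp.of_bound ((hm hu1).mono_measure (hle K ha hb)) B ?_
    filter_upwards [hmem K a b hK] with p hp using hB p hp
  · simp only [inner_quotGrad]
    exact (hm (hone.continuousOn.mul (hj.continuousOn_inner_grad hX.1))).sub
      ((hm hu2).mul (hinner X hX).comp_fst)
  · have := hfin K hK
    have hN : MemLp (fun p : M × ℝ ↦ ‖Φ p.1‖) 2
        (((weightedVol n φ).restrict K).prod (volume.restrict (Icc a b))) :=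
      (hΦ.memL2Loc_norm_weightedVol hφ K hK).comp_fst _
    have hpair := (hj.aestronglyMeasurable_inner_grad hinner).mono_measure (hle K ha hb)
    have hK' := hK.prod (isCompact_Icc (a := a) (b := b))
    obtain ⟨B₁, hB₁⟩ := hK'.exists_bound_of_continuousOn (hug.mono (hsub K ha hb))
    obtain ⟨B₂, hB₂⟩ := hK'.exists_bound_of_continuousOn (hu2.mono (hsub K ha hb))
    have hm' : ∀ {g : M × ℝ → ℝ}, ContinuousOn g (univ ×ˢ Ioo 0 T) → AEStronglyMeasurable g
        (((weightedVol n φ).restrict K).prod (volume.restrict (Icc a b))) := fun hg ↦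
      (hm hg).mono_measure (hle K ha hb)
    refine MemLp.mono' ((memLp_const B₁).add (hN.const_mul B₂)) ?_ ?_
    · simp only [norm_quotGrad]
      exact Real.continuous_sqrt.comp_aestronglyMeasurable
        ((((hm' hug).pow 2).sub ((hone.aestronglyMeasurable.mul
          ((hm' hu2).mul hpair)).const_mul 2)).add (((hm' hu2).mul hN.1).pow 2))
    · filter_upwards [hmem K a b hK] with p hp
      rw [norm_norm]
      exact (norm_quotGrad_le p.1).trans (add_le_add (hB₁ p hp)
        (mul_le_mul_of_nonneg_right (hB₂ p hp) (norm_nonneg _)))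

end Weighted

/-! ### Integration by parts in time and integral bounds. -/

section TimeDerivative

variable {X : Type*} [TopologicalSpace X] {ψ : X × ℝ → ℝ} {u : X → ℝ → ℝ} {T : ℝ}

theorem deriv_time_eq_zero_of_notMem_tsupport {p : X × ℝ} (hp : p ∉ tsupport ψ) :
    deriv (fun s ↦ ψ (p.1, s)) p.2 = 0 := by
  have h := notMem_tsupport_iff_eventuallyEq.1 hp
  have h1 : (fun s ↦ ψ (p.1, s)) =ᶠ[𝓝 p.2] fun _ ↦ 0 :=
    (Continuous.tendsto (by fun_prop : Continuous fun s : ℝ ↦ (p.1, s)) p.2).eventually h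
  rw [h1.deriv_eq, deriv_const]

variable [T2Space X]

/-- A function continuous on `X × (0, T)` that vanishes off a compact subset of it. -/
theorem continuous_and_hasCompactSupport {F : X × ℝ → ℝ}
    (hc : HasCompactSupport ψ) (hs : tsupport ψ ⊆ univ ×ˢ Ioo 0 T)
    (hF : ContinuousOn F (univ ×ˢ Ioo 0 T)) (h0 : ∀ p ∉ tsupport ψ, F p = 0) :
    Continuous F ∧ HasCompactSupport F :=
  ⟨continuous_of_continuousOn_of_eq_zero (isOpen_univ.prod isOpen_Ioo) (isClosed_tsupport ψ) hs
    hF h0, HasCompactSupport.intro hc h0⟩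

variable [MeasurableSpace X] [BorelSpace X] [SecondCountableTopology X]
    {m : Measure X} [IsFiniteMeasureOnCompacts m] [SFinite m] {φ : X → ℝ}

theorem integrable_mul_of_tsupport (hφ : Continuous φ) {v w : X × ℝ → ℝ}
    (hc : HasCompactSupport ψ) (hs : tsupport ψ ⊆ univ ×ˢ Ioo 0 T)
    (hv : ContinuousOn v (univ ×ˢ Ioo 0 T)) (hw : Continuous w) (h0 : ∀ p ∉ tsupport ψ, w p = 0) :
    Integrable (fun p : X × ℝ ↦ φ p.1 * (v p * w p)) (m.prod volume) := by
  have h := continuous_and_hasCompactSupport hc hs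
    ((hφ.comp continuous_fst).continuousOn.mul (hv.mul hw.continuousOn))
    fun p hp ↦ mul_eq_zero_of_right _ (mul_eq_zero_of_right _ (h0 p hp))
  exact h.1.integrable_of_hasCompactSupport h.2

/-- Integration by parts in time. -/
theorem integral_deriv_time_mul_add (hφ : Continuous φ)
    (hψ : Continuous ψ) (hψd : ∀ x t, DifferentiableAt ℝ (fun s ↦ ψ (x, s)) t)
    (hψ' : Continuous fun p : X × ℝ ↦ deriv (fun s ↦ ψ (p.1, s)) p.2)
    (hc : HasCompactSupport ψ) (hs : tsupport ψ ⊆ univ ×ˢ Ioo 0 T)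
    (hu : ContinuousOn (fun p : X × ℝ ↦ u p.1 p.2) (univ ×ˢ Ioo 0 T))
    (hud : ∀ x, ∀ t ∈ Ioo 0 T, DifferentiableAt ℝ (u x) t)
    (hu' : ContinuousOn (fun p : X × ℝ ↦ deriv (u p.1) p.2) (univ ×ˢ Ioo 0 T)) :
    ∫ p : X × ℝ, φ p.1 * (deriv (u p.1) p.2 * ψ p) ∂(m.prod volume) +
      ∫ p : X × ℝ, φ p.1 * (u p.1 p.2 * deriv (fun s ↦ ψ (p.1, s)) p.2) ∂(m.prod volume) = 0 := by
  have hψ0 : ∀ p ∉ tsupport ψ, ψ p = 0 := fun p hp ↦ image_eq_zero_of_notMem_tsupport hp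
  have hψ'0 : ∀ p ∉ tsupport ψ, deriv (fun s ↦ ψ (p.1, s)) p.2 = 0 := fun p hp ↦
    deriv_time_eq_zero_of_notMem_tsupport hp
  have hi1 := integrable_mul_of_tsupport (m := m) hφ hc hs hu' hψ hψ0
  have hi2 := integrable_mul_of_tsupport (m := m) hφ hc hs hu hψ' hψ'0
  have hF := continuous_and_hasCompactSupport hc hs (F := fun p : X × ℝ ↦
    deriv (u p.1) p.2 * ψ p + u p.1 p.2 * deriv (fun s ↦ ψ (p.1, s)) p.2)
    ((hu'.mul hψ.continuousOn).add (hu.mul hψ'.continuousOn))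
    fun p hp ↦ by rw [hψ0 p hp, hψ'0 p hp, mul_zero, mul_zero, add_zero]
  have hG := continuous_and_hasCompactSupport hc hs (hu.mul hψ.continuousOn)
    fun p hp ↦ mul_eq_zero_of_right _ (hψ0 p hp)
  have hslice : ∀ {F : X × ℝ → ℝ}, Continuous F ∧ HasCompactSupport F → ∀ x,
      Integrable fun t ↦ F (x, t) := fun {F} h x ↦ by
    refine (h.1.comp (by fun_prop : Continuous fun t : ℝ ↦ (x, t))).integrable_of_hasCompactSupport
      (HasCompactSupport.intro (h.2.isCompact.image continuous_snd) fun t ht ↦ ?_)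
    exact image_eq_zero_of_notMem_tsupport (f := F) fun h ↦ ht ⟨(x, t), h, rfl⟩
  have hi3 : Integrable (fun p : X × ℝ ↦ φ p.1 * (deriv (u p.1) p.2 * ψ p) +
      φ p.1 * (u p.1 p.2 * deriv (fun s ↦ ψ (p.1, s)) p.2)) (m.prod volume) := hi1.add hi2
  rw [← integral_add hi1 hi2, integral_prod _ hi3]
  refine integral_eq_zero_of_ae (Eventually.of_forall fun x ↦ ?_)
  simp only [← mul_add]
  rw [integral_const_mul]
  -- For fixed x the inner integrand is the t-derivative of uψ on the whole line: uψ vanishes near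
  -- every time outside (0,T), where nothing is known about u.
  refine mul_eq_zero_of_right _ (integral_eq_zero_of_hasDerivAt_of_integrable
    (f := fun t ↦ u x t * ψ (x, t)) (fun t ↦ ?_) (hslice hF x) (hslice hG x))
  by_cases ht : t ∈ Ioo 0 T
  · exact (hud x t ht).hasDerivAt.mul (hψd x t).hasDerivAt
  · have hxt : (x, t) ∉ tsupport ψ := fun h ↦ ht (hs h).2
    have h1 : (fun t ↦ u x t * ψ (x, t)) =ᶠ[𝓝 t] fun _ ↦ 0 := by
      have := (Continuous.tendsto (by fun_prop : Continuous fun s : ℝ ↦ (x, s)) t).eventually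
        (notMem_tsupport_iff_eventuallyEq.1 hxt)
      filter_upwards [this] with s hs
      exact mul_eq_zero_of_right _ hs
    rw [hψ0 _ hxt, hψ'0 _ hxt, mul_zero, mul_zero, add_zero]
    exact (hasDerivAt_const t (0 : ℝ)).congr_of_eventuallyEq h1

theorem integral_prod_eq_setIntegral {F : X × ℝ → ℝ} (hF : Integrable F (m.prod volume))
    (h0 : ∀ x, ∀ t ∉ Ioo 0 T, F (x, t) = 0) :
    ∫ p, F p ∂(m.prod volume) = ∫ t in Ioo 0 T, ∫ x, F (x, t) ∂m := by
  rw [integral_prod_symm _ hF]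
  refine (setIntegral_eq_integral_of_forall_compl_eq_zero fun t ht ↦ ?_).symm
  simp only [h0 _ t ht, integral_zero]

/-- The inequality at fixed time contains `D`, the term with ∂ₜu; after integration over time,
integration by parts replaces ∫D by −∫G, the term with ∂ₜψ. -/
theorem integral_sub_le_zero_of_slice {A C D G : X × ℝ → ℝ}
    (hA : Integrable A (m.prod (volume.restrict (Ioo 0 T))))
    (hC : Integrable C (m.prod (volume.restrict (Ioo 0 T))))
    (hD : Integrable D (m.prod (volume.restrict (Ioo 0 T))))
    (hG : Integrable G (m.prod (volume.restrict (Ioo 0 T))))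
    (hDG : ∫ p, D p ∂(m.prod (volume.restrict (Ioo 0 T))) +
      ∫ p, G p ∂(m.prod (volume.restrict (Ioo 0 T))) = 0)
    (hslice : ∀ t ∈ Ioo 0 T, ∫ x, (A (x, t) - C (x, t) + D (x, t)) ∂m ≤ 0) :
    ∫ p, (A p - C p - G p) ∂(m.prod (volume.restrict (Ioo 0 T))) ≤ 0 := by
  have hAC : Integrable (fun p ↦ A p - C p) (m.prod (volume.restrict (Ioo 0 T))) := hA.sub hC
  have hACD : Integrable (fun p ↦ A p - C p + D p) (m.prod (volume.restrict (Ioo 0 T))) :=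
    hAC.add hD
  have h : ∫ p, (A p - C p + D p) ∂(m.prod (volume.restrict (Ioo 0 T))) ≤ 0 := by
    rw [integral_prod_symm _ hACD]
    exact setIntegral_nonpos measurableSet_Ioo hslice
  rw [integral_add hAC hD] at h
  rw [integral_sub hAC hG]
  linarith

/-- The Cauchy–Schwarz inequality on a compact set. -/
theorem abs_integral_mul_le {g a : X → ℝ} {K : Set X} {B : ℝ} (hK : IsCompact K)
    (hg : ∀ x ∈ K, |g x| ≤ B) (ha : Continuous a) (haK : ∀ x ∉ K, a x = 0) (hB : 0 ≤ B) :
    |∫ x, g x * a x ∂m| ≤ B * √(m.real K) * √(∫ x, a x ^ 2 ∂m) := by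
  have hfin : IsFiniteMeasure (m.restrict K) := isFiniteMeasure_restrict.2 hK.measure_lt_top.ne
  obtain ⟨D, hD⟩ := hK.exists_bound_of_continuousOn ha.continuousOn
  have hmem : MemLp a (ENNReal.ofReal 2) (m.restrict K) :=
    MemLp.of_bound ha.aestronglyMeasurable D
      ((ae_restrict_mem hK.measurableSet).mono fun x hx ↦ hD x hx)
  -- Hölder's inequality against the constant 1, whose L² norm on `K` is √m(K).
  have hholder := integral_mul_norm_le_Lp_mul_Lq (μ := m.restrict K) (p := 2) (q := 2)
    (Real.HolderConjugate.two_two) (memLp_const (1 : ℝ)) hmem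
  have h1 : ∫ x in K, a x ^ 2 ∂m = ∫ x, a x ^ 2 ∂m :=
    setIntegral_eq_integral_of_forall_compl_eq_zero fun x hx ↦ by rw [haK x hx]; simp
  have h2 : ∫ x in K, g x * a x ∂m = ∫ x, g x * a x ∂m :=
    setIntegral_eq_integral_of_forall_compl_eq_zero fun x hx ↦ by rw [haK x hx, mul_zero]
  simp only [Real.rpow_ofNat, norm_one, one_pow, one_mul, Real.norm_eq_abs, sq_abs, integral_const,
    smul_eq_mul, mul_one, measureReal_restrict_apply_univ, ← Real.sqrt_eq_rpow, h1] at hholder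
  rw [← h2, mul_assoc]
  have hint : Integrable (fun x ↦ B * |a x|) (m.restrict K) :=
    ((ha.abs.continuousOn (s := K)).integrableOn_compact hK).const_mul B
  calc |∫ x in K, g x * a x ∂m| ≤ ∫ x in K, B * |a x| ∂m := by
        refine norm_integral_le_of_norm_le (f := fun x ↦ g x * a x) hint
          ((ae_restrict_mem hK.measurableSet).mono fun x hx ↦ ?_)
        rw [Real.norm_eq_abs, abs_mul]
        exact mul_le_mul_of_nonneg_right (hg x hx) (abs_nonneg _)
    _ = B * ∫ x in K, |a x| ∂m := integral_const_mul _ _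
    _ ≤ _ := mul_le_mul_of_nonneg_left hholder hB

end TimeDerivative

/-! ### The time derivative of w and the weak inequality. -/

section Main

variable {n : ℕ} {M : Type*} [TopologicalSpace M] [T2Space M] [LocallyCompactSpace M]
  [SigmaCompactSpace M] [ChartedSpace (E n) M]
  [IsManifold (𝓡 n) ∞ M] [RiemannianBundle (fun x : M ↦ TangentSpace (𝓡 n) x)]
  [IsContMDiffRiemannianBundle (𝓡 n) ∞ (E n) (fun x : M ↦ TangentSpace (𝓡 n) x)]
  [MeasurableSpace M] [BorelSpace M]
  {φ V f g ρ : M → ℝ} {Φ : ∀ x : M, TangentSpace (𝓡 n) x} {T : ℝ} {u : M → ℝ → ℝ}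

theorem sqrt_integral_mul_sq_le_h1Norm (hφ : Continuous φ) {η : M → ℝ}
    (hη : ContMDiff (𝓡 n) 𝓘(ℝ, ℝ) ∞ η) (hc : HasCompactSupport η) :
    √(∫ x, (φ x * η x) ^ 2 ∂(vol n : Measure M)) ≤ h1Norm n (weightedVol n φ) η := by
  have := isLocallyFiniteMeasure_weightedVol (n := n) hφ
  have hη2 := hη.of_le two_le_smooth
  have h1 : ∫ x, (φ x * η x) ^ 2 ∂(vol n : Measure M) = ∫ x, η x ^ 2 ∂(weightedVol n φ) := by
    rw [integral_weightedVol hφ fun x ↦ η x ^ 2]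
    simp only [mul_pow]
  have hi1 : Integrable (fun x ↦ η x ^ 2) (weightedVol n φ) :=
    (hη.continuous.pow 2).integrable_of_hasCompactSupport
      (HasCompactSupport.intro hc.isCompact fun x hx ↦ by
        simp [image_eq_zero_of_notMem_tsupport hx])
  have hi2 : Integrable (fun x ↦ ‖grad n η x‖ ^ 2) (weightedVol n φ) :=
    ((continuous_norm_field (contMDiff_grad hη2)).pow 2).integrable_of_hasCompactSupport
      (HasCompactSupport.intro hc.isCompact fun x hx ↦ by
        simp [grad_eq_zero_of_notMem_tsupport hx])
  have hi3 : Integrable (fun x ↦ η x ^ 2 + ‖grad n η x‖ ^ 2) (weightedVol n φ) := hi1.add hi2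
  have h2 : ∫ x, η x ^ 2 ∂(weightedVol n φ) ≤
      ∫ x, (η x ^ 2 + ‖grad n η x‖ ^ 2) ∂(weightedVol n φ) :=
    integral_mono hi1 hi3 fun x ↦ le_add_of_nonneg_right (sq_nonneg _)
  rw [h1]
  exact Real.sqrt_le_sqrt h2

/-- The time derivative of the quotient `u / φ`. -/
theorem IsC21.timeDerivL1LocHNegOneLoc (hu : IsC21 n T u) (hφ : Continuous φ)
    (hpos : ∀ x, 0 < φ x) :
    TimeDerivL1LocHNegOneLoc n (weightedVol n φ) T fun x t ↦ u x t / φ x := by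
  have := ChartedSpace.secondCountable_of_sigmaCompact (E n) M
  have := isLocallyFiniteMeasure_vol (n := n) (M := M)
  have := sigmaFinite_vol (n := n) (M := M)
  have hslice : ∀ t ∈ Ioo 0 T, Continuous fun x ↦ deriv (u x) t := fun t ht ↦ by
    rw [← continuousOn_univ]
    exact hu.continuousOn_deriv.comp (by fun_prop : Continuous fun x : M ↦ (x, t)).continuousOn
      fun x _ ↦ ⟨mem_univ x, ht⟩
  have hint : ∀ t ∈ Ioo 0 T, ∀ η : testFunctions n M,
      Integrable (fun x ↦ deriv (u x) t * (φ x * (η : M → ℝ) x)) (vol n) := fun t ht η ↦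
    ((hslice t ht).mul (hφ.mul η.2.1.continuous)).integrable_of_hasCompactSupport
      (HasCompactSupport.mul_left (HasCompactSupport.mul_left η.2.2))
  classical
  -- ζ(t)η = ∫ ∂ₜw η dμ, where one factor φ cancels. Outside (0,T) it is set to 0, since additivity
  -- of the integral needs integrability, known only for t in (0,T).
  let ζ : ℝ → (testFunctions n M →ₗ[ℝ] ℝ) := fun t ↦ if ht : t ∈ Ioo 0 T then
    { toFun := fun η ↦ ∫ x, deriv (u x) t * (φ x * (η : M → ℝ) x) ∂(vol n)
      map_add' := fun η θ ↦ by
        rw [← integral_add (hint t ht η) (hint t ht θ)]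
        refine integral_congr_ae (Eventually.of_forall fun x ↦ ?_)
        simp only [Submodule.coe_add, Pi.add_apply]
        ring
      map_smul' := fun c η ↦ by
        rw [RingHom.id_apply, smul_eq_mul, ← integral_const_mul]
        refine integral_congr_ae (Eventually.of_forall fun x ↦ ?_)
        simp only [Submodule.coe_smul, Pi.smul_apply, smul_eq_mul]
        ring } else 0
  have hζ : ∀ t ∈ Ioo 0 T, ∀ η : testFunctions n M,
      ζ t η = ∫ x, deriv (u x) t * (φ x * (η : M → ℝ) x) ∂(vol n) := fun t ht η ↦ by
    simp only [ζ, dif_pos ht]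
    rfl
  refine ⟨ζ, fun η ↦ ?_, fun K hK a b ha hb ↦ ?_, fun η θ hθ hθc hθs ↦ ?_⟩
  · have h : ContinuousOn (fun t ↦ ∫ x, deriv (u x) t * (φ x * (η : M → ℝ) x) ∂(vol n))
        (Ioo 0 T) := by
      refine continuousOn_integral_of_compact_support (k := tsupport (η : M → ℝ)) η.2.2 ?_
        fun t x _ hx ↦ ?_
      · have h1 : ContinuousOn (fun p : ℝ × M ↦ deriv (u p.2) p.1) (Ioo 0 T ×ˢ univ) :=
          hu.continuousOn_deriv.comp continuous_swap.continuousOn fun p hp ↦ ⟨hp.2, hp.1⟩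
        exact h1.mul ((hφ.mul η.2.1.continuous).comp continuous_snd).continuousOn
      · rw [image_eq_zero_of_notMem_tsupport hx, mul_zero, mul_zero]
    refine (h.aestronglyMeasurable measurableSet_Ioo).congr ?_
    filter_upwards [ae_restrict_mem measurableSet_Ioo] with t ht using (hζ t ht η).symm
  · obtain ⟨B, hB⟩ := (hK.prod (isCompact_Icc (a := a) (b := b))).exists_bound_of_continuousOn
      (hu.continuousOn_deriv.mono (prod_mono (subset_univ K) (Icc_subset_Ioo ha hb)))
    -- ∂ₜu is bounded on K × [a,b], so a bound constant in time is available.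
    refine ⟨fun _ ↦ |B| * √((vol n : Measure M).real K), integrableOn_const (by simp), ?_⟩
    filter_upwards [ae_restrict_mem measurableSet_Icc] with t ht η hη
    rw [hζ t (Icc_subset_Ioo ha hb ht) η]
    refine (abs_integral_mul_le hK (B := |B|)
      (fun x hx ↦ (hB (x, t) ⟨hx, ht⟩).trans (le_abs_self B))
      (hφ.mul η.2.1.continuous) (fun x hx ↦ ?_) (abs_nonneg B)).trans
      (mul_le_mul_of_nonneg_left (sqrt_integral_mul_sq_le_h1Norm hφ η.2.1 η.2.2) (by positivity))
    exact mul_eq_zero_of_right _ (image_eq_zero_of_notMem_tsupport fun h ↦ hx (hη h))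
  -- Integration by parts in time for the product ηθ with weight φ; the weight is right because φ²w
  -- = φu.
  · set ψ : M × ℝ → ℝ := fun p ↦ (η : M → ℝ) p.1 * θ p.2
    have hθd : Differentiable ℝ θ := hθ.differentiable (by simp)
    have hθ' : Continuous (deriv θ) := hθ.continuous_deriv (by simp)
    have hder : ∀ p : M × ℝ, deriv (fun s ↦ ψ (p.1, s)) p.2 = (η : M → ℝ) p.1 * deriv θ p.2 :=
      fun p ↦ ((hθd p.2).hasDerivAt.const_mul ((η : M → ℝ) p.1)).deriv
    have hψ : Continuous ψ :=
      (η.2.1.continuous.comp continuous_fst).mul (hθ.continuous.comp continuous_snd)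
    have hψ' : Continuous fun p : M × ℝ ↦ deriv (fun s ↦ ψ (p.1, s)) p.2 := by
      simp only [hder]
      exact (η.2.1.continuous.comp continuous_fst).mul (hθ'.comp continuous_snd)
    have hsub : tsupport ψ ⊆ tsupport (η : M → ℝ) ×ˢ tsupport θ :=
      closure_minimal (fun p hp ↦ ⟨subset_tsupport _ fun h ↦ hp (mul_eq_zero_of_left h _),
        subset_tsupport _ fun h ↦ hp (mul_eq_zero_of_right _ h)⟩)
        ((isClosed_tsupport _).prod (isClosed_tsupport _))
    have hc : HasCompactSupport ψ :=
      (η.2.2.isCompact.prod hθc.isCompact).of_isClosed_subset (isClosed_tsupport _) hsub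
    have hs : tsupport ψ ⊆ univ ×ˢ Ioo 0 T := hsub.trans (prod_mono (subset_univ _) hθs)
    have hψ0 : ∀ p ∉ tsupport ψ, ψ p = 0 := fun p hp ↦ image_eq_zero_of_notMem_tsupport hp
    have hψ'0 : ∀ p ∉ tsupport ψ, deriv (fun s ↦ ψ (p.1, s)) p.2 = 0 := fun p hp ↦
      deriv_time_eq_zero_of_notMem_tsupport hp
    have huc := hu.isJointC1.continuousOn
    have key := integral_deriv_time_mul_add (m := (vol n : Measure M)) hφ hψ
      (fun x t ↦ (hθd t).const_mul ((η : M → ℝ) x)) hψ' hc hs huc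
      hu.differentiableAt hu.continuousOn_deriv
    rw [integral_prod_eq_setIntegral (T := T)
        (integrable_mul_of_tsupport hφ hc hs hu.continuousOn_deriv hψ hψ0) fun x t ht ↦ by
          rw [hψ0 (x, t) fun h ↦ ht (hs h).2, mul_zero, mul_zero],
      integral_prod_eq_setIntegral (T := T) (integrable_mul_of_tsupport hφ hc hs huc hψ' hψ'0)
        fun x t ht ↦ by rw [hψ'0 (x, t) fun h ↦ ht (hs h).2, mul_zero, mul_zero]] at key
    refine eq_neg_iff_add_eq_zero.2 (Eq.trans ?_ key)
    congr 1
    · refine setIntegral_congr_fun measurableSet_Ioo fun t ht ↦ ?_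
      simp only [hζ t ht η]
      rw [← integral_const_mul]
      refine integral_congr_ae (Eventually.of_forall fun x ↦ ?_)
      simp only [ψ]
      ring
    · refine setIntegral_congr_fun measurableSet_Ioo fun t ht ↦ ?_
      simp only [integral_weightedVol hφ]
      rw [← integral_const_mul]
      refine integral_congr_ae (Eventually.of_forall fun x ↦ ?_)
      have := (hpos x).ne'
      have hx : deriv (fun s ↦ ψ (x, s)) t = (η : M → ℝ) x * deriv θ t := hder (x, t)
      simp only [hx]
      field_simp

theorem continuous_laplacian (hf : ContMDiff (𝓡 n) 𝓘(ℝ, ℝ) 2 f) : Continuous (laplacian n f) :=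
  continuous_divergence (contMDiff_grad hf)

/-- The supersolution inequality tested with `f ρ`, combined with the weak gradient tested with
`ρ ∇f`. -/
theorem integral_le_zero_of_subsolution (hΦ : IsH1Loc n (vol n) φ Φ) (hφ : Continuous φ)
    (hpos : ∀ x, 0 < φ x) (hV : Continuous V)
    (hsup : ∀ η ∈ testFunctions n M, (∀ x, 0 ≤ η x) →
      0 ≤ ∫ x, inner ℝ (Φ x) (grad n η x) ∂(vol n : Measure M) + ∫ x, V x * φ x * η x ∂(vol n))
    (hf : ContMDiff (𝓡 n) 𝓘(ℝ, ℝ) 2 f) (hf0 : ∀ x, 0 ≤ f x) (hg : Continuous g)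
    (hsub : ∀ x, g x - laplacian n f x + V x * f x ≤ 0)
    (hρ : ContMDiff (𝓡 n) 𝓘(ℝ, ℝ) 2 ρ) (hc : HasCompactSupport ρ) (hρ0 : ∀ x, 0 ≤ ρ x) :
    ∫ x, (φ x * inner ℝ (grad n f x) (grad n ρ x) - inner ℝ (Φ x) (grad n ρ x) * f x +
      φ x * (g x * ρ x)) ∂(vol n : Measure M) ≤ 0 := by
  have := isLocallyFiniteMeasure_vol (n := n) (M := M)
  -- The supersolution inequality tested with fρ; here f ≥ 0 matters.
  have h1 := supersolution_of_contMDiff_two hΦ hφ hV hsup (hf.mul hρ) hc.mul_left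
    fun x ↦ mul_nonneg (hf0 x) (hρ0 x)
  have hρ1 := hρ.of_le one_le_two
  have hgf : IsC1Field n (grad n f) := contMDiff_grad hf
  have hY : IsTestField n fun x ↦ ρ x • grad n f x := hgf.smul_of_hasCompactSupport hρ1 hc
  -- The term ∫ ρ⟨Φ,∇f⟩ produced by `h1` is removed by testing the weak gradient with ρ∇f, which
  -- leaves Δf with no derivative on φ.
  have h2 := hΦ.integral_eq _ hY
  have hi1 := hΦ.integrable_inner_mul (isTestField_grad hρ hc) hf.continuous
  have hi2 : Integrable (fun x ↦ inner ℝ (Φ x) (ρ x • grad n f x)) (vol n : Measure M) := by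
    simpa using hΦ.integrable_inner_mul hY (continuous_const (y := (1 : ℝ)))
  have hi : ∀ {h : M → ℝ}, Continuous h → (∀ x ∉ tsupport ρ, h x = 0) →
      Integrable h (vol n : Measure M) := fun hh h0 ↦
    hh.integrable_of_hasCompactSupport (HasCompactSupport.intro hc h0)
  have hρ0' : ∀ x ∉ tsupport ρ, ρ x = 0 := fun x hx ↦ image_eq_zero_of_notMem_tsupport hx
  have hi3 : Integrable (fun x ↦ φ x * inner ℝ (grad n f x) (grad n ρ x)) (vol n : Measure M) :=
    hi (hφ.mul (continuous_inner_field hgf (contMDiff_grad hρ)))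
      fun x hx ↦ by rw [grad_eq_zero_of_notMem_tsupport hx, inner_zero_right, mul_zero]
  have hi4 : Integrable (fun x ↦ φ x * (g x * ρ x)) (vol n : Measure M) :=
    hi (hφ.mul (hg.mul hρ.continuous)) fun x hx ↦ by rw [hρ0' x hx, mul_zero, mul_zero]
  have hi5 : Integrable (fun x ↦ V x * φ x * (f x * ρ x)) (vol n : Measure M) :=
    hi ((hV.mul hφ).mul (hf.continuous.mul hρ.continuous))
      fun x hx ↦ by rw [hρ0' x hx, mul_zero, mul_zero]
  have hi6 : Integrable (fun x ↦ φ x * (ρ x * laplacian n f x)) (vol n : Measure M) :=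
    hi (hφ.mul (hρ.continuous.mul (continuous_laplacian hf)))
      fun x hx ↦ by rw [hρ0' x hx, zero_mul, mul_zero]
  have h3 : ∫ x, inner ℝ (Φ x) (grad n (fun x ↦ f x * ρ x) x) ∂(vol n : Measure M) =
      ∫ x, inner ℝ (Φ x) (grad n ρ x) * f x ∂(vol n : Measure M) +
        ∫ x, inner ℝ (Φ x) (ρ x • grad n f x) ∂(vol n : Measure M) := by
    rw [← integral_add hi1 hi2]
    refine integral_congr_ae (Eventually.of_forall fun x ↦ ?_)
    simp only
    rw [grad_mul (hf.mdifferentiable two_ne_zero x) (hρ.mdifferentiable two_ne_zero x),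
      inner_add_right, real_inner_smul_right, mul_comm]
  have h4 : ∫ x, φ x * divergence n (fun x ↦ ρ x • grad n f x) x ∂(vol n : Measure M) =
      ∫ x, φ x * (ρ x * laplacian n f x) ∂(vol n : Measure M) +
        ∫ x, φ x * inner ℝ (grad n f x) (grad n ρ x) ∂(vol n : Measure M) := by
    rw [← integral_add hi6 hi3]
    refine integral_congr_ae (Eventually.of_forall fun x ↦ ?_)
    simp only
    rw [divergence_smul hgf hρ1, real_inner_comm, mul_add]
    rfl
  -- The classical subsolution inequality multiplied by φρ ≥ 0 and integrated.
  have h5 : ∫ x, V x * φ x * (f x * ρ x) ∂(vol n : Measure M) -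
      ∫ x, φ x * (ρ x * laplacian n f x) ∂(vol n : Measure M) +
      ∫ x, φ x * (g x * ρ x) ∂(vol n : Measure M) ≤ 0 := by
    have hi7 : Integrable (fun x ↦ V x * φ x * (f x * ρ x) - φ x * (ρ x * laplacian n f x))
        (vol n : Measure M) := hi5.sub hi6
    rw [← integral_sub hi5 hi6, ← integral_add hi7 hi4]
    refine integral_nonpos fun x ↦ ?_
    have := mul_nonpos_of_nonneg_of_nonpos (mul_nonneg (hpos x).le (hρ0 x)) (hsub x)
    simp only [Pi.zero_apply]
    linarith
  have h1' : 0 ≤ ∫ x, inner ℝ (Φ x) (grad n (fun x ↦ f x * ρ x) x) ∂(vol n : Measure M) +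
    ∫ x, V x * φ x * (f x * ρ x) ∂(vol n : Measure M) := h1
  have hi8 : Integrable (fun x ↦ φ x * inner ℝ (grad n f x) (grad n ρ x) -
      inner ℝ (Φ x) (grad n ρ x) * f x) (vol n : Measure M) := hi3.sub hi1
  rw [integral_add hi8 hi4, integral_sub hi3 hi1]
  linarith

theorem grad_eq_zero_of_notMem_tsupport_prod {ψ : M × ℝ → ℝ} {p : M × ℝ} (hp : p ∉ tsupport ψ) :
    grad n (fun y ↦ ψ (y, p.2)) p.1 = 0 := by
  have hcl : IsClosed {x | (x, p.2) ∈ tsupport ψ} :=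
    (isClosed_tsupport ψ).preimage (by fun_prop : Continuous fun x : M ↦ (x, p.2))
  exact grad_eq_zero_of_notMem_tsupport fun h ↦
    hp (closure_minimal (s := Function.support fun y ↦ ψ (y, p.2))
      (fun x hx ↦ subset_tsupport ψ hx) hcl h)

/-- `Φ` need not be locally bounded, so continuity does not help. The integrand is dominated by B‖Φ‖
on the projection of supp ψ to M, where ‖Φ‖ is integrable. -/
theorem IsH1Loc.integrable_inner_grad_mul (hΦ : IsH1Loc n (vol n) φ Φ) {ψ : M × ℝ → ℝ}
    (hψ : IsJointC1 n T fun x t ↦ ψ (x, t)) (hc : HasCompactSupport ψ)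
    (hs : tsupport ψ ⊆ univ ×ˢ Ioo 0 T)
    (hu : ContinuousOn (fun p : M × ℝ ↦ u p.1 p.2) (univ ×ˢ Ioo 0 T)) :
    Integrable (fun p : M × ℝ ↦ inner ℝ (Φ p.1) (grad n (fun y ↦ ψ (y, p.2)) p.1) * u p.1 p.2)
      ((vol n : Measure M).prod (volume.restrict (Ioo 0 T))) := by
  have := ChartedSpace.secondCountable_of_sigmaCompact (E n) M
  have := sigmaFinite_vol (n := n) (M := M)
  have hK : IsCompact (Prod.fst '' tsupport ψ) := hc.isCompact.image continuous_fst
  have hb := continuous_and_hasCompactSupport hc hs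
    (F := fun p : M × ℝ ↦ ‖grad n (fun y ↦ ψ (y, p.2)) p.1‖ * u p.1 p.2)
    (hψ.continuousOn_norm_grad.mul hu)
    fun p hp ↦ by simp only [grad_eq_zero_of_notMem_tsupport_prod hp, norm_zero, zero_mul]
  obtain ⟨B, hB⟩ := hb.2.exists_bound_of_continuous hb.1
  have hΦB : IntegrableOn (fun x ↦ B * ‖Φ x‖) (Prod.fst '' tsupport ψ) (vol n : Measure M) :=
    (hΦ.integrableOn_norm hK).const_mul B
  have hΦK := hΦB.integrable_indicator hK.measurableSet
  refine Integrable.mono' (hΦK.comp_fst (volume.restrict (Ioo 0 T)))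
    ((hψ.aestronglyMeasurable_inner_grad hΦ.aestronglyMeasurable).mul
      (aestronglyMeasurable_prod_of_continuousOn measurableSet_Ioo hu))
    (Eventually.of_forall fun p ↦ ?_)
  by_cases hp : p ∈ tsupport ψ
  · rw [indicator_of_mem (mem_image_of_mem Prod.fst hp), norm_mul]
    calc _ ≤ ‖Φ p.1‖ * ‖grad n (fun y ↦ ψ (y, p.2)) p.1‖ * ‖u p.1 p.2‖ :=
          mul_le_mul_of_nonneg_right (abs_real_inner_le_norm _ _) (norm_nonneg _)
      _ = ‖Φ p.1‖ * ‖‖grad n (fun y ↦ ψ (y, p.2)) p.1‖ * u p.1 p.2‖ := by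
          rw [norm_mul, norm_norm, mul_assoc]
      _ ≤ ‖Φ p.1‖ * B := mul_le_mul_of_nonneg_left (hB p) (norm_nonneg _)
      _ = B * ‖Φ p.1‖ := mul_comm _ _
  · rw [grad_eq_zero_of_notMem_tsupport_prod hp, inner_zero_right, zero_mul, norm_zero]
    exact indicator_nonneg (fun x _ ↦ mul_nonneg ((norm_nonneg _).trans (hB p)) (norm_nonneg _)) _

/-- The weak inequality for the quotient of a subsolution and a supersolution. -/
theorem integral_quotGrad_le_zero (hΦ : IsH1Loc n (vol n) φ Φ) (hφ : Continuous φ)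
    (hpos : ∀ x, 0 < φ x) (hV : Continuous V)
    (hsup : ∀ η ∈ testFunctions n M, (∀ x, 0 ≤ η x) →
      0 ≤ ∫ x, inner ℝ (Φ x) (grad n η x) ∂(vol n : Measure M) + ∫ x, V x * φ x * η x ∂(vol n))
    (hu : IsClassicalSubsolution n V T u) (hu0 : ∀ x, ∀ t ∈ Ioo 0 T, 0 ≤ u x t)
    {ψ : M × ℝ → ℝ} (hψ : ContMDiff ((𝓡 n).prod 𝓘(ℝ, ℝ)) 𝓘(ℝ, ℝ) ∞ ψ)
    (hc : HasCompactSupport ψ) (hs : tsupport ψ ⊆ univ ×ˢ Ioo 0 T) (hψ0 : ∀ p, 0 ≤ ψ p) :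
    ∫ p : M × ℝ, (-(u p.1 p.2 / φ p.1) * deriv (fun s ↦ ψ (p.1, s)) p.2 +
        inner ℝ (quotGrad n (fun y ↦ u y p.2) φ Φ p.1) (grad n (fun y ↦ ψ (y, p.2)) p.1))
      ∂((weightedVol n φ).prod (volume.restrict (Ioo 0 T))) ≤ 0 := by
  have := ChartedSpace.secondCountable_of_sigmaCompact (E n) M
  have := isLocallyFiniteMeasure_vol (n := n) (M := M)
  have := sigmaFinite_vol (n := n) (M := M)
  have hj := hu.isC21.isJointC1
  have hjψ := isJointC1_of_contMDiff (T := T) hψ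
  have hψd : ∀ x t, DifferentiableAt ℝ (fun s ↦ ψ (x, s)) t := fun x t ↦ by
    have h1 : ContMDiff 𝓘(ℝ, ℝ) 𝓘(ℝ, ℝ) ∞ fun s ↦ ψ (x, s) :=
      hψ.comp (contMDiff_const.prodMk contMDiff_id)
    exact (contMDiff_iff_contDiff.1 h1).differentiable (by simp) t
  have hz : ∀ p ∉ tsupport ψ, ψ p = 0 := fun p hp ↦ image_eq_zero_of_notMem_tsupport hp
  have hz' : ∀ p ∉ tsupport ψ, deriv (fun s ↦ ψ (p.1, s)) p.2 = 0 := fun p hp ↦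
    deriv_time_eq_zero_of_notMem_tsupport hp
  have hψ' := continuous_deriv_time hψ
  have hle : (vol n : Measure M).prod (volume.restrict (Ioo 0 T)) ≤
      (vol n : Measure M).prod volume :=
    Measure.prod_mono le_rfl Measure.restrict_le_self
  have hgg := continuous_and_hasCompactSupport hc hs
    (F := fun p : M × ℝ ↦ φ p.1 * inner ℝ (grad n (fun y ↦ u y p.2) p.1)
      (grad n (fun y ↦ ψ (y, p.2)) p.1))
    ((hφ.comp continuous_fst).continuousOn.mul (hj.continuousOn_inner_grad_grad hjψ))
    fun p hp ↦ by simp only [grad_eq_zero_of_notMem_tsupport_prod hp, inner_zero_right, mul_zero]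
  have hi1 : Integrable (fun p : M × ℝ ↦ φ p.1 * inner ℝ (grad n (fun y ↦ u y p.2) p.1)
      (grad n (fun y ↦ ψ (y, p.2)) p.1)) ((vol n : Measure M).prod (volume.restrict (Ioo 0 T))) :=
    (hgg.1.integrable_of_hasCompactSupport hgg.2).mono_measure hle
  have hi2 := integrable_mul_of_tsupport (m := (vol n : Measure M)) hφ hc hs hj.continuousOn hψ' hz'
  have hi4 := integrable_mul_of_tsupport (m := (vol n : Measure M)) hφ hc hs
    hu.isC21.continuousOn_deriv hψ.continuous hz
  have hi3 := hΦ.integrable_inner_grad_mul hjψ hc hs hj.continuousOn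
  have key := integral_deriv_time_mul_add (m := (vol n : Measure M)) hφ hψ.continuous
    hψd hψ' hc hs hj.continuousOn hu.isC21.differentiableAt hu.isC21.continuousOn_deriv
  have hrestrict : ∀ {F : M × ℝ → ℝ}, Integrable F ((vol n : Measure M).prod volume) →
      (∀ p ∉ tsupport ψ, F p = 0) → ∫ p, F p ∂((vol n : Measure M).prod volume) =
        ∫ p, F p ∂((vol n : Measure M).prod (volume.restrict (Ioo 0 T))) := fun hF h0 ↦ by
    rw [integral_prod_eq_setIntegral (T := T) hF fun x t ht ↦ h0 _ fun h ↦ ht (hs h).2,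
      integral_prod_symm _ (hF.mono_measure hle)]
  rw [hrestrict hi4 fun p hp ↦ by rw [hz p hp, mul_zero, mul_zero],
    hrestrict hi2 fun p hp ↦ by rw [hz' p hp, mul_zero, mul_zero]] at key
  have hi2' := hi2.mono_measure hle
  have hi4' := hi4.mono_measure hle
  -- The weight φ² clears all denominators of w and of its weak gradient.
  have heq : ∀ p : M × ℝ, φ p.1 ^ 2 * (-(u p.1 p.2 / φ p.1) * deriv (fun s ↦ ψ (p.1, s)) p.2 +
        inner ℝ (quotGrad n (fun y ↦ u y p.2) φ Φ p.1) (grad n (fun y ↦ ψ (y, p.2)) p.1)) =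
      φ p.1 * inner ℝ (grad n (fun y ↦ u y p.2) p.1) (grad n (fun y ↦ ψ (y, p.2)) p.1) -
        inner ℝ (Φ p.1) (grad n (fun y ↦ ψ (y, p.2)) p.1) * u p.1 p.2 -
      φ p.1 * (u p.1 p.2 * deriv (fun s ↦ ψ (p.1, s)) p.2) := by
    intro p
    have := (hpos p.1).ne'
    rw [inner_quotGrad]
    field_simp
    ring
  have hslice : ∀ t ∈ Ioo 0 T, ∫ x, (φ x * inner ℝ (grad n (fun y ↦ u y t) x)
      (grad n (fun y ↦ ψ (y, t)) x) - inner ℝ (Φ x) (grad n (fun y ↦ ψ (y, t)) x) * u x t +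
      φ x * (deriv (u x) t * ψ (x, t))) ∂(vol n : Measure M) ≤ 0 := by
    intro t ht
    have hderiv : Continuous fun x ↦ deriv (u x) t := by
      rw [← continuousOn_univ]
      exact hu.isC21.continuousOn_deriv.comp
        (by fun_prop : Continuous fun x : M ↦ (x, t)).continuousOn fun x _ ↦ ⟨mem_univ x, ht⟩
    have hρ : ContMDiff (𝓡 n) 𝓘(ℝ, ℝ) ∞ fun x ↦ ψ (x, t) :=
      hψ.comp (contMDiff_id.prodMk contMDiff_const)
    have hρc : HasCompactSupport fun x ↦ ψ (x, t) :=
      HasCompactSupport.intro (hc.isCompact.image continuous_fst) fun x hx ↦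
        hz (x, t) fun h ↦ hx ⟨(x, t), h, rfl⟩
    exact integral_le_zero_of_subsolution hΦ hφ hpos hV hsup (hu.isC21.contMDiff t ht)
      (fun x ↦ hu0 x t ht) hderiv (fun x ↦ hu.le_zero x t ht) (hρ.of_le two_le_smooth) hρc
      fun x ↦ hψ0 (x, t)
  rw [integral_weightedVol_prod hφ]
  simp only [heq]
  exact integral_sub_le_zero_of_slice hi1 hi3 hi4' hi2' key hslice

end Main

end RiemHeat

end

theorem proposition4p2 (n : ℕ) {M : Type*} [MetricSpace M] [ChartedSpace (RiemHeat.E n) M]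
    [IsManifold (𝓡 n) ∞ M]
    [RiemannianBundle (fun x : M ↦ TangentSpace (𝓡 n) x)]
    [IsContMDiffRiemannianBundle (𝓡 n) ∞ (RiemHeat.E n) (fun x : M ↦ TangentSpace (𝓡 n) x)]
    [IsRiemannianManifold (𝓡 n) M]
    [ConnectedSpace M] [CompleteSpace M] [NoncompactSpace M]
    [MeasurableSpace M] [BorelSpace M]
    (T : ℝ) (hT : 0 < T)
    (V : M → ℝ) (hV : ContMDiff (𝓡 n) 𝓘(ℝ, ℝ) 1 V)
    (u : M → ℝ → ℝ) (hu : RiemHeat.IsClassicalSubsolution n V T u)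
    (hu_nonneg : ∀ x, ∀ t ∈ Ioo 0 T, 0 ≤ u x t)
    (φ : M → ℝ) (hφ : RiemHeat.IsWeakSupersolution n V φ) (hφ_pos : ∀ x, 0 < φ x) :
    RiemHeat.IsWeakSubsolutionHeat n (RiemHeat.weightedVol n φ) T (fun x t ↦ u x t / φ x) := by
  -- Charts give local compactness and the metric gives paracompactness; with connectedness, M is
  -- σ-compact, as the lemmas above require.
  have := ChartedSpace.locallyCompactSpace (RiemHeat.E n) M
  have := sigmaCompactSpace_of_connected M
  obtain ⟨hφc, Φ, hΦ, hsup⟩ := hφ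
  exact ⟨fun x t ↦ RiemHeat.quotGrad n (fun y ↦ u y t) φ Φ x,
    hΦ.isL2LocH1Loc_quotGrad hφc hφ_pos hu.isC21,
    hu.isC21.timeDerivL1LocHNegOneLoc hφc hφ_pos,
    fun ψ hψ hc hs hψ0 ↦ RiemHeat.integral_quotGrad_le_zero hΦ hφc hφ_pos hV.continuous hsup hu
      hu_nonneg hψ hc hs hψ0⟩
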